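/- Let $G=\mathrm{GL}_3(\mathbb R)$ and $H=\mathrm{GL}_2(\mathbb R)$, embedded in $G$ by $h\mapsto\mathrm{diag}(h,1)$, and let $P_G,P_H$ be the subgroups of invertible upper triangular matrices. For $\xi\in\mathbb Z/2\mathbb Z$, $s\in\mathbb C$, $x\in\mathbb R^\times$ put $|x|_\xi^s=\mathrm{sgn}(x)^\xi|x|^s$. For $\xi\in(\mathbb Z/2\mathbb Z)^3$, $\lambda\in\mathbb C^3$ let $\pi_{\xi,\lambda}$ be the left regular representation of $G$ on the smooth functions $f:G\to\mathbb C$ with $$f(gp)=|x_1|_{\xi_1}^{-\lambda_1-1}|x_2|_{\xi_2}^{-\lambda_2}|x_3|_{\xi_3}^{-\lambda_3+1}f(g)\qquad(p\in P_G\text{ with diagonal }(x_1,x_2,x_3)),$$ and for $\eta\in(\mathbb Z/2\mathbb Z)^2$, $\nu\in\mathbb C^2$ let $\tau_{\eta,\nu}$ be the left regular representation of $H$ on the smooth functions $f:H\to\mathbb C$ with $f(hp)=|x_1|_{\eta_1}^{-\nu_1-\frac12}|x_2|_{\eta_2}^{-\nu_2+\frac12}f(h)$ for $p\in P_H$ with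 diagonal $(x_1,x_2)$; both carry the $C^\infty$ topology. Let $\mathrm{DSBO}_2(\pi_{\xi,\lambda},\tau_{\eta,\nu})$ be the complex vector space of continuous $H$-intertwining linear maps $T:\pi_{\xi,\lambda}\to\tau_{\eta,\nu}$ with $p_2(\mathrm{supp}\,Tf)\subset\mathrm{supp}\,f$ for all $f$, where supports are taken in $H/P_H$ and $G/P_G$ (functions being viewed as sections of line bundles) and $p_2:H/P_H\to G/P_G$, $hP_H\mapsto hP_G$. Let $\varepsilon^{i,j}$ (on $G$) and $\varepsilon_H^{i,j}$ (on $H$) denote the derivative of the right regular action in the direction of the elementary matrix $E_{i,j}$, that is $\varepsilon^{i,j}f(g)=\sum_k g_{ki}\,\partial_{kj}f(g)$. Let $\Psi_3,\Psi_2,\Psi_1$ be the minors of $g\in G$ with rows $1,2$ and columns $\{1,2\}$, $\{1,3\}$, $\{2,3\}$ respectively, let $\lambda_{i,j}=\lambda_i-\lambda_j-1$, and put $$\mathcal F_2(\lambda)=\Psi_3\,\varepsilon^{3,2}-\lambda_{3,2}\Psi_2,\qquad \mathcal F_1(\lambda)=\Psi_3(\varepsilon^{3,2}\varepsilon^{2,1}+\lambda_{2,1}\varepsilon^{3,1})-\lambda_{3,1}\Psi_2\,\varepsilon^{2,1}+\lambda_{3,1}\lambda_{2,1}\Psi_1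 .$$ With $\hat e_1=(0,1,1)$, $\hat e_2=(1,0,1)$ let $\mathcal F_j^{\alpha}=\mathcal F_j(\lambda-(\alpha-1)\hat e_j)\circ\cdots\circ\mathcal F_j(\lambda-\hat e_j)\circ\mathcal F_j(\lambda)$ and, in a composition $\mathcal F_1^{a}\circ\mathcal F_2^{b}$ applied to $\pi_{\xi,\lambda}$, let $\mathcal F_2^b$ be taken at $\lambda$ and $\mathcal F_1^a$ at $\lambda-b\hat e_2$. Let $\mathrm{rest}_2$ be the restriction of functions from $G$ to $H$, and $\det_H^{-m}$ the multiplication of functions on $H$ by $h\mapsto\det(h)^{-m}$. **Proposition.** Suppose that $n_1:=\nu_1-\lambda_1-\frac12$ and $n_2:=\nu_1+\nu_2-\lambda_1-\lambda_2-1$ are non-negative integers and that, in $\mathbb Z/2\mathbb Z$, $\eta_1=\xi_1+n_1$ and $\eta_2=\xi_2+n_1+n_2$. 1. If $n_1\le n_2$, then $\mathrm{DSBO}_2(\pi_{\xi,\lambda},\tau_{\eta,\nu})$ has as a basis the single operator $$\textstyle\det_H^{-n_2}\circ\,\mathrm{rest}_2\circ\mathcal F_1^{n_1}\circ\mathcal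 F_2^{n_2-n_1}.$$ 2. If $n_1>n_2$ and $k_0$ is an integer with $0\le k_0\le n_2$ and $\lambda_1-\lambda_2+n_1-n_2+k_0=0$, then $\mathrm{DSBO}_2(\pi_{\xi,\lambda},\tau_{\eta,\nu})$ has as a basis the single operator $$\textstyle\det_H^{-n_2}\circ\,(\varepsilon_H^{2,1})^{n_1-k_0}\circ\mathrm{rest}_2\circ\mathcal F_1^{k_0}\circ\mathcal F_2^{n_2-k_0}.$$ -/

import Mathlib

open scoped ContDiff Matrix

attribute [local instance] Matrix.normedAddCommGroup Matrix.normedSpace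

noncomputable section

/-- The function on all real `n × n` matrices that equals `f` on the open set `GL(n, ℝ)` of
invertible matrices and `0` elsewhere. It is only ever differentiated at invertible matrices. -/
def extendGL {n : ℕ} (f : GL (Fin n) ℝ → ℂ) : Matrix (Fin n) (Fin n) ℝ → ℂ :=
  Function.extend Units.val f 0

/-- `f` is a smooth function on the open subset `GL(n, ℝ)` of the space of matrices. -/
def SmoothGL {n : ℕ} (f : GL (Fin n) ℝ → ℂ) : Prop :=
  ContDiffOn ℝ ∞ (extendGL f) {M | IsUnit M}

/-- The minimal parabolic subgroup of `GL(n, ℝ)`: invertible upper triangular matrices. -/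
def borelGL (n : ℕ) : Subgroup (GL (Fin n) ℝ) where
  carrier := {g | (g : Matrix (Fin n) (Fin n) ℝ).BlockTriangular id}
  mul_mem' := fun {a b} ha hb => by
    have h := Matrix.BlockTriangular.mul ha hb
    simpa using h
  one_mem' := by
    simpa using (Matrix.blockTriangular_one :
      Matrix.BlockTriangular (1 : Matrix (Fin n) (Fin n) ℝ) id)
  inv_mem' := fun {a} ha => by
    have h : ((a : Matrix (Fin n) (Fin n) ℝ)⁻¹).BlockTriangular id := by
      have : Invertible (a : Matrix (Fin n) (Fin n) ℝ) := a.invertible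
      exact Matrix.blockTriangular_inv_of_blockTriangular ha
    simpa [Matrix.coe_units_inv] using h

/-- `|x|_ξ^s = sgn(x)^ξ |x|^s` for `x ≠ 0`. -/
def signedPow (ξ : ZMod 2) (s : ℂ) (x : ℝ) : ℂ :=
  ((SignType.sign x : ℝ) : ℂ) ^ ξ.val * ((|x| : ℝ) : ℂ) ^ s

/-- The coordinates of `ρ = ½ (n - 1, n - 3, …, 1 - n)`. -/
def rhoGL (n : ℕ) (i : Fin n) : ℂ := ((n : ℂ) - 1 - 2 * (i : ℕ)) / 2

/-- The character of the group of upper triangular matrices `p = m a n'` with diagonal entries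
`x₁, …, xₙ` by which the functions in the principal series transform:
`∏ |xᵢ|_{ξᵢ}^{-λᵢ - ρᵢ}`. -/
def inducingChar {n : ℕ} (ξ : Fin n → ZMod 2) (lam : Fin n → ℂ) (p : GL (Fin n) ℝ) : ℂ :=
  ∏ i, signedPow (ξ i) (-lam i - rhoGL n i) ((p : Matrix (Fin n) (Fin n) ℝ) i i)

section basic

variable {n : ℕ}

theorem extendGL_coe (f : GL (Fin n) ℝ → ℂ) (g : GL (Fin n) ℝ) :
    extendGL f (g : Matrix (Fin n) (Fin n) ℝ) = f g :=
  Units.val_injective.extend_apply _ _ _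

theorem extendGL_add (f₁ f₂ : GL (Fin n) ℝ → ℂ) :
    extendGL (f₁ + f₂) = extendGL f₁ + extendGL f₂ := by
  funext M
  by_cases h : ∃ g : GL (Fin n) ℝ, (g : Matrix (Fin n) (Fin n) ℝ) = M
  · obtain ⟨g, rfl⟩ := h
    simp [extendGL_coe]
  · simp [extendGL, Function.extend_apply' _ _ _ h]

theorem extendGL_smul (c : ℂ) (f : GL (Fin n) ℝ → ℂ) :
    extendGL (c • f) = c • extendGL f := by
  funext M
  by_cases h : ∃ g : GL (Fin n) ℝ, (g : Matrix (Fin n) (Fin n) ℝ) = M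
  · obtain ⟨g, rfl⟩ := h
    simp [extendGL_coe]
  · simp [extendGL, Function.extend_apply' _ _ _ h]

theorem extendGL_zero : extendGL (0 : GL (Fin n) ℝ → ℂ) = 0 := by
  have h := extendGL_smul (0 : ℂ) (0 : GL (Fin n) ℝ → ℂ)
  simpa using h

theorem isOpen_units_matrix : IsOpen {M : Matrix (Fin n) (Fin n) ℝ | IsUnit M} := by
  have h : {M : Matrix (Fin n) (Fin n) ℝ | IsUnit M} = {M | M.det ≠ 0} := by
    ext M
    simp [Matrix.isUnit_iff_isUnit_det]
  rw [h]
  exact isOpen_ne_fun (Continuous.matrix_det continuous_id) continuous_const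

theorem SmoothGL.contDiffAt {f : GL (Fin n) ℝ → ℂ} (hf : SmoothGL f) (g : GL (Fin n) ℝ) :
    ContDiffAt ℝ ∞ (extendGL f) (g : Matrix (Fin n) (Fin n) ℝ) :=
  ContDiffOn.contDiffAt hf (isOpen_units_matrix.mem_nhds g.isUnit)

theorem SmoothGL.add {f₁ f₂ : GL (Fin n) ℝ → ℂ} (h₁ : SmoothGL f₁) (h₂ : SmoothGL f₂) :
    SmoothGL (f₁ + f₂) := by
  unfold SmoothGL
  rw [extendGL_add]
  exact ContDiffOn.add h₁ h₂

theorem SmoothGL.smul (c : ℂ) {f : GL (Fin n) ℝ → ℂ} (hf : SmoothGL f) : SmoothGL (c • f) := by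
  unfold SmoothGL
  rw [extendGL_smul]
  exact ContDiffOn.const_smul c hf

theorem SmoothGL.leftTranslate {f : GL (Fin n) ℝ → ℂ} (hf : SmoothGL f) (a : GL (Fin n) ℝ) :
    SmoothGL (fun g => f (a * g)) := by
  have hlin : ContDiff ℝ ∞ (fun M : Matrix (Fin n) (Fin n) ℝ =>
      (a : Matrix (Fin n) (Fin n) ℝ) * M) :=
    (LinearMap.toContinuousLinearMap
      (LinearMap.mulLeft ℝ (a : Matrix (Fin n) (Fin n) ℝ))).contDiff
  have hcomp : ContDiffOn ℝ ∞ (fun M : Matrix (Fin n) (Fin n) ℝ =>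
      extendGL f ((a : Matrix (Fin n) (Fin n) ℝ) * M)) {M | IsUnit M} :=
    ContDiffOn.comp (t := {M | IsUnit M}) hf hlin.contDiffOn
      (fun M (hM : IsUnit M) => a.isUnit.mul hM)
  refine hcomp.congr ?_
  rintro M ⟨g, rfl⟩
  rw [extendGL_coe, ← Units.val_mul, extendGL_coe]

end basic

/-- The space of the principal series representation attached to `(ξ, λ)`: the smooth functions
on `GL(n, ℝ)` that transform on the right under upper triangular matrices by `inducingChar`. -/
def principalSeriesSubmodule (n : ℕ) (ξ : Fin n → ZMod 2) (lam : Fin n → ℂ) :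
    Submodule ℂ (GL (Fin n) ℝ → ℂ) where
  carrier := {f | SmoothGL f ∧
    ∀ g : GL (Fin n) ℝ, ∀ p ∈ borelGL n, f (g * p) = inducingChar ξ lam p * f g}
  add_mem' := by
    rintro f₁ f₂ ⟨h₁, e₁⟩ ⟨h₂, e₂⟩
    refine ⟨h₁.add h₂, fun g p hp => ?_⟩
    simp only [Pi.add_apply, e₁ g p hp, e₂ g p hp, mul_add]
  zero_mem' := by
    refine ⟨?_, fun g p _ => by simp⟩
    unfold SmoothGL
    rw [extendGL_zero]
    exact contDiffOn_const
  smul_mem' := by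
    rintro c f ⟨h, e⟩
    refine ⟨h.smul c, fun g p hp => ?_⟩
    simp only [Pi.smul_apply, e g p hp, smul_eq_mul]
    ring

/-- The same space as a type, so that it can carry the `C^∞` topology (and not the topology of
pointwise convergence). -/
def PrincipalSeries (n : ℕ) (ξ : Fin n → ZMod 2) (lam : Fin n → ℂ) : Type :=
  ↥(principalSeriesSubmodule n ξ lam)

section principalSeries

variable {n : ℕ} {ξ : Fin n → ZMod 2} {lam : Fin n → ℂ}

instance : AddCommGroup (PrincipalSeries n ξ lam) :=
  inferInstanceAs (AddCommGroup ↥(principalSeriesSubmodule n ξ lam))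

instance : Module ℂ (PrincipalSeries n ξ lam) :=
  inferInstanceAs (Module ℂ ↥(principalSeriesSubmodule n ξ lam))

/-- The function on `GL(n, ℝ)` underlying an element of the principal series. -/
def PrincipalSeries.toFun (f : PrincipalSeries n ξ lam) : GL (Fin n) ℝ → ℂ :=
  (show ↥(principalSeriesSubmodule n ξ lam) from f).1

instance : CoeFun (PrincipalSeries n ξ lam) (fun _ => GL (Fin n) ℝ → ℂ) :=
  ⟨PrincipalSeries.toFun⟩

theorem PrincipalSeries.ext {f₁ f₂ : PrincipalSeries n ξ lam} (h : ∀ g, f₁ g = f₂ g) :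
    f₁ = f₂ :=
  Subtype.ext (funext h)

theorem PrincipalSeries.smooth (f : PrincipalSeries n ξ lam) : SmoothGL f.toFun := f.2.1

theorem PrincipalSeries.equivariant (f : PrincipalSeries n ξ lam) (g : GL (Fin n) ℝ)
    {p : GL (Fin n) ℝ} (hp : p ∈ borelGL n) : f (g * p) = inducingChar ξ lam p * f g :=
  f.2.2 g p hp

theorem PrincipalSeries.coe_add (f₁ f₂ : PrincipalSeries n ξ lam) :
    (f₁ + f₂).toFun = f₁.toFun + f₂.toFun := rfl

theorem PrincipalSeries.coe_smul (c : ℂ) (f : PrincipalSeries n ξ lam) :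
    (c • f).toFun = c • f.toFun := rfl

theorem PrincipalSeries.bddAbove (m : ℕ) (K : TopologicalSpace.Compacts (GL (Fin n) ℝ))
    (f : PrincipalSeries n ξ lam) :
    BddAbove (Set.range fun g : K =>
      ‖iteratedFDeriv ℝ m (extendGL f.toFun) ((g : GL (Fin n) ℝ) : Matrix (Fin n) (Fin n) ℝ)‖) := by
  have hc : Continuous fun g : GL (Fin n) ℝ =>
      ‖iteratedFDeriv ℝ m (extendGL f.toFun) (g : Matrix (Fin n) (Fin n) ℝ)‖ := by
    refine continuous_iff_continuousAt.2 fun g => ?_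
    have h1 : ContinuousAt (iteratedFDeriv ℝ m (extendGL f.toFun))
        (g : Matrix (Fin n) (Fin n) ℝ) :=
      ((f.smooth.contDiffAt g).iteratedFDeriv_right (m := 0) (i := m) (by
        rw [zero_add]; exact_mod_cast le_top)).continuousAt
    exact (h1.comp (f := (Units.val : GL (Fin n) ℝ → Matrix (Fin n) (Fin n) ℝ))
      Units.continuous_val.continuousAt).norm
  obtain ⟨C, hC⟩ := K.isCompact.bddAbove_image hc.continuousOn
  refine ⟨C, ?_⟩
  rintro _ ⟨g, rfl⟩
  exact hC ⟨g.1, g.2, rfl⟩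

/-- The seminorm `f ↦ sup_{g ∈ K} ‖D^m f(g)‖`, for `K` a compact subset of `GL(n, ℝ)`. -/
def smoothSeminorm (n : ℕ) (ξ : Fin n → ZMod 2) (lam : Fin n → ℂ) :
    SeminormFamily ℂ (PrincipalSeries n ξ lam)
      (ℕ × TopologicalSpace.Compacts (GL (Fin n) ℝ)) := fun mK =>
  Seminorm.of
    (fun f => ⨆ g : mK.2, ‖iteratedFDeriv ℝ mK.1 (extendGL f.toFun)
      ((g : GL (Fin n) ℝ) : Matrix (Fin n) (Fin n) ℝ)‖)
    (by
      intro f₁ f₂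
      rcases isEmpty_or_nonempty mK.2 with hK | hK
      · simp [Real.iSup_of_isEmpty]
      refine ciSup_le fun g => ?_
      rw [PrincipalSeries.coe_add, extendGL_add, iteratedFDeriv_add_apply
        ((f₁.smooth.contDiffAt g).of_le (by exact_mod_cast le_top))
        ((f₂.smooth.contDiffAt g).of_le (by exact_mod_cast le_top))]
      exact (norm_add_le _ _).trans (add_le_add
        (le_ciSup (PrincipalSeries.bddAbove mK.1 mK.2 f₁) g)
        (le_ciSup (PrincipalSeries.bddAbove mK.1 mK.2 f₂) g)))
    (by
      intro c f
      rw [Real.mul_iSup_of_nonneg (norm_nonneg c)]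
      refine iSup_congr fun g => ?_
      rw [PrincipalSeries.coe_smul, extendGL_smul, iteratedFDeriv_const_smul_apply
        ((f.smooth.contDiffAt g).of_le (by exact_mod_cast le_top)), norm_smul])

/-- The Fréchet topology of `C^∞(GL(n, ℝ))`: uniform convergence of all derivatives on compact
subsets of `GL(n, ℝ)`. -/
instance : TopologicalSpace (PrincipalSeries n ξ lam) :=
  (smoothSeminorm n ξ lam).moduleFilterBasis.topology

theorem PrincipalSeries.withSeminorms : WithSeminorms (smoothSeminorm n ξ lam) := ⟨rfl⟩

instance : IsTopologicalAddGroup (PrincipalSeries n ξ lam) :=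
  PrincipalSeries.withSeminorms.topologicalAddGroup

instance : ContinuousSMul ℂ (PrincipalSeries n ξ lam) :=
  PrincipalSeries.withSeminorms.continuousSMul

/-- The left regular action of `GL(n, ℝ)` on the principal series: `(a · f)(g) = f (a⁻¹ g)`. -/
def leftRegular (n : ℕ) (ξ : Fin n → ZMod 2) (lam : Fin n → ℂ) :
    Representation ℂ (GL (Fin n) ℝ) (PrincipalSeries n ξ lam) where
  toFun a :=
    { toFun := fun f => ⟨fun g => f (a⁻¹ * g), f.smooth.leftTranslate a⁻¹, fun g p hp => by
        have h := f.equivariant (a⁻¹ * g) hp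
        rwa [mul_assoc] at h⟩
      map_add' := fun _ _ => rfl
      map_smul' := fun _ _ => rfl }
  map_one' := by
    refine LinearMap.ext fun f => PrincipalSeries.ext fun g => ?_
    change f (1⁻¹ * g) = f g
    simp
  map_mul' a b := by
    refine LinearMap.ext fun f => PrincipalSeries.ext fun g => ?_
    change f ((a * b)⁻¹ * g) = f (b⁻¹ * (a⁻¹ * g))
    rw [mul_inv_rev, mul_assoc]

/-- The support of `f`, viewed as a section of a line bundle over the flag variety
`GL(n, ℝ) / P`: the closure of the set of cosets on which `f` does not vanish. -/
def sectionSupport (f : PrincipalSeries n ξ lam) : Set (GL (Fin n) ℝ ⧸ borelGL n) :=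
  closure ((fun g : GL (Fin n) ℝ => (g : GL (Fin n) ℝ ⧸ borelGL n)) '' Function.support f.toFun)

theorem sectionSupport_add (f₁ f₂ : PrincipalSeries n ξ lam) :
    sectionSupport (f₁ + f₂) ⊆ sectionSupport f₁ ∪ sectionSupport f₂ := by
  unfold sectionSupport
  rw [← closure_union, ← Set.image_union]
  exact closure_mono (Set.image_mono (Function.support_add f₁.toFun f₂.toFun))

theorem sectionSupport_smul (c : ℂ) (f : PrincipalSeries n ξ lam) :
    sectionSupport (c • f) ⊆ sectionSupport f := by
  unfold sectionSupport
  exact closure_mono (Set.image_mono (Function.support_const_smul_subset c f.toFun))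

theorem sectionSupport_zero : sectionSupport (0 : PrincipalSeries n ξ lam) = ∅ := by
  have h : Function.support (0 : PrincipalSeries n ξ lam).toFun = ∅ := Function.support_zero
  simp [sectionSupport, h]

end principalSeries

/-- The embedding `h ↦ diag(h, 1)` of `2 × 2` matrices into `3 × 3` matrices. -/
def embedMatrix : Matrix (Fin 2) (Fin 2) ℝ →* Matrix (Fin 3) (Fin 3) ℝ where
  toFun h := !![h 0 0, h 0 1, 0; h 1 0, h 1 1, 0; 0, 0, 1]
  map_one' := by
    ext i j
    fin_cases i <;> fin_cases j <;> simp
  map_mul' a b := by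
    ext i j
    fin_cases i <;> fin_cases j <;> simp [Matrix.mul_apply, Fin.sum_univ_succ]

/-- The embedding of `H = GL(2, ℝ)` into `G = GL(3, ℝ)`. -/
def embedGL : GL (Fin 2) ℝ →* GL (Fin 3) ℝ := Units.map embedMatrix

theorem embedGL_mem_borel {p : GL (Fin 2) ℝ} (hp : p ∈ borelGL 2) :
    embedGL p ∈ borelGL 3 := by
  have h10 : (p : Matrix (Fin 2) (Fin 2) ℝ) 1 0 = 0 := hp (by decide)
  intro i j hij
  fin_cases i <;> fin_cases j <;> simp_all [embedGL, embedMatrix]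

/-- The map `p₂ : H/P_H → G/P_G`, `h P_H ↦ h x₂ P_G`, where `x₂` is the identity matrix. -/
def flagMap : GL (Fin 2) ℝ ⧸ borelGL 2 → GL (Fin 3) ℝ ⧸ borelGL 3 :=
  Quotient.map' embedGL fun a b hab => by
    rw [QuotientGroup.leftRel_apply] at hab ⊢
    rw [← map_inv, ← map_mul]
    exact embedGL_mem_borel hab

/-- The space `DSBO₂(π_{ξ,λ}, τ_{η,ν})` of `p₂`-differential symmetry breaking operators:
continuous linear maps `T` from the principal series of `GL(3, ℝ)` to that of `GL(2, ℝ)` that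
intertwine the actions of `GL(2, ℝ)` and satisfy `p₂(supp T f) ⊆ supp f` for all `f`. -/
def DSBO₂ (ξ : Fin 3 → ZMod 2) (lam : Fin 3 → ℂ) (η : Fin 2 → ZMod 2) (nu : Fin 2 → ℂ) :
    Submodule ℂ (PrincipalSeries 3 ξ lam →L[ℂ] PrincipalSeries 2 η nu) where
  carrier := {T |
    (∀ (h : GL (Fin 2) ℝ) (f : PrincipalSeries 3 ξ lam),
      T (leftRegular 3 ξ lam (embedGL h) f) = leftRegular 2 η nu h (T f)) ∧
    ∀ f : PrincipalSeries 3 ξ lam, flagMap '' sectionSupport (T f) ⊆ sectionSupport f}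
  add_mem' := by
    rintro S T ⟨hS, sS⟩ ⟨hT, sT⟩
    refine ⟨fun h f => ?_, fun f => ?_⟩
    · rw [add_apply, add_apply, hS, hT, map_add]
    · rw [add_apply]
      refine (Set.image_mono (sectionSupport_add _ _)).trans ?_
      rw [Set.image_union]
      exact Set.union_subset (sS f) (sT f)
  zero_mem' := by
    refine ⟨fun h f => ?_, fun f => ?_⟩
    · rw [zero_apply, zero_apply, map_zero]
    · rw [zero_apply, sectionSupport_zero, Set.image_empty]
      exact Set.empty_subset _
  smul_mem' := by
    rintro c T ⟨hT, sT⟩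
    refine ⟨fun h f => ?_, fun f => ?_⟩
    · rw [smul_apply, smul_apply, hT, map_smul]
    · rw [smul_apply]
      exact (Set.image_mono (sectionSupport_smul _ _)).trans (sT f)

/-- `ε^{i,j} = dr(E_{i,j})`, the derivative of the right regular action:
`(ε^{i,j} f)(g) = ∑ₖ g_{k,i} ∂_{k,j} f(g)`, i.e. the derivative of `f` at `g` in the direction
`g E_{i,j}`. Rows and columns are numbered from `0`. -/
def epsGL {n : ℕ} (i j : Fin n) (f : GL (Fin n) ℝ → ℂ) : GL (Fin n) ℝ → ℂ := fun g =>
  fderiv ℝ (extendGL f) (g : Matrix (Fin n) (Fin n) ℝ)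
    ((g : Matrix (Fin n) (Fin n) ℝ) * Matrix.single i j (1 : ℝ))

/-- `Ψ₃(g)` is the minor of `g` with rows `1, 2` and columns `1, 2`. -/
def Psi₃ (g : GL (Fin 3) ℝ) : ℂ :=
  (((g : Matrix (Fin 3) (Fin 3) ℝ).submatrix ![0, 1] ![0, 1]).det : ℝ)

/-- `Ψ₂(g) = Ψ₃(g w₂)`, with `w₂` the transposition of the columns `2, 3`: the minor of `g` with
rows `1, 2` and columns `1, 3`. -/
def Psi₂ (g : GL (Fin 3) ℝ) : ℂ :=
  (((g : Matrix (Fin 3) (Fin 3) ℝ).submatrix ![0, 1] ![0, 2]).det : ℝ)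

/-- `Ψ₁(g) = Ψ₂(g w₁)`, with `w₁` the transposition of the columns `1, 2`: the minor of `g` with
rows `1, 2` and columns `2, 3`. -/
def Psi₁ (g : GL (Fin 3) ℝ) : ℂ :=
  (((g : Matrix (Fin 3) (Fin 3) ℝ).submatrix ![0, 1] ![1, 2]).det : ℝ)

/-- `λ_{i,j} = λ_i - λ_j - 1`. -/
def lamDiff (lam : Fin 3 → ℂ) (i j : Fin 3) : ℂ := lam i - lam j - 1

/-- `ê_j = ∑_{k ≠ j} e_k`. -/
def eHat (j : Fin 3) : Fin 3 → ℂ := fun k => if k = j then 0 else 1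

/-- `𝓕₂(λ) = Ψ₃ ε^{3,2} - λ_{3,2} Ψ₂`, the determinant, with the factors of each term in the order
of the columns, of
`[[Ψ₃, λ_{3,2}], [Ψ₂, ε^{3,2}]]`. -/
def sourceF₂ (lam : Fin 3 → ℂ) (f : GL (Fin 3) ℝ → ℂ) : GL (Fin 3) ℝ → ℂ := fun g =>
  Psi₃ g * epsGL 2 1 f g - lamDiff lam 2 1 * Psi₂ g * f g

/-- `𝓕₁(λ) = Ψ₃ (ε^{3,2} ε^{2,1} + λ_{2,1} ε^{3,1}) - λ_{3,1} Ψ₂ ε^{2,1} + λ_{3,1} λ_{2,1} Ψ₁`, the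
determinant, with the factors of each term in the order of the columns, of
`[[Ψ₃, λ_{3,1}, 0], [Ψ₂, ε^{3,2}, λ_{2,1}], [Ψ₁, -ε^{3,1}, ε^{2,1}]]`. -/
def sourceF₁ (lam : Fin 3 → ℂ) (f : GL (Fin 3) ℝ → ℂ) : GL (Fin 3) ℝ → ℂ := fun g =>
  Psi₃ g * (epsGL 2 1 (epsGL 1 0 f) g + lamDiff lam 1 0 * epsGL 2 0 f g)
    - lamDiff lam 2 0 * Psi₂ g * epsGL 1 0 f g
    + lamDiff lam 2 0 * lamDiff lam 1 0 * Psi₁ g * f g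

/-- `𝓕₁^a = 𝓕₁(λ - (a - 1) ê₁) ∘ ⋯ ∘ 𝓕₁(λ - ê₁) ∘ 𝓕₁(λ)`. -/
def sourceF₁Pow : ℕ → (Fin 3 → ℂ) → (GL (Fin 3) ℝ → ℂ) → GL (Fin 3) ℝ → ℂ
  | 0, _, f => f
  | a + 1, lam, f => sourceF₁Pow a (lam - eHat 0) (sourceF₁ lam f)

/-- `𝓕₂^a = 𝓕₂(λ - (a - 1) ê₂) ∘ ⋯ ∘ 𝓕₂(λ - ê₂) ∘ 𝓕₂(λ)`. -/
def sourceF₂Pow : ℕ → (Fin 3 → ℂ) → (GL (Fin 3) ℝ → ℂ) → GL (Fin 3) ℝ → ℂ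
  | 0, _, f => f
  | a + 1, lam, f => sourceF₂Pow a (lam - eHat 1) (sourceF₂ lam f)

/-- The composition `𝓕₁^a ∘ 𝓕₂^b` on functions of the principal series with parameter `λ`; the
operator `𝓕₂^b` replaces `λ` by `λ - b ê₂`. -/
def sourceComp (a b : ℕ) (lam : Fin 3 → ℂ) (f : GL (Fin 3) ℝ → ℂ) : GL (Fin 3) ℝ → ℂ :=
  sourceF₁Pow a (lam - (b : ℂ) • eHat 1) (sourceF₂Pow b lam f)

/-- `rest₂`: restriction to `H`, `f ↦ (h ↦ f (h x₂))` with `x₂` the identity matrix. -/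
def rest₂ (f : GL (Fin 3) ℝ → ℂ) : GL (Fin 2) ℝ → ℂ := fun h => f (embedGL h)

/-- The operator `f ↦ det_H^{-m} f` on functions on `GL(2, ℝ)`. It is the isomorphism
`τ_{η,ν} ⊗ det^m ≃ τ_{(η,ν) + m (1,1)}` of representations of `GL(2, ℝ)`. -/
def untwist (m : ℕ) (f : GL (Fin 2) ℝ → ℂ) : GL (Fin 2) ℝ → ℂ := fun h =>
  (((h : Matrix (Fin 2) (Fin 2) ℝ).det : ℝ) : ℂ)⁻¹ ^ m * f h

end

/-! ### Iterated derivatives: symmetry, composition bounds, Taylor polynomials. -/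

section calculus

/-! Both cases concern one operator `breakingOp`, with `m + a = n₁` and `b + a = n₂`: the first has
`m = 0`, the second `a = k₀`. It must be shown that this operator belongs to the space and that the
space has dimension at most one.

Existence. A smooth function lies in a principal series iff it has the right weight under the
diagonal torus and is killed by `ε^{i,j}` for `i < j` (`mem_principalSeriesSubmodule_iff`).
Membership thus reduces to commutators. The coefficients of `𝓕₁`, `𝓕₂` are such that the raising
operators still kill the image, while the minors shift the weight (`sourceF₁_mem`, `sourceF₂_mem`).
After restriction to `H`, the power `(ε_H^{2,1})^m` preserves highest weight vectors exactly under
the condition on `λ₁ - λ₂`, an `sl₂` computation (`epsGL_raise_iterate_eq_zero`). The minors involve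
the first two rows only, so translation by `h` costs one factor `det h` for each `𝓕_j`, and the
power of `det_H` compensates for it. Locality and continuity follow from derivative estimates
(`IsDiffOp`).

Uniqueness. By equivariance `T` is determined by `f ↦ (T f)(1)`, and by the support condition this
depends only on the germ at the origin of `f` in the chart `N⁻` with coordinates `x, y, z` at the
places `(2,1), (3,2), (3,1)`. The Borel subgroup of `H` acts on this functional `v`
(`IsJetFunctional`). Torus dilations give it finite order, and let only monomials `x^i y^j z^k` with
`i + k = n₁`, `j + k = n₂` survive (`exists_order`, `weight_eq`). One unipotent element yields a
recursion from `x^(i+1) y^(j+1) z^k` to `x^i y^j z^(k+1)`, whose coefficient at the latter is the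
nonzero number `j + 1` (`recursion`). So `v` is determined by its value on `x^n₁ y^n₂`.

The two halves meet there. On functions of `x, y` in the chart, `𝓕₂` is `∂_y`, `𝓕₁` is `∂_x ∂_y` and
`ε_H^{2,1}` is `∂_x`, so the operator does not vanish on `x^n₁ y^n₂` (`breakingOp_one_ne_zero`) and
spans the space. -/

theorem natCast_lt_infty (k : ℕ) : (k : WithTop ℕ∞) < ∞ :=
  WithTop.coe_lt_coe.2 (ENat.natCast_lt_top k)

theorem natCast_le_infty (k : ℕ) : (k : WithTop ℕ∞) ≤ ∞ := (natCast_lt_infty k).le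

variable {E E' F : Type*} [NormedAddCommGroup E] [NormedSpace ℝ E] [NormedAddCommGroup E']
  [NormedSpace ℝ E'] [NormedAddCommGroup F] [NormedSpace ℝ F]

/-- Adjacent transpositions generate the permutations. Swapping the first two slots is the symmetry
of the second derivative of `D^n f`; every other adjacent swap happens under the outermost
derivative. -/
theorem ContDiff.iteratedFDeriv_perm {f : E → F} (hf : ContDiff ℝ ∞ f) :
    ∀ (n : ℕ) (σ : Equiv.Perm (Fin n)) (x : E) (v : Fin n → E),
      iteratedFDeriv ℝ n f x (v ∘ σ) = iteratedFDeriv ℝ n f x v := by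
  intro n
  induction n with
  | zero => intro σ x v; congr 1; ext i; exact i.elim0
  | succ n ih =>
    have hdiff : ∀ k : ℕ, Differentiable ℝ (iteratedFDeriv ℝ k f) := fun k =>
      hf.differentiable_iteratedFDeriv (natCast_lt_infty _)
    cases n with
    | zero =>
      intro σ x v
      rw [show σ = 1 from Equiv.ext fun i => Fin.ext (by omega)]; rfl
    | succ n =>
      intro σ
      have hσ : σ ∈ Submonoid.closure
          (Set.range fun i : Fin (n + 1) => Equiv.swap i.castSucc i.succ) := by
        rw [Equiv.Perm.mclosure_swap_castSucc_succ]; trivial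
      induction hσ using Submonoid.closure_induction with
      | one => intro x v; rfl
      | mul a b _ _ ha hb =>
        intro x v
        rw [Equiv.Perm.coe_mul, ← Function.comp_assoc, hb, ha]
      | mem a ha =>
        obtain ⟨i, rfl⟩ := ha
        intro x v
        induction i using Fin.cases with
        | zero =>
          have hd2 : ∀ w : Fin (n + 2) → E, iteratedFDeriv ℝ (n + 2) f x w =
              fderiv ℝ (fderiv ℝ (iteratedFDeriv ℝ n f)) x (w 0) (w 1)
                (Fin.tail (Fin.tail w)) := by
            intro w
            rw [iteratedFDeriv_succ_apply_left]
            have h1 : fderiv ℝ (fun y => iteratedFDeriv ℝ (n + 1) f y (Fin.tail w)) x (w 0) =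
                fderiv ℝ (iteratedFDeriv ℝ (n + 1) f) x (w 0) (Fin.tail w) := by
              rw [fderiv_continuousMultilinear_apply_const_apply (hdiff _ x)]
            rw [← h1]
            have h2 : (fun y => iteratedFDeriv ℝ (n + 1) f y (Fin.tail w)) =
                fun y => fderiv ℝ (iteratedFDeriv ℝ n f) y (w 1) (Fin.tail (Fin.tail w)) := by
              funext y
              rw [iteratedFDeriv_succ_apply_left]; rfl
            have hd : DifferentiableAt ℝ (fderiv ℝ (iteratedFDeriv ℝ n f)) x := by
              have : ContDiff ℝ 1 (fderiv ℝ (iteratedFDeriv ℝ n f)) :=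
                (hf.iteratedFDeriv_right (m := 2) (i := n)
                  (by exact_mod_cast natCast_le_infty (2 + n))).fderiv_right (by norm_num)
              exact this.differentiable (by norm_num) x
            rw [h2, fderiv_continuousMultilinear_apply_const_apply (hd.clm_apply
              (differentiableAt_const _)), fderiv_clm_apply hd (differentiableAt_const _)]
            simp
          rw [hd2, hd2]
          have hs : IsSymmSndFDerivAt ℝ (iteratedFDeriv ℝ n f) x :=
            ContDiffAt.isSymmSndFDerivAt (n := 2)
              (hf.iteratedFDeriv_right (m := 2) (i := n)
                  (by exact_mod_cast natCast_le_infty (2 + n))).contDiffAt (by simp)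
          have e0 : (v ∘ (Equiv.swap (Fin.castSucc (0 : Fin (n + 1))) (Fin.succ 0))) 0 = v 1 := by
            simp
          have e1 : (v ∘ (Equiv.swap (Fin.castSucc (0 : Fin (n + 1))) (Fin.succ 0))) 1 = v 0 := by
            simp
          have e2 : Fin.tail (Fin.tail
              (v ∘ (Equiv.swap (Fin.castSucc (0 : Fin (n + 1))) (Fin.succ 0)))) =
              Fin.tail (Fin.tail v) := by
            ext j
            simp only [Fin.tail, Function.comp]
            rw [Equiv.swap_apply_of_ne_of_ne]
            · exact Fin.succ_ne_zero _
            · intro h; exact Fin.succ_ne_zero _ (Fin.succ_injective _ h)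
          rw [e0, e1, e2, hs.eq]
        | succ i =>
          rw [iteratedFDeriv_succ_apply_left, iteratedFDeriv_succ_apply_left]
          have e0 : (v ∘ (Equiv.swap (Fin.castSucc i.succ) (Fin.succ i.succ))) 0 = v 0 := by
            simp only [Function.comp]
            rw [Equiv.swap_apply_of_ne_of_ne]
            · rw [← Fin.succ_castSucc]; exact (Fin.succ_ne_zero _).symm
            · exact (Fin.succ_ne_zero _).symm
          have e1 : Fin.tail (v ∘ (Equiv.swap (Fin.castSucc i.succ) (Fin.succ i.succ))) =
              Fin.tail v ∘ Equiv.swap (Fin.castSucc i) i.succ := by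
            ext j
            simp only [Fin.tail, Function.comp, ← Fin.succ_castSucc]
            rw [(Fin.succ_injective _).swap_apply]
          rw [e0, e1]
          -- With the remaining arguments frozen, the outer derivative falls on a scalar family to
          -- which the induction hypothesis applies pointwise.
          have key : ∀ w : Fin (n + 1) → E, ∀ y u : E,
              fderiv ℝ (iteratedFDeriv ℝ (n + 1) f) y u w =
                fderiv ℝ (fun z => iteratedFDeriv ℝ (n + 1) f z w) y u := by
            intro w y u
            rw [fderiv_continuousMultilinear_apply_const_apply (hdiff _ y)]
          rw [key, key]
          congr 2
          funext z
          exact ih _ z _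

theorem ContDiffOn.continuousOn_norm_iteratedFDeriv {U : Set E} (hU : IsOpen U) {f : E → F}
    (hf : ContDiffOn ℝ ∞ f U) (i : ℕ) : ContinuousOn (fun x => ‖iteratedFDeriv ℝ i f x‖) U :=
  (hf.continuousOn_iteratedFDerivWithin (m := i) (natCast_le_infty i)
    hU.uniqueDiffOn).norm.congr fun x hx => by
      change _ = ‖iteratedFDerivWithin ℝ i f U x‖
      rw [iteratedFDerivWithin_of_isOpen i hU hx]

/-- Leibniz and Faà di Bruno, with a constant that is continuous in `x` and independent of `Φ`. This
uniformity gives the continuity both of the operators and of the lift of functions from the chart.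
-/
theorem exists_bound_mul_comp {U : Set E} (hU : IsOpen U) {J : E → ℂ} {φ : E → E'}
    (hJ : ContDiffOn ℝ ∞ J U) (hφ : ContDiffOn ℝ ∞ φ U) (m : ℕ) :
    ∃ C : E → ℝ, ContinuousOn C U ∧ ∀ x ∈ U, ∀ Φ : E' → ℂ, ContDiffAt ℝ ∞ Φ (φ x) →
      ∀ B, (∀ j ≤ m, ‖iteratedFDeriv ℝ j Φ (φ x)‖ ≤ B) →
        ‖iteratedFDeriv ℝ m (fun y => J y * Φ (φ y)) x‖ ≤ C x * B := by
  -- The summand `1` forces `D ≥ 1`, so that `‖D^i φ‖ ≤ D ≤ D^i`, the form required by the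
  -- composition estimate.
  let D : E → ℝ := fun x => 1 + ∑ i ∈ Finset.range (m + 1), ‖iteratedFDeriv ℝ i φ x‖
  refine ⟨fun x => (∑ i ∈ Finset.range (m + 1), (m.choose i : ℝ) * ‖iteratedFDeriv ℝ i J x‖) *
    ((m.factorial : ℝ) * D x ^ m), ?_, ?_⟩
  · have hD : ContinuousOn D U := continuousOn_const.add (continuousOn_finsetSum _ fun i _ =>
      hφ.continuousOn_norm_iteratedFDeriv hU i)
    exact ContinuousOn.mul (continuousOn_finsetSum _ fun i _ => continuousOn_const.mul
      (hJ.continuousOn_norm_iteratedFDeriv hU i)) (continuousOn_const.mul (hD.pow _))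
  · intro x hx Φ hΦ B hB
    have hD1 : 1 ≤ D x := by
      have : 0 ≤ ∑ i ∈ Finset.range (m + 1), ‖iteratedFDeriv ℝ i φ x‖ :=
        Finset.sum_nonneg fun _ _ => norm_nonneg _
      simp only [D]; linarith
    have hB0 : 0 ≤ B := (norm_nonneg _).trans (hB 0 (Nat.zero_le _))
    obtain ⟨V, hVo, hxV, hΦV⟩ : ∃ V, IsOpen V ∧ φ x ∈ V ∧ ContDiffOn ℝ m Φ V := by
      have h := (hΦ.of_le (m := m) (by exact_mod_cast le_top)).eventually (by simp)
      obtain ⟨V, hV, hVo, hxV⟩ := eventually_nhds_iff.1 h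
      exact ⟨V, hVo, hxV, fun y hy => (hV y hy).contDiffWithinAt⟩
    let s := U ∩ φ ⁻¹' V
    have hs : IsOpen s := hφ.continuousOn.isOpen_inter_preimage hU hVo
    have hxs : x ∈ s := ⟨hx, hxV⟩
    have hφs : ContDiffOn ℝ m φ s := (hφ.of_le (by exact_mod_cast le_top)).mono
      Set.inter_subset_left
    have hJs : ContDiffOn ℝ m J s := (hJ.of_le (by exact_mod_cast le_top)).mono
      Set.inter_subset_left
    have hcomp : ContDiffOn ℝ m (Φ ∘ φ) s := hΦV.comp hφs fun y hy => hy.2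
    have hc : ∀ k ≤ m, ‖iteratedFDerivWithin ℝ k (Φ ∘ φ) s x‖ ≤
        (m.factorial : ℝ) * D x ^ m * B := by
      intro k hk
      have h := norm_iteratedFDerivWithin_comp_le (n := k) (N := m) hΦV hφs (by exact_mod_cast hk)
        hVo.uniqueDiffOn hs.uniqueDiffOn (fun y hy => hy.2) hxs (C := B) (D := D x)
        (fun i hi => by rw [iteratedFDerivWithin_of_isOpen i hVo hxV]; exact hB i (hi.trans hk))
        (fun i h1 hi => by
          rw [iteratedFDerivWithin_of_isOpen i hs hxs]
          refine le_trans ?_ (le_self_pow₀ hD1 (by omega))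
          have := Finset.single_le_sum (f := fun i => ‖iteratedFDeriv ℝ i φ x‖)
            (fun _ _ => norm_nonneg _) (Finset.mem_range.2 (show i < m + 1 by omega))
          simp only [D]; linarith)
      refine h.trans ?_
      rw [mul_right_comm]
      have h1 : (k.factorial : ℝ) ≤ m.factorial := by exact_mod_cast Nat.factorial_le hk
      have h2 : D x ^ k ≤ D x ^ m := pow_le_pow_right₀ hD1 hk
      gcongr
    rw [← iteratedFDerivWithin_of_isOpen m hs hxs]
    refine (norm_iteratedFDerivWithin_mul_le hJs hcomp hs.uniqueDiffOn hxs le_rfl).trans ?_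
    rw [mul_assoc, Finset.sum_mul]
    refine Finset.sum_le_sum fun i hi => ?_
    rw [iteratedFDerivWithin_of_isOpen i hs hxs]
    exact mul_le_mul_of_nonneg_left (hc _ (by omega)) (by positivity)

theorem norm_iteratedFDeriv_comp_clm_le {f : E' → F} (hf : ContDiff ℝ ∞ f) (L : E →L[ℝ] E')
    (m : ℕ) (x : E) :
    ‖iteratedFDeriv ℝ m (fun y => f (L y)) x‖ ≤ ‖iteratedFDeriv ℝ m f (L x)‖ * ‖L‖ ^ m := by
  have h := L.iteratedFDeriv_comp_right hf x (i := m) (by exact_mod_cast le_top)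
  have h' : (fun y => f (L y)) = f ∘ L := rfl
  rw [h', h]
  refine (ContinuousMultilinearMap.norm_compContinuousLinearMap_le _ _).trans ?_
  simp

/-- Start from a bound for the derivative of order `N + 1` on the unit ball and descend: each use of
the mean value inequality gains one factor `‖x‖`. -/
theorem exists_bound_of_iteratedFDeriv_eq_zero [FiniteDimensional ℝ E] {f : E → F}
    (hf : ContDiff ℝ ∞ f) {N : ℕ} (h0 : ∀ m ≤ N, iteratedFDeriv ℝ m f 0 = 0) :
    ∃ C : ℝ, ∀ m ≤ N, ∀ x : E, ‖x‖ ≤ 1 → ‖iteratedFDeriv ℝ m f x‖ ≤ C * ‖x‖ ^ (N + 1 - m) := by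
  have hc : Continuous fun x => ‖iteratedFDeriv ℝ (N + 1) f x‖ :=
    (hf.continuous_iteratedFDeriv (m := N + 1) (by exact_mod_cast le_top)).norm
  obtain ⟨C, hC⟩ := (isCompact_closedBall (0 : E) 1).bddAbove_image hc.continuousOn
  have hC' : ∀ x : E, ‖x‖ ≤ 1 → ‖iteratedFDeriv ℝ (N + 1) f x‖ ≤ C := fun x hx =>
    hC ⟨x, by simpa using hx, rfl⟩
  refine ⟨C, ?_⟩
  have key : ∀ j, j ≤ N + 1 → ∀ x : E, ‖x‖ ≤ 1 →
      ‖iteratedFDeriv ℝ (N + 1 - j) f x‖ ≤ C * ‖x‖ ^ j := by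
    intro j
    induction j with
    | zero => intro _ x hx; simpa using hC' x hx
    | succ j ih =>
      intro hj x hx
      have hm : N + 1 - j = (N + 1 - (j + 1)) + 1 := by omega
      have hd : Differentiable ℝ (iteratedFDeriv ℝ (N + 1 - (j + 1)) f) :=
        hf.differentiable_iteratedFDeriv (natCast_lt_infty _)
      have h := (convex_closedBall (0 : E) ‖x‖).norm_image_sub_le_of_norm_fderiv_le
        (f := iteratedFDeriv ℝ (N + 1 - (j + 1)) f) (𝕜 := ℝ) (C := C * ‖x‖ ^ j) (x := 0) (y := x)
        (fun y _ => hd y) (fun y hy => by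
          have hy' : ‖y‖ ≤ ‖x‖ := by simpa using hy
          have := ih (by omega) y (hy'.trans hx)
          rw [hm] at this
          rw [← norm_fderiv_iteratedFDeriv] at this
          refine this.trans ?_
          have hC0 : 0 ≤ C := (norm_nonneg _).trans (hC' 0 (by simp))
          gcongr) (by simp) (by simp)
      rw [h0 _ (by omega), sub_zero, sub_zero] at h
      rw [pow_succ, ← mul_assoc]; exact h
  intro m hm x hx
  have := key (N + 1 - m) (by omega) x hx
  rwa [show N + 1 - (N + 1 - m) = m by omega] at this

theorem exists_taylor_polynomial {ι : Type*} [Fintype ι] {f : (ι → ℝ) → ℂ}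
    (hf : ContDiff ℝ ∞ f) (N : ℕ) :
    ∃ c : (m : Fin (N + 1)) → (Fin m → ι) → ℂ, ∀ m ≤ N,
      iteratedFDeriv ℝ m (f - fun p : ι → ℝ => ∑ j, ∑ r, c j r * ∏ i, ((p (r i) : ℝ) : ℂ)) 0
        = 0 := by
  classical
  let q : FormalMultilinearSeries ℝ (ι → ℝ) ℂ := fun m =>
    if m ≤ N then (m.factorial : ℝ)⁻¹ • iteratedFDeriv ℝ m f 0 else 0
  let P : (ι → ℝ) → ℂ := fun p => ∑ m ∈ Finset.range (N + 1), q m fun _ => p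
  have hP : HasFiniteFPowerSeriesOnBall P q 0 (N + 1) ⊤ := by
    refine HasFiniteFPowerSeriesOnBall.mk' (fun m hm => by simp [q]; omega) (by simp) ?_
    intro y _
    simp [P]
  have hPan : AnalyticOn ℝ P Set.univ := by
    have := hP.cpolynomialOn
    exact fun x _ => ((hP.cpolynomialAt_of_mem (by simp)).analyticAt).analyticWithinAt
  have hPc : ContDiff ℝ ∞ P := by
    rw [← contDiffOn_univ]; exact hPan.contDiffOn uniqueDiffOn_univ
  have hjet : ∀ m ≤ N, iteratedFDeriv ℝ m P 0 = iteratedFDeriv ℝ m f 0 := by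
    intro m hm
    ext v
    rw [hP.toHasFPowerSeriesOnBall.iteratedFDeriv_eq_sum hPan v]
    -- The derivative of the polynomial is a sum over permutations; by symmetry its `m!` terms
    -- coincide and cancel the factorial in `q`.
    have : ∀ σ : Equiv.Perm (Fin m), q m (fun i => v (σ i)) =
        (m.factorial : ℝ)⁻¹ • iteratedFDeriv ℝ m f 0 v := by
      intro σ
      simp only [q, if_pos hm]
      rw [smul_apply]
      congr 1
      exact hf.iteratedFDeriv_perm m σ 0 v
    rw [Finset.sum_congr rfl fun σ _ => this σ, Finset.sum_const, Finset.card_univ,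
      Fintype.card_perm, Fintype.card_fin, ← Nat.cast_smul_eq_nsmul ℝ, smul_smul,
      mul_inv_cancel₀ (by positivity), one_smul]
  refine ⟨fun j r => q j fun i => Pi.single (r i) 1, fun m hm => ?_⟩
  have hPeq : (fun p : ι → ℝ => ∑ j : Fin (N + 1), ∑ r : Fin j → ι,
      q j (fun i => Pi.single (r i) 1) * ∏ i, ((p (r i) : ℝ) : ℂ)) = P := by
    funext p
    simp only [P]
    rw [Finset.sum_range]
    refine Finset.sum_congr rfl fun j _ => ?_
    have hp : (fun _ : Fin j => p) = fun _ => ∑ k, p k • (Pi.single k 1 : ι → ℝ) := by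
      funext _
      exact pi_eq_sum_univ' p
    rw [hp, ContinuousMultilinearMap.map_sum]
    refine Finset.sum_congr rfl fun r _ => ?_
    rw [ContinuousMultilinearMap.map_smul_univ, Complex.real_smul, mul_comm]
    push_cast; rfl
  rw [hPeq, iteratedFDeriv_sub_apply ((hf.of_le (by exact_mod_cast le_top)).contDiffAt)
    ((hPc.of_le (by exact_mod_cast le_top)).contDiffAt), hjet m hm, sub_self]

theorem contDiffOn_fderiv_apply {f : E → F} {U : Set E} (hU : IsOpen U)
    (hf : ContDiffOn ℝ ∞ f U) (L : E →L[ℝ] E) :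
    ContDiffOn ℝ ∞ (fun x => fderiv ℝ f x (L x)) U :=
  (ContDiffOn.fderiv_of_isOpen hf hU (by simp)).clm_apply L.contDiff.contDiffOn

theorem fderiv_add_apply' {f₁ f₂ : E → F} {x : E} (h₁ : DifferentiableAt ℝ f₁ x)
    (h₂ : DifferentiableAt ℝ f₂ x) (v : E) :
    fderiv ℝ (f₁ + f₂) x v = fderiv ℝ f₁ x v + fderiv ℝ f₂ x v := by
  rw [fderiv_add h₁ h₂]; rfl

theorem fderiv_smul_apply' {f : E → ℂ} {x : E} (h : DifferentiableAt ℝ f x) (c : ℂ) (v : E) :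
    fderiv ℝ (c • f) x v = c • fderiv ℝ f x v := by
  rw [fderiv_const_smul h]; rfl

theorem fderiv_mul_apply' {f₁ f₂ : E → ℂ} {x : E} (h₁ : DifferentiableAt ℝ f₁ x)
    (h₂ : DifferentiableAt ℝ f₂ x) (v : E) :
    fderiv ℝ (fun y => f₁ y * f₂ y) x v = fderiv ℝ f₁ x v * f₂ x + f₁ x * fderiv ℝ f₂ x v := by
  rw [fderiv_fun_mul h₁ h₂]; simp; ring

theorem fderiv_comp_clm_apply {f : E' → F} (A : E →L[ℝ] E') {x v : E} {y w : E'}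
    (hy : A x = y) (hw : A v = w) (h : DifferentiableAt ℝ f y) :
    fderiv ℝ (fun z => f (A z)) x v = fderiv ℝ f y w := by
  subst hy hw
  have := fderiv_comp x h A.differentiableAt
  rw [A.fderiv] at this
  exact congrArg (fun T => T v) this

/-- The symmetric second-order terms cancel, and the bracket of the two linear vector fields
remains. -/
theorem fderiv_fderiv_comm {f : E → F} {U : Set E} (hU : IsOpen U)
    (hf : ContDiffOn ℝ ∞ f U) {x : E} (hx : x ∈ U) (K L : E →L[ℝ] E) :
    fderiv ℝ (fun y => fderiv ℝ f y (L y)) x (K x) =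
      fderiv ℝ (fun y => fderiv ℝ f y (K y)) x (L x) + fderiv ℝ f x (L (K x) - K (L x)) := by
  have hd : DifferentiableAt ℝ (fderiv ℝ f) x :=
    ((ContDiffOn.fderiv_of_isOpen hf hU (m := ∞) (by simp)).contDiffAt
      (hU.mem_nhds hx)).differentiableAt (by simp)
  have hs : IsSymmSndFDerivAt ℝ f x :=
    (hf.contDiffAt (hU.mem_nhds hx)).isSymmSndFDerivAt (by simpa using natCast_le_infty 2)
  rw [fderiv_clm_apply hd L.differentiableAt, fderiv_clm_apply hd K.differentiableAt]
  simp [hs.eq]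
  abel

theorem norm_iteratedFDeriv_fderiv_apply_le {f : E → F} {U : Set E} (hU : IsOpen U)
    (hf : ContDiffOn ℝ ∞ f U) {x : E} (hx : x ∈ U) (L : E →L[ℝ] E) {m : ℕ} {B : ℝ}
    (hB : ∀ j ≤ m + 1, ‖iteratedFDeriv ℝ j f x‖ ≤ B) :
    ‖iteratedFDeriv ℝ m (fun y => fderiv ℝ f y (L y)) x‖ ≤
      (∑ i ∈ Finset.range (m + 1), (m.choose i : ℝ) * ‖iteratedFDeriv ℝ (m - i) L x‖) * B := by
  rw [← iteratedFDerivWithin_of_isOpen m hU hx]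
  refine (norm_iteratedFDerivWithin_clm_apply (N := m)
    (ContDiffOn.fderiv_of_isOpen hf hU (natCast_le_infty (m + 1)))
    L.contDiff.contDiffOn hU.uniqueDiffOn hx le_rfl).trans ?_
  rw [Finset.sum_mul]
  refine Finset.sum_le_sum fun i hi => ?_
  rw [iteratedFDerivWithin_of_isOpen _ hU hx, iteratedFDerivWithin_of_isOpen _ hU hx,
    norm_iteratedFDeriv_fderiv, mul_right_comm]
  have := hB (i + 1) (by have := Finset.mem_range.1 hi; omega)
  gcongr

theorem fderiv_coe_clm_apply (L : E →L[ℝ] F) (x v : E) : fderiv ℝ L x v = L v := by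
  rw [L.fderiv]

end calculus

noncomputable section

/-! ### Derivatives of the right regular action on functions on `GL(n, ℝ)`. -/

section calculusGL

variable {n k l : ℕ}

/-- The unit topology also records the inverse, but inversion is continuous on invertible matrices
by the adjugate formula. Neighbourhoods in the group and among matrices can therefore be exchanged.
-/
theorem isOpenEmbedding_val_GL :
    Topology.IsOpenEmbedding (Units.val : GL (Fin n) ℝ → Matrix (Fin n) (Fin n) ℝ) := by
  refine ⟨?_, ?_⟩
  · refine Units.isEmbedding_val_mk' (f := fun M => M⁻¹) ?_ fun u => ?_
    · intro M hM
      have hdet : M.det ≠ 0 := by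
        have : IsUnit M := hM
        exact ((Matrix.isUnit_iff_isUnit_det _).1 this).ne_zero
      have : ContinuousAt (fun N : Matrix (Fin n) (Fin n) ℝ => N.det⁻¹ • N.adjugate) M :=
        ((continuous_id.matrix_det.continuousAt).inv₀ hdet).smul
          (continuous_id.matrix_adjugate.continuousAt)
      refine (this.congr ?_).continuousWithinAt
      exact Filter.Eventually.of_forall fun N => by simp [Matrix.inv_def, Ring.inverse_eq_inv']
    · exact (Matrix.coe_units_inv u).symm
  · exact isOpen_units_matrix (n := n)

theorem extendGL_eventuallyEq {f : GL (Fin n) ℝ → ℂ} {F : Matrix (Fin n) (Fin n) ℝ → ℂ}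
    {g : GL (Fin n) ℝ} (h : ∀ᶠ g' in nhds g, f g' = F g') :
    extendGL f =ᶠ[nhds (g : Matrix (Fin n) (Fin n) ℝ)] F := by
  rw [Filter.EventuallyEq, ← isOpenEmbedding_val_GL.map_nhds_eq, Filter.eventually_map]
  filter_upwards [h] with g' hg'
  rw [extendGL_coe, hg']

theorem smoothGL_iff {f : GL (Fin n) ℝ → ℂ} :
    SmoothGL f ↔ ∀ g : GL (Fin n) ℝ, ContDiffAt ℝ ∞ (extendGL f) g := by
  refine ⟨fun h g => h.contDiffAt g, fun h => ?_⟩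
  rintro _ ⟨g, rfl⟩
  exact (h g).contDiffWithinAt

theorem smoothGL_of_contDiffOn {f : GL (Fin n) ℝ → ℂ} {F : Matrix (Fin n) (Fin n) ℝ → ℂ}
    (hF : ContDiffOn ℝ ∞ F {M | IsUnit M}) (h : ∀ g : GL (Fin n) ℝ, f g = F g) : SmoothGL f := by
  refine hF.congr ?_
  rintro _ ⟨g, rfl⟩
  rw [extendGL_coe, h]

theorem SmoothGL.mul {f₁ f₂ : GL (Fin n) ℝ → ℂ} (h₁ : SmoothGL f₁) (h₂ : SmoothGL f₂) :
    SmoothGL (fun g => f₁ g * f₂ g) :=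
  smoothGL_of_contDiffOn (F := fun M => extendGL f₁ M * extendGL f₂ M) (ContDiffOn.mul h₁ h₂)
    fun g => by simp only [extendGL_coe]

theorem SmoothGL.const_mul {f : GL (Fin n) ℝ → ℂ} (h : SmoothGL f) (c : ℂ) :
    SmoothGL (fun g => c * f g) := h.smul c

theorem SmoothGL.continuous {f : GL (Fin n) ℝ → ℂ} (h : SmoothGL f) : Continuous f := by
  rw [continuous_iff_continuousAt]
  intro g
  have := (h.contDiffAt g).continuousAt.comp (f := Units.val) Units.continuous_val.continuousAt
  refine this.congr (Filter.Eventually.of_forall fun g' => extendGL_coe f g')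

/-- The derivative of the right regular action in the direction `X`. -/
def rightDeriv (X : Matrix (Fin n) (Fin n) ℝ) (f : GL (Fin n) ℝ → ℂ) : GL (Fin n) ℝ → ℂ :=
  fun g => fderiv ℝ (extendGL f) (g : Matrix (Fin n) (Fin n) ℝ)
    ((g : Matrix (Fin n) (Fin n) ℝ) * X)

theorem epsGL_eq_rightDeriv (i j : Fin n) :
    epsGL i j = rightDeriv (Matrix.single i j (1 : ℝ)) := rfl

/-- Right multiplication by `X` as a continuous linear map. -/
def mulRightCLM (X : Matrix (Fin n) (Fin n) ℝ) :
    Matrix (Fin n) (Fin n) ℝ →L[ℝ] Matrix (Fin n) (Fin n) ℝ :=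
  LinearMap.toContinuousLinearMap (LinearMap.mulRight ℝ X)

theorem mulRightCLM_apply (X M : Matrix (Fin n) (Fin n) ℝ) : mulRightCLM X M = M * X := rfl

theorem SmoothGL.differentiableAt {f : GL (Fin n) ℝ → ℂ} (h : SmoothGL f) (g : GL (Fin n) ℝ) :
    DifferentiableAt ℝ (extendGL f) (g : Matrix (Fin n) (Fin n) ℝ) :=
  (h.contDiffAt g).differentiableAt (by simp)

theorem SmoothGL.rightDeriv {f : GL (Fin n) ℝ → ℂ} (h : SmoothGL f)
    (X : Matrix (Fin n) (Fin n) ℝ) : SmoothGL (rightDeriv X f) :=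
  smoothGL_of_contDiffOn (F := fun M => fderiv ℝ (extendGL f) M (mulRightCLM X M))
    (contDiffOn_fderiv_apply isOpen_units_matrix h (mulRightCLM X)) fun _ => rfl

theorem extendGL_rightDeriv_eventuallyEq (f : GL (Fin n) ℝ → ℂ)
    (X : Matrix (Fin n) (Fin n) ℝ) (g : GL (Fin n) ℝ) :
    extendGL (rightDeriv X f) =ᶠ[nhds (g : Matrix (Fin n) (Fin n) ℝ)]
      fun M => fderiv ℝ (extendGL f) M (mulRightCLM X M) :=
  extendGL_eventuallyEq (Filter.Eventually.of_forall fun _ => rfl)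

theorem rightDeriv_add {f₁ f₂ : GL (Fin n) ℝ → ℂ} (h₁ : SmoothGL f₁) (h₂ : SmoothGL f₂)
    (X : Matrix (Fin n) (Fin n) ℝ) :
    rightDeriv X (f₁ + f₂) = rightDeriv X f₁ + rightDeriv X f₂ := by
  funext g
  simp only [rightDeriv, extendGL_add]
  exact fderiv_add_apply' (h₁.differentiableAt g) (h₂.differentiableAt g) _

theorem rightDeriv_smul {f : GL (Fin n) ℝ → ℂ} (h : SmoothGL f) (c : ℂ)
    (X : Matrix (Fin n) (Fin n) ℝ) :
    rightDeriv X (c • f) = c • rightDeriv X f := by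
  funext g
  simp only [rightDeriv, extendGL_smul]
  exact fderiv_smul_apply' (h.differentiableAt g) c _

theorem rightDeriv_mul {f₁ f₂ : GL (Fin n) ℝ → ℂ} (h₁ : SmoothGL f₁) (h₂ : SmoothGL f₂)
    (X : Matrix (Fin n) (Fin n) ℝ) (g : GL (Fin n) ℝ) :
    rightDeriv X (fun g => f₁ g * f₂ g) g =
      rightDeriv X f₁ g * f₂ g + f₁ g * rightDeriv X f₂ g := by
  have he : extendGL (fun g => f₁ g * f₂ g) =ᶠ[nhds (g : Matrix (Fin n) (Fin n) ℝ)]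
      (fun M => extendGL f₁ M * extendGL f₂ M) :=
    extendGL_eventuallyEq (Filter.Eventually.of_forall fun g' => by simp [extendGL_coe])
  simp only [rightDeriv]
  rw [he.fderiv_eq, ← extendGL_coe f₁, ← extendGL_coe f₂]
  exact fderiv_mul_apply' (h₁.differentiableAt g) (h₂.differentiableAt g) _

/-- The infinitesimal right regular action is a Lie algebra representation; all commutation
relations below come from this. -/
theorem rightDeriv_comm {f : GL (Fin n) ℝ → ℂ} (h : SmoothGL f)
    (X Y : Matrix (Fin n) (Fin n) ℝ) (g : GL (Fin n) ℝ) :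
    rightDeriv Y (rightDeriv X f) g =
      rightDeriv X (rightDeriv Y f) g + rightDeriv (Y * X - X * Y) f g := by
  have key := fderiv_fderiv_comm isOpen_units_matrix h g.isUnit (mulRightCLM Y) (mulRightCLM X)
  have e1 : rightDeriv Y (rightDeriv X f) g =
      fderiv ℝ (fun M => fderiv ℝ (extendGL f) M (mulRightCLM X M)) g (mulRightCLM Y g) := by
    rw [rightDeriv, (extendGL_rightDeriv_eventuallyEq f X g).fderiv_eq]; rfl
  have e2 : rightDeriv X (rightDeriv Y f) g =
      fderiv ℝ (fun M => fderiv ℝ (extendGL f) M (mulRightCLM Y M)) g (mulRightCLM X g) := by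
    rw [rightDeriv, (extendGL_rightDeriv_eventuallyEq f Y g).fderiv_eq]; rfl
  have e3 : rightDeriv (Y * X - X * Y) f g = fderiv ℝ (extendGL f) g
      (mulRightCLM X (mulRightCLM Y g) - mulRightCLM Y (mulRightCLM X g)) := by
    rw [rightDeriv]
    congr 1
    simp only [mulRightCLM_apply]
    noncomm_ring
  rw [e1, e2, e3]
  exact key

theorem rightDeriv_sub_dir (X Y : Matrix (Fin n) (Fin n) ℝ) (f : GL (Fin n) ℝ → ℂ)
    (g : GL (Fin n) ℝ) : rightDeriv (X - Y) f g = rightDeriv X f g - rightDeriv Y f g := by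
  simp only [rightDeriv, mul_sub, map_sub]

theorem rightDeriv_smul_dir (c : ℝ) (X : Matrix (Fin n) (Fin n) ℝ) (f : GL (Fin n) ℝ → ℂ)
    (g : GL (Fin n) ℝ) : rightDeriv (c • X) f g = c * rightDeriv X f g := by
  simp only [rightDeriv, mul_smul_comm, map_smul, Complex.real_smul]

theorem rightDeriv_zero_dir (f : GL (Fin n) ℝ → ℂ)
    (g : GL (Fin n) ℝ) : rightDeriv 0 f g = 0 := by
  simp [rightDeriv]

theorem rightDeriv_eq_sum (X : Matrix (Fin n) (Fin n) ℝ) (f : GL (Fin n) ℝ → ℂ)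
    (g : GL (Fin n) ℝ) : rightDeriv X f g = ∑ i, ∑ j, (X i j : ℂ) * epsGL i j f g := by
  conv_lhs => rw [rightDeriv, X.matrix_eq_sum_single]
  simp only [Finset.mul_sum, map_sum]
  refine Finset.sum_congr rfl fun i _ => Finset.sum_congr rfl fun j _ => ?_
  rw [show Matrix.single i j (X i j) = X i j • Matrix.single i j (1 : ℝ) by simp]
  exact rightDeriv_smul_dir _ _ f g

theorem epsGL_comm {f : GL (Fin n) ℝ → ℂ} (h : SmoothGL f) (i j p q : Fin n)
    (g : GL (Fin n) ℝ) :
    epsGL i j (epsGL p q f) g = epsGL p q (epsGL i j f) g +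
      ((if j = p then epsGL i q f g else 0) - (if q = i then epsGL p j f g else 0)) := by
  simp only [epsGL_eq_rightDeriv]
  rw [rightDeriv_comm h, rightDeriv_sub_dir]
  congr 2
  · split_ifs with hjp
    · subst hjp; simp
    · rw [Matrix.single_mul_single_of_ne (h := hjp), rightDeriv_zero_dir]
  · split_ifs with hjp
    · subst hjp; simp
    · rw [Matrix.single_mul_single_of_ne (h := hjp), rightDeriv_zero_dir]

theorem hasDerivAt_comp_curve {f : GL (Fin n) ℝ → ℂ} (h : SmoothGL f) {γ : ℝ → GL (Fin n) ℝ}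
    {X : Matrix (Fin n) (Fin n) ℝ} {t : ℝ}
    (hγ : HasDerivAt (fun s => (γ s : Matrix (Fin n) (Fin n) ℝ)) (γ t * X) t) :
    HasDerivAt (fun s => f (γ s)) (rightDeriv X f (γ t)) t := by
  have := (h.differentiableAt (γ t)).hasFDerivAt.comp_hasDerivAt t hγ
  refine this.congr_of_eventuallyEq (Filter.Eventually.of_forall fun s => ?_)
  exact (extendGL_coe f (γ s)).symm

theorem rightDeriv_leftTranslate {f : GL (Fin n) ℝ → ℂ} (h : SmoothGL f) (a : GL (Fin n) ℝ)
    (X : Matrix (Fin n) (Fin n) ℝ) (g : GL (Fin n) ℝ) :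
    rightDeriv X (fun g => f (a * g)) g = rightDeriv X f (a * g) := by
  let A : Matrix (Fin n) (Fin n) ℝ →L[ℝ] Matrix (Fin n) (Fin n) ℝ :=
    LinearMap.toContinuousLinearMap (LinearMap.mulLeft ℝ (a : Matrix (Fin n) (Fin n) ℝ))
  have he : extendGL (fun g => f (a * g)) =ᶠ[nhds (g : Matrix (Fin n) (Fin n) ℝ)]
      fun M => extendGL f (A M) :=
    extendGL_eventuallyEq (Filter.Eventually.of_forall fun g' =>
      (extendGL_coe f (a * g')).symm)
  rw [rightDeriv, he.fderiv_eq]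
  exact fderiv_comp_clm_apply A rfl (mul_assoc _ _ _).symm (h.differentiableAt (a * g))

/-- The hypothesis `X * p = p * Y` says `Y = Ad(p⁻¹) X` without writing an inverse. -/
theorem rightDeriv_rightTranslate {f : GL (Fin n) ℝ → ℂ} (h : SmoothGL f) (p : GL (Fin n) ℝ)
    {X Y : Matrix (Fin n) (Fin n) ℝ} (hXY : X * p = p * Y) (g : GL (Fin n) ℝ) :
    rightDeriv X (fun g => f (g * p)) g = rightDeriv Y f (g * p) := by
  obtain ⟨A, hA⟩ : ∃ A : Matrix (Fin n) (Fin n) ℝ →L[ℝ] Matrix (Fin n) (Fin n) ℝ,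
      ∀ M, A M = M * (p : Matrix (Fin n) (Fin n) ℝ) := ⟨mulRightCLM p, mulRightCLM_apply _⟩
  have he : extendGL (fun g => f (g * p)) =ᶠ[nhds (g : Matrix (Fin n) (Fin n) ℝ)]
      fun M => extendGL f (A M) :=
    extendGL_eventuallyEq (Filter.Eventually.of_forall fun g' => by
      rw [hA, ← Units.val_mul, extendGL_coe])
  have e1 : A (g : Matrix (Fin n) (Fin n) ℝ) = (g * p : GL (Fin n) ℝ) := by
    rw [hA, Units.val_mul]
  have e2 : A ((g : Matrix (Fin n) (Fin n) ℝ) * X) = (g * p : GL (Fin n) ℝ) * Y := by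
    rw [hA, mul_assoc, hXY, Units.val_mul, mul_assoc]
  rw [rightDeriv, he.fderiv_eq]
  exact fderiv_comp_clm_apply A e1 e2 (h.differentiableAt (g * p))

end calculusGL

/-! ### Differential operators along a map, described by estimates. -/

section diffOp

variable {n k l : ℕ}

/-- A linear differential operator along the map `φ`: the derivatives of `A f` at `g` are
controlled by finitely many derivatives of `f` at `φ g`, locally uniformly in `g`. -/
structure IsDiffOp (φ : GL (Fin k) ℝ → GL (Fin n) ℝ)
    (A : (GL (Fin n) ℝ → ℂ) → GL (Fin k) ℝ → ℂ) : Prop where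
  smooth : ∀ {f}, SmoothGL f → SmoothGL (A f)
  add : ∀ {f₁ f₂}, SmoothGL f₁ → SmoothGL f₂ → A (f₁ + f₂) = A f₁ + A f₂
  smul : ∀ (c : ℂ) {f}, SmoothGL f → A (c • f) = c • A f
  bound : ∀ m : ℕ, ∃ (N : ℕ) (C : GL (Fin k) ℝ → ℝ), Continuous C ∧ ∀ f, SmoothGL f → ∀ g B,
    (∀ j ≤ N, ‖iteratedFDeriv ℝ j (extendGL f) (φ g : Matrix (Fin n) (Fin n) ℝ)‖ ≤ B) →
      ‖iteratedFDeriv ℝ m (extendGL (A f)) (g : Matrix (Fin k) (Fin k) ℝ)‖ ≤ C g * B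

namespace IsDiffOp

theorem id : IsDiffOp (fun g : GL (Fin n) ℝ => g) fun f => f where
  smooth h := h
  add _ _ := rfl
  smul _ _ _ := rfl
  bound m := ⟨m, fun _ => 1, continuous_const, fun f _ g B hB => by simpa using hB m le_rfl⟩

theorem comp {φ : GL (Fin k) ℝ → GL (Fin n) ℝ} {ψ : GL (Fin l) ℝ → GL (Fin k) ℝ}
    {A : (GL (Fin n) ℝ → ℂ) → GL (Fin k) ℝ → ℂ} {A' : (GL (Fin k) ℝ → ℂ) → GL (Fin l) ℝ → ℂ}
    (hA' : IsDiffOp ψ A') (hA : IsDiffOp φ A) (hψ : Continuous ψ) :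
    IsDiffOp (fun g => φ (ψ g)) fun f => A' (A f) where
  smooth h := hA'.smooth (hA.smooth h)
  add h₁ h₂ := by rw [hA.add h₁ h₂, hA'.add (hA.smooth h₁) (hA.smooth h₂)]
  smul c f h := by rw [hA.smul c h, hA'.smul c (hA.smooth h)]
  bound m := by
    obtain ⟨N', C', hC', h'⟩ := hA'.bound m
    choose N C hC h using hA.bound
    refine ⟨(Finset.range (N' + 1)).sup N,
      fun g => C' g * ∑ j ∈ Finset.range (N' + 1), |C j (ψ g)|,
      hC'.mul (continuous_finsetSum _ fun j _ => ((hC j).comp hψ).abs), ?_⟩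
    intro f hf g B hB
    have hB0 : 0 ≤ B := (norm_nonneg _).trans (hB 0 (Nat.zero_le _))
    rw [mul_assoc]
    refine h' _ (hA.smooth hf) _ _ fun j hj => ?_
    have hmem : j ∈ Finset.range (N' + 1) := Finset.mem_range.2 (by omega)
    refine (h j f hf (ψ g) B fun i hi => hB i (hi.trans (Finset.le_sup hmem))).trans ?_
    refine mul_le_mul_of_nonneg_right ((le_abs_self _).trans ?_) hB0
    exact Finset.single_le_sum (f := fun j => |C j (ψ g)|) (fun _ _ => abs_nonneg _) hmem

theorem add_op {φ : GL (Fin k) ℝ → GL (Fin n) ℝ}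
    {A A' : (GL (Fin n) ℝ → ℂ) → GL (Fin k) ℝ → ℂ} (hA : IsDiffOp φ A) (hA' : IsDiffOp φ A') :
    IsDiffOp φ fun f => A f + A' f where
  smooth h := (hA.smooth h).add (hA'.smooth h)
  add h₁ h₂ := by rw [hA.add h₁ h₂, hA'.add h₁ h₂]; abel
  smul c f h := by rw [hA.smul c h, hA'.smul c h, smul_add]
  bound m := by
    obtain ⟨N, C, hC, h⟩ := hA.bound m
    obtain ⟨N', C', hC', h'⟩ := hA'.bound m
    refine ⟨max N N', fun g => C g + C' g, hC.add hC', fun f hf g B hB => ?_⟩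
    rw [extendGL_add, iteratedFDeriv_add_apply
      (((hA.smooth hf).contDiffAt g).of_le (natCast_le_infty _))
      (((hA'.smooth hf).contDiffAt g).of_le (natCast_le_infty _)), add_mul]
    exact (norm_add_le _ _).trans (add_le_add
      (h f hf g B fun j hj => hB j (hj.trans (le_max_left _ _)))
      (h' f hf g B fun j hj => hB j (hj.trans (le_max_right _ _))))

/-- The operator `f ↦ (g ↦ J g * f (φ g))`. -/
theorem mul_comp {J : GL (Fin k) ℝ → ℂ} (hJ : SmoothGL J)
    {φ : GL (Fin k) ℝ → GL (Fin n) ℝ} {φ' : Matrix (Fin k) (Fin k) ℝ → Matrix (Fin n) (Fin n) ℝ}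
    (hφ' : ContDiff ℝ ∞ φ') (hφ : ∀ g : GL (Fin k) ℝ, φ' g = φ g) :
    IsDiffOp φ fun f g => J g * f (φ g) := by
  have hev : ∀ (f : GL (Fin n) ℝ → ℂ) (g : GL (Fin k) ℝ),
      extendGL (fun g => J g * f (φ g)) =ᶠ[nhds (g : Matrix (Fin k) (Fin k) ℝ)]
        fun M => extendGL J M * extendGL f (φ' M) := fun f g =>
    extendGL_eventuallyEq (Filter.Eventually.of_forall fun g' => by
      rw [hφ, extendGL_coe, extendGL_coe])
  refine ⟨fun {f} hf => ?_, fun {f₁ f₂} _ _ => ?_, fun c f _ => ?_, fun m => ?_⟩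
  · rw [smoothGL_iff]
    intro g
    refine ContDiffAt.congr_of_eventuallyEq ?_ (hev f g)
    refine (hJ.contDiffAt g).mul (ContDiffAt.comp _ ?_ hφ'.contDiffAt)
    rw [hφ]; exact hf.contDiffAt _
  · funext g; simp [mul_add]
  · funext g; simp; ring
  · obtain ⟨C, hC, h⟩ := exists_bound_mul_comp isOpen_units_matrix hJ hφ'.contDiffOn m
    refine ⟨m, fun g => C g, ?_, fun f hf g B hB => ?_⟩
    · exact hC.comp_continuous Units.continuous_val fun g => g.isUnit
    · rw [((hev f g).iteratedFDeriv ℝ m).eq_of_nhds]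
      refine h _ g.isUnit _ ?_ B fun j hj => ?_
      · rw [hφ]; exact hf.contDiffAt _
      · rw [hφ]; exact hB j hj

theorem mul {J : GL (Fin n) ℝ → ℂ} (hJ : SmoothGL J) :
    IsDiffOp (fun g => g) fun f g => J g * f g :=
  mul_comp hJ contDiff_id fun _ => rfl

theorem smoothGL_const (c : ℂ) : SmoothGL (fun _ : GL (Fin n) ℝ => c) :=
  smoothGL_of_contDiffOn contDiffOn_const fun _ => rfl

theorem const_mul (c : ℂ) : IsDiffOp (fun g : GL (Fin n) ℝ => g) fun f g => c * f g :=
  mul (smoothGL_const c)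

theorem rightDeriv (X : Matrix (Fin n) (Fin n) ℝ) :
    IsDiffOp (fun g => g) (rightDeriv X) where
  smooth h := h.rightDeriv X
  add h₁ h₂ := rightDeriv_add h₁ h₂ X
  smul c _ h := rightDeriv_smul h c X
  bound m := by
    have hcont : ∀ i, Continuous fun g : GL (Fin n) ℝ =>
        ‖iteratedFDeriv ℝ i (mulRightCLM X) (g : Matrix (Fin n) (Fin n) ℝ)‖ := fun i =>
      (((mulRightCLM X).contDiff.continuous_iteratedFDeriv (n := ∞)
        (natCast_le_infty i)).comp Units.continuous_val).norm
    refine ⟨m + 1, fun g => ∑ i ∈ Finset.range (m + 1), (m.choose i : ℝ) *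
      ‖iteratedFDeriv ℝ (m - i) (mulRightCLM X) (g : Matrix (Fin n) (Fin n) ℝ)‖, ?_, ?_⟩
    · exact continuous_finsetSum _ fun i _ => continuous_const.mul (hcont _)
    · intro f hf g B hB
      rw [((extendGL_rightDeriv_eventuallyEq f X g).iteratedFDeriv ℝ m).eq_of_nhds]
      exact norm_iteratedFDeriv_fderiv_apply_le isOpen_units_matrix hf g.isUnit (mulRightCLM X) hB

theorem epsGL (i j : Fin n) : IsDiffOp (fun g => g) (epsGL i j) := rightDeriv _

/-- Locality comes from the order-zero estimate: if `f` vanishes near `φ g`, all its derivatives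
there vanish and `B = 0` is admissible. -/
theorem apply_eq_zero {φ : GL (Fin k) ℝ → GL (Fin n) ℝ}
    {A : (GL (Fin n) ℝ → ℂ) → GL (Fin k) ℝ → ℂ} (hA : IsDiffOp φ A) {f : GL (Fin n) ℝ → ℂ}
    (hf : SmoothGL f) {g : GL (Fin k) ℝ} (h : ∀ᶠ g' in nhds (φ g), f g' = 0) : A f g = 0 := by
  obtain ⟨N, C, -, hC⟩ := hA.bound 0
  have he : extendGL f =ᶠ[nhds (φ g : Matrix (Fin n) (Fin n) ℝ)] fun _ => 0 :=
    extendGL_eventuallyEq h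
  have := hC f hf g 0 fun j _ => by
    rw [(he.iteratedFDeriv ℝ j).eq_of_nhds]
    have : (fun _ : Matrix (Fin n) (Fin n) ℝ => (0 : ℂ)) = 0 := rfl
    rw [this, iteratedFDeriv_zero]; simp
  simpa [extendGL_coe] using this

end IsDiffOp

end diffOp

/-! ### Torus weights and the infinitesimal description of the principal series. -/

section torus

variable {n : ℕ}

/-- The invertible diagonal matrix with diagonal entries `t`. -/
def diagGL (t : Fin n → ℝˣ) : GL (Fin n) ℝ where
  val := Matrix.diagonal fun i => (t i : ℝ)
  inv := Matrix.diagonal fun i => ((t i)⁻¹ : ℝˣ)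
  val_inv := by rw [Matrix.diagonal_mul_diagonal]; simp
  inv_val := by rw [Matrix.diagonal_mul_diagonal]; simp

theorem coe_diagGL (t : Fin n → ℝˣ) :
    (diagGL t : Matrix (Fin n) (Fin n) ℝ) = Matrix.diagonal fun i => (t i : ℝ) := rfl

theorem diagGL_mem_borel (t : Fin n → ℝˣ) : diagGL t ∈ borelGL n :=
  Matrix.blockTriangular_diagonal _

/-- `f` transforms under diagonal matrices on the right by `c`. -/
def HasWeight (c : (Fin n → ℝˣ) → ℂ) (f : GL (Fin n) ℝ → ℂ) : Prop :=
  ∀ g t, f (g * diagGL t) = c t * f g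

theorem HasWeight.mul {c₁ c₂ : (Fin n → ℝˣ) → ℂ} {f₁ f₂ : GL (Fin n) ℝ → ℂ}
    (h₁ : HasWeight c₁ f₁) (h₂ : HasWeight c₂ f₂) :
    HasWeight (fun t => c₁ t * c₂ t) fun g => f₁ g * f₂ g := by
  intro g t
  simp only [h₁ g t, h₂ g t]; ring

/-- Conjugation by the torus scales `E_{i,j}` by the root `t_i / t_j`. -/
theorem HasWeight.eps {c : (Fin n → ℝˣ) → ℂ} {f : GL (Fin n) ℝ → ℂ}
    (h : HasWeight c f) (hf : SmoothGL f) (i j : Fin n) :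
    HasWeight (fun t => c t * ((t i : ℝ) / (t j : ℝ) : ℝ)) (epsGL i j f) := by
  intro g t
  have hti : ((t i : ℝ) : ℂ) ≠ 0 := by exact_mod_cast (t i).ne_zero
  have htj : ((t j : ℝ) : ℂ) ≠ 0 := by exact_mod_cast (t j).ne_zero
  have hXY : Matrix.single i j (1 : ℝ) * (diagGL t : Matrix (Fin n) (Fin n) ℝ) =
      diagGL t * (((t j : ℝ) / (t i : ℝ)) • Matrix.single i j (1 : ℝ)) := by
    ext a b
    rw [coe_diagGL, Matrix.mul_diagonal, Matrix.diagonal_mul]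
    by_cases hab : i = a ∧ j = b
    · obtain ⟨rfl, rfl⟩ := hab
      simp
      field_simp
    · simp [hab]
  have h1 := rightDeriv_rightTranslate hf (diagGL t) hXY g
  have h2 : (fun g => f (g * diagGL t)) = c t • f := funext fun g => h g t
  rw [h2, rightDeriv_smul hf, rightDeriv_smul_dir] at h1
  rw [epsGL_eq_rightDeriv]
  have h3 : c t * rightDeriv (Matrix.single i j 1) f g = _ := h1
  rw [show c t * (((t i : ℝ) / (t j : ℝ) : ℝ) : ℂ) * rightDeriv (Matrix.single i j 1) f g =
    (((t i : ℝ) / (t j : ℝ) : ℝ) : ℂ) * (c t * rightDeriv (Matrix.single i j 1) f g) by ring, h3]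
  push_cast
  field_simp

/-- The diagonal matrix with `exp s` in the place `i` and `1` elsewhere. -/
def expAt (i : Fin n) (s : ℝ) : Fin n → ℝˣ :=
  Function.update 1 i (Units.mk0 (Real.exp s) (Real.exp_pos s).ne')

theorem HasWeight.eps_self {c : (Fin n → ℝˣ) → ℂ} {f : GL (Fin n) ℝ → ℂ}
    (h : HasWeight c f) (hf : SmoothGL f) {i : Fin n} {z : ℂ}
    (hc : ∀ s : ℝ, c (expAt i s) = Complex.exp (s * z)) : epsGL i i f = z • f := by
  funext g
  have hcoe : ∀ s, (diagGL (expAt i s) : Matrix (Fin n) (Fin n) ℝ) =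
      1 + (Real.exp s - 1) • Matrix.single i i (1 : ℝ) := by
    intro s
    ext a b
    rw [coe_diagGL]
    by_cases hab : a = b
    · subst hab
      by_cases hai : a = i
      · subst hai; simp [expAt]
      · simp [expAt, hai, Ne.symm hai]
    · have : ¬ (i = a ∧ i = b) := fun ⟨h1, h2⟩ => hab (h1.symm.trans h2)
      simp [hab, this]
  have hγ : HasDerivAt (fun s => ((g * diagGL (expAt i s) : GL (Fin n) ℝ) :
      Matrix (Fin n) (Fin n) ℝ)) ((g * diagGL (expAt i 0) : GL (Fin n) ℝ) *
        Matrix.single i i (1 : ℝ)) 0 := by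
    have h1 : HasDerivAt (fun s : ℝ => (g : Matrix (Fin n) (Fin n) ℝ) + (Real.exp s - 1) •
        ((g : Matrix (Fin n) (Fin n) ℝ) * Matrix.single i i (1 : ℝ)))
        (Real.exp 0 • ((g : Matrix (Fin n) (Fin n) ℝ) * Matrix.single i i (1 : ℝ))) 0 :=
      (((Real.hasDerivAt_exp 0).sub_const 1).smul_const _).const_add _
    convert! h1 using 1
    · funext s
      rw [Units.val_mul, hcoe, mul_add, mul_one, mul_smul_comm]
    · rw [Units.val_mul, hcoe]; simp
  have h1 := hasDerivAt_comp_curve hf hγ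
  have h2 : HasDerivAt (fun s : ℝ => Complex.exp (s * z) * f g) (z * f g) 0 := by
    have := (((Complex.ofRealCLM.hasDerivAt (x := 0)).mul_const z).cexp).mul_const (f g)
    simpa using this
  have h3 : (fun s => f (g * diagGL (expAt i s))) = fun s : ℝ => Complex.exp (s * z) * f g := by
    funext s; rw [h, hc]
  rw [h3] at h1
  have h4 : diagGL (expAt i 0) = (1 : GL (Fin n) ℝ) := by
    ext a b; rw [hcoe]; simp
  have := h1.unique h2
  rw [h4, mul_one] at this
  exact this

/-- Only the unipotent directions are integrated. The torus is disconnected, so the signs of the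
diagonal entries must be supplied by the weight as a global condition. -/
theorem apply_mul_of_epsGL_eq_zero {c : (Fin n → ℝˣ) → ℂ} {f : GL (Fin n) ℝ → ℂ}
    (h : HasWeight c f) (hf : SmoothGL f) (h0 : ∀ i j, i < j → epsGL i j f = 0)
    (g : GL (Fin n) ℝ) {p : GL (Fin n) ℝ} (hp : p ∈ borelGL n) {t : Fin n → ℝˣ}
    (ht : ∀ i, (t i : ℝ) = (p : Matrix (Fin n) (Fin n) ℝ) i i) : f (g * p) = c t * f g := by
  let D : Matrix (Fin n) (Fin n) ℝ := Matrix.diagonal fun i => (t i : ℝ)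
  -- The segment from the diagonal part of `p` to `p` keeps the diagonal fixed, hence stays
  -- invertible and upper triangular.
  let q : ℝ → Matrix (Fin n) (Fin n) ℝ := fun s => D + s • (p - D)
  have hp' : (p : Matrix (Fin n) (Fin n) ℝ).BlockTriangular id := hp
  have hN : ∀ a b, ¬ a < b → ((p : Matrix (Fin n) (Fin n) ℝ) - D) a b = 0 := by
    intro a b hab
    rcases eq_or_lt_of_le (not_lt.1 hab) with h1 | h1
    · subst h1; simp [D, ht]
    · simp [D, hp' h1, h1.ne']
  have hq : ∀ s, (q s).BlockTriangular id := by
    intro s a b hab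
    have h1 : b < a := hab
    simp only [q, Matrix.add_apply, Matrix.smul_apply, hN a b (not_lt.2 h1.le)]
    simp [D, h1.ne']
  have hqd : ∀ s i, q s i i = t i := by
    intro s i
    simp only [q, Matrix.add_apply, Matrix.smul_apply, hN i i (lt_irrefl _)]
    simp [D]
  have hdet : ∀ s, (q s).det ≠ 0 := by
    intro s
    rw [Matrix.det_of_isUpperTriangular (hq s)]
    exact Finset.prod_ne_zero_iff.2 fun i _ => by rw [hqd]; exact (t i).ne_zero
  let Q : ℝ → GL (Fin n) ℝ := fun s => Matrix.GeneralLinearGroup.mkOfDetNeZero (q s) (hdet s)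
  have hQ : ∀ s, (Q s : Matrix (Fin n) (Fin n) ℝ) = q s := fun s => rfl
  have hderiv : ∀ s, HasDerivAt (fun s => f (g * Q s)) 0 s := by
    intro s
    -- The logarithmic derivative of the curve: upper triangular times strictly upper triangular, so
    -- only `ε^{a,b}` with `a < b` occur.
    let X : Matrix (Fin n) (Fin n) ℝ := ((Q s)⁻¹ : GL (Fin n) ℝ) * (p - D)
    have hγ : HasDerivAt (fun s => ((g * Q s : GL (Fin n) ℝ) : Matrix (Fin n) (Fin n) ℝ))
        ((g * Q s : GL (Fin n) ℝ) * X) s := by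
      have h1 : HasDerivAt (fun s : ℝ => (g : Matrix (Fin n) (Fin n) ℝ) * D + s •
          ((g : Matrix (Fin n) (Fin n) ℝ) * (p - D)))
          ((1 : ℝ) • ((g : Matrix (Fin n) (Fin n) ℝ) * (p - D))) s :=
        ((hasDerivAt_id s).smul_const _).const_add _
      convert! h1 using 1
      · funext s
        rw [Units.val_mul, hQ]
        simp only [q, mul_add, mul_smul_comm]
      · rw [one_smul, Units.val_mul, mul_assoc]
        simp only [X]
        rw [← mul_assoc ((Q s : GL (Fin n) ℝ) : Matrix (Fin n) (Fin n) ℝ), ← Units.val_mul,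
          mul_inv_cancel, Units.val_one, one_mul]
    have h1 := hasDerivAt_comp_curve hf hγ
    have h2 : rightDeriv X f (g * Q s) = 0 := by
      rw [rightDeriv_eq_sum]
      refine Finset.sum_eq_zero fun a _ => Finset.sum_eq_zero fun b _ => ?_
      by_cases hab : a < b
      · rw [h0 a b hab]; simp
      · have hQinv : (((Q s)⁻¹ : GL (Fin n) ℝ) : Matrix (Fin n) (Fin n) ℝ).BlockTriangular id :=
          (borelGL n).inv_mem (show Q s ∈ borelGL n from hq s)
        have : X a b = 0 := by
          simp only [X, Matrix.mul_apply]
          refine Finset.sum_eq_zero fun e _ => ?_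
          by_cases hea : e < a
          · rw [hQinv hea, zero_mul]
          · rw [hN e b (fun h => hab (lt_of_le_of_lt (not_lt.1 hea) h)), mul_zero]
        rw [this]; simp
    rwa [h2] at h1
  have hconst := is_const_of_deriv_eq_zero (f := fun s => f (g * Q s))
    (fun s => (hderiv s).differentiableAt) (fun s => (hderiv s).deriv) 1 0
  have hQ1 : Q 1 = p := by ext a b; rw [hQ]; simp [q]
  have hQ0 : Q 0 = diagGL t := by ext a b; rw [hQ]; simp [q, coe_diagGL, D]
  simp only [hQ1, hQ0] at hconst
  rw [hconst, h]

theorem signedPow_exp (ξ : ZMod 2) (z : ℂ) (s : ℝ) :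
    signedPow ξ z (Real.exp s) = Complex.exp (s * z) := by
  simp only [signedPow, sign_pos (Real.exp_pos s), abs_of_pos (Real.exp_pos s)]
  rw [Complex.cpow_def_of_ne_zero (by exact_mod_cast (Real.exp_pos s).ne'),
    ← Complex.ofReal_log (Real.exp_pos s).le, Real.log_exp]
  simp

theorem signedPow_one (ξ : ZMod 2) (z : ℂ) : signedPow ξ z 1 = 1 := by
  simpa using signedPow_exp ξ z 0

/-- Since `sgn(x) |x| = x`, a polynomial factor shifts the sign and the exponent together; this is
why the parity conditions on `η` accompany the integrality of `n₁`, `n₂`. -/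
theorem signedPow_add_one (ξ : ZMod 2) (z : ℂ) {x : ℝ} (hx : x ≠ 0) :
    signedPow (ξ + 1) (z + 1) x = signedPow ξ z x * x := by
  have hx' : ((|x| : ℝ) : ℂ) ≠ 0 := by exact_mod_cast (abs_pos.2 hx).ne'
  have key : ((SignType.sign x : ℝ) : ℂ) ^ (ξ + 1).val =
      ((SignType.sign x : ℝ) : ℂ) ^ ξ.val * ((SignType.sign x : ℝ) : ℂ) := by
    have h2 : ((SignType.sign x : ℝ) : ℂ) ^ 2 = 1 := by
      rcases lt_or_gt_of_ne hx with h | h <;> simp [h]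
    rw [← pow_succ, ZMod.val_add, ZMod.val_one, ← pow_mod_orderOf, ← pow_mod_orderOf _ (ξ.val + 1),
      Nat.mod_mod_of_dvd _ (orderOf_dvd_of_pow_eq_one h2)]
  rw [signedPow, signedPow, key, Complex.cpow_add _ _ hx', Complex.cpow_one]
  have : ((SignType.sign x : ℝ) : ℂ) * ((|x| : ℝ) : ℂ) = x := by
    rw [← Complex.ofReal_mul, sign_mul_abs]
  linear_combination ((SignType.sign x : ℝ) : ℂ) ^ ξ.val * ((|x| : ℝ) : ℂ) ^ z * this

theorem signedPow_add_natCast (ξ : ZMod 2) (z : ℂ) {x : ℝ} (hx : x ≠ 0) (k : ℕ) :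
    signedPow (ξ + k) (z + k) x = signedPow ξ z x * (x : ℂ) ^ k := by
  induction k with
  | zero => simp
  | succ k ih =>
    push_cast
    rw [← add_assoc, ← add_assoc, signedPow_add_one _ _ hx, ih, pow_succ, mul_assoc]

/-- The Borel subgroup is torus times unipotent radical. For smooth functions, invariance under the
radical can be tested on its Lie algebra, which turns equivariance into commutator identities. -/
theorem mem_principalSeriesSubmodule_iff {ξ : Fin n → ZMod 2} {lam : Fin n → ℂ}
    {f : GL (Fin n) ℝ → ℂ} :
    f ∈ principalSeriesSubmodule n ξ lam ↔ SmoothGL f ∧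
      HasWeight (fun t => inducingChar ξ lam (diagGL t)) f ∧ ∀ i j, i < j → epsGL i j f = 0 := by
  constructor
  · rintro ⟨hs, he⟩
    refine ⟨hs, fun g t => he g _ (diagGL_mem_borel t), fun i j hij => funext fun g => ?_⟩
    let γ : ℝ → GL (Fin n) ℝ := fun s =>
      { val := Matrix.transvection i j s
        inv := Matrix.transvection i j (-s)
        val_inv := by rw [Matrix.transvection_mul_transvection_same _ _ hij.ne]; simp
        inv_val := by rw [Matrix.transvection_mul_transvection_same _ _ hij.ne]; simp }
    have hγv : ∀ s, (γ s : Matrix (Fin n) (Fin n) ℝ) = 1 + s • Matrix.single i j (1 : ℝ) := by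
      intro s; simp [γ, Matrix.transvection]
    have hγb : ∀ s, γ s ∈ borelGL n := by
      intro s
      change ((γ s : GL (Fin n) ℝ) : Matrix (Fin n) (Fin n) ℝ).BlockTriangular id
      rw [hγv]
      intro a b hab
      have h1 : b < a := hab
      have : ¬ (i = a ∧ j = b) := by rintro ⟨rfl, rfl⟩; exact absurd hij (not_lt.2 h1.le)
      simp [this, h1.ne']
    have hγd : ∀ s a, (γ s : Matrix (Fin n) (Fin n) ℝ) a a = 1 := by
      intro s a
      have : ¬ (i = a ∧ j = a) := by rintro ⟨rfl, h⟩; exact hij.ne' h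
      rw [hγv]; simp [this]
    have hd : HasDerivAt (fun s => ((g * γ s : GL (Fin n) ℝ) : Matrix (Fin n) (Fin n) ℝ))
        ((g * γ 0 : GL (Fin n) ℝ) * Matrix.single i j (1 : ℝ)) 0 := by
      have h1 : HasDerivAt (fun s : ℝ => (g : Matrix (Fin n) (Fin n) ℝ) + s •
          ((g : Matrix (Fin n) (Fin n) ℝ) * Matrix.single i j (1 : ℝ)))
          ((1 : ℝ) • ((g : Matrix (Fin n) (Fin n) ℝ) * Matrix.single i j (1 : ℝ))) 0 :=
        ((hasDerivAt_id 0).smul_const _).const_add _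
      convert! h1 using 1
      · funext s
        rw [Units.val_mul, hγv, mul_add, mul_one, mul_smul_comm]
      · rw [Units.val_mul, hγv]; simp
    have h1 := hasDerivAt_comp_curve hs hd
    have h2 : (fun s => f (g * γ s)) = fun _ => f g := by
      funext s
      rw [he g _ (hγb s)]
      simp [inducingChar, hγd, signedPow_one]
    rw [h2] at h1
    have h3 : γ 0 = 1 := by ext a b; rw [hγv]; simp
    rw [h3, mul_one] at h1
    exact h1.unique (hasDerivAt_const _ _)
  · rintro ⟨hs, hw, h0⟩
    refine ⟨hs, fun g p hp => ?_⟩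
    have hne : ∀ i, (p : Matrix (Fin n) (Fin n) ℝ) i i ≠ 0 := by
      have : (p : Matrix (Fin n) (Fin n) ℝ).det ≠ 0 :=
        ((Matrix.isUnit_iff_isUnit_det _).1 p.isUnit).ne_zero
      rw [Matrix.det_of_isUpperTriangular hp] at this
      exact fun i => Finset.prod_ne_zero_iff.1 this i (Finset.mem_univ i)
    rw [apply_mul_of_epsGL_eq_zero hw hs h0 g hp (t := fun i => Units.mk0 _ (hne i)) fun i => rfl]
    congr 1
    simp [inducingChar, coe_diagGL]

theorem epsGL_self_of_mem {ξ : Fin n → ZMod 2} {lam : Fin n → ℂ}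
    {f : GL (Fin n) ℝ → ℂ} (hf : f ∈ principalSeriesSubmodule n ξ lam) (i : Fin n) :
    epsGL i i f = (-lam i - rhoGL n i) • f := by
  obtain ⟨hs, hw, -⟩ := mem_principalSeriesSubmodule_iff.1 hf
  refine hw.eps_self hs fun s => ?_
  rw [inducingChar, Finset.prod_eq_single i]
  · simp only [coe_diagGL, Matrix.diagonal_apply_eq, expAt, Function.update_self, Units.val_mk0]
    exact signedPow_exp _ _ _
  · intro b _ hb
    simp [coe_diagGL, expAt, hb, signedPow_one]
  · simp

end torus

/-! ### Minors of the first two rows. -/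

section minors

variable {n : ℕ}

/-- The entry `(i, j)` as a complex valued function on `GL(n, ℝ)`. -/
def entryGL (i j : Fin n) (g : GL (Fin n) ℝ) : ℂ := ((g : Matrix (Fin n) (Fin n) ℝ) i j : ℝ)

/-- The linear form `M ↦ M i j`, with values in `ℂ`. -/
def entryCLM (i j : Fin n) : Matrix (Fin n) (Fin n) ℝ →L[ℝ] ℂ :=
  LinearMap.toContinuousLinearMap (Complex.ofRealCLM.toLinearMap ∘ₗ Matrix.entryLinearMap ℝ ℝ i j)

theorem entryCLM_apply (i j : Fin n) (M : Matrix (Fin n) (Fin n) ℝ) :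
    entryCLM i j M = (M i j : ℝ) := rfl

theorem smoothGL_entry (i j : Fin n) : SmoothGL (entryGL i j) :=
  smoothGL_of_contDiffOn (F := entryCLM i j) (entryCLM i j).contDiff.contDiffOn fun _ => rfl

theorem epsGL_entry (i j a b : Fin n) (g : GL (Fin n) ℝ) :
    epsGL i j (entryGL a b) g = if j = b then entryGL a i g else 0 := by
  have he : extendGL (entryGL a b) =ᶠ[nhds (g : Matrix (Fin n) (Fin n) ℝ)] entryCLM a b :=
    extendGL_eventuallyEq (Filter.Eventually.of_forall fun _ => rfl)
  have h1 : epsGL i j (entryGL a b) g =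
      entryCLM a b ((g : Matrix (Fin n) (Fin n) ℝ) * Matrix.single i j (1 : ℝ)) := by
    rw [epsGL, he.fderiv_eq]
    exact fderiv_coe_clm_apply _ _ _
  rw [h1, entryCLM_apply]
  split_ifs with h
  · subst h; simp [entryGL]
  · simp [Matrix.mul_single_apply_of_ne _ _ _ _ _ (Ne.symm h)]

theorem epsGL_add {f₁ f₂ : GL (Fin n) ℝ → ℂ} (h₁ : SmoothGL f₁) (h₂ : SmoothGL f₂)
    (i j : Fin n) (g : GL (Fin n) ℝ) :
    epsGL i j (fun g => f₁ g + f₂ g) g = epsGL i j f₁ g + epsGL i j f₂ g :=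
  congrFun (rightDeriv_add h₁ h₂ _) g

theorem epsGL_const_mul {f : GL (Fin n) ℝ → ℂ} (h : SmoothGL f) (c : ℂ)
    (i j : Fin n) (g : GL (Fin n) ℝ) :
    epsGL i j (fun g => c * f g) g = c * epsGL i j f g :=
  congrFun (rightDeriv_smul h c _) g

theorem epsGL_mul {f₁ f₂ : GL (Fin n) ℝ → ℂ} (h₁ : SmoothGL f₁) (h₂ : SmoothGL f₂)
    (i j : Fin n) (g : GL (Fin n) ℝ) :
    epsGL i j (fun g => f₁ g * f₂ g) g = epsGL i j f₁ g * f₂ g + f₁ g * epsGL i j f₂ g :=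
  rightDeriv_mul h₁ h₂ _ g

theorem epsGL_zero (i j : Fin n) : epsGL i j (0 : GL (Fin n) ℝ → ℂ) = 0 := by
  have h := rightDeriv_smul (IsDiffOp.smoothGL_const (n := n) 0) 0 (Matrix.single i j (1 : ℝ))
  rw [zero_smul, zero_smul] at h
  exact h

theorem SmoothGL.eps {f : GL (Fin n) ℝ → ℂ} (h : SmoothGL f) (i j : Fin n) :
    SmoothGL (epsGL i j f) := h.rightDeriv _

/-- The minor of `g` with rows `1, 2` and columns `a, b`. -/
def topMinor (a b : Fin 3) (g : GL (Fin 3) ℝ) : ℂ :=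
  entryGL 0 a g * entryGL 1 b g + (-1) * (entryGL 0 b g * entryGL 1 a g)

theorem topMinor_eq_det (a b : Fin 3) (g : GL (Fin 3) ℝ) : topMinor a b g =
    (((g : Matrix (Fin 3) (Fin 3) ℝ).submatrix ![0, 1] ![a, b]).det : ℝ) := by
  rw [Matrix.det_fin_two]; simp [topMinor, entryGL]; ring

theorem Psi₃_eq : Psi₃ = topMinor 0 1 := funext fun g => (topMinor_eq_det _ _ g).symm
theorem Psi₂_eq : Psi₂ = topMinor 0 2 := funext fun g => (topMinor_eq_det _ _ g).symm
theorem Psi₁_eq : Psi₁ = topMinor 1 2 := funext fun g => (topMinor_eq_det _ _ g).symm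

theorem smoothGL_topMinor (a b : Fin 3) : SmoothGL (topMinor a b) :=
  ((smoothGL_entry 0 a).mul (smoothGL_entry 1 b)).add
    (((smoothGL_entry 0 b).mul (smoothGL_entry 1 a)).const_mul _)

/-- `ε^{i,j}` is a derivation that replaces column `j` by column `i`. -/
theorem epsGL_topMinor (i j a b : Fin 3) (g : GL (Fin 3) ℝ) :
    epsGL i j (topMinor a b) g =
      (if j = a then topMinor i b g else 0) + (if j = b then topMinor a i g else 0) := by
  have h1 := (smoothGL_entry (0 : Fin 3) a).mul (smoothGL_entry 1 b)
  have h2 := (smoothGL_entry (0 : Fin 3) b).mul (smoothGL_entry 1 a)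
  have : epsGL i j (topMinor a b) g = _ := epsGL_add h1 (h2.const_mul (-1)) i j g
  rw [this, epsGL_const_mul h2, epsGL_mul (smoothGL_entry _ _) (smoothGL_entry _ _),
    epsGL_mul (smoothGL_entry _ _) (smoothGL_entry _ _)]
  simp only [epsGL_entry, topMinor]
  split_ifs <;> ring

theorem topMinor_self (a : Fin 3) (g : GL (Fin 3) ℝ) : topMinor a a g = 0 := by
  simp only [topMinor]; ring

theorem hasWeight_topMinor (a b : Fin 3) :
    HasWeight (fun t => ((t a : ℝ) * (t b : ℝ) : ℝ)) (topMinor a b) := by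
  intro g t
  simp only [topMinor, entryGL, Units.val_mul, coe_diagGL, Matrix.mul_diagonal]
  push_cast; ring

/-- On the first two rows `diag(h, 1)` acts through `h`. This factor `det h` is all that separates
`𝓕_j` from being `H`-equivariant. -/
theorem topMinor_embed_mul (a b : Fin 3) (h : GL (Fin 2) ℝ) (g : GL (Fin 3) ℝ) :
    topMinor a b (embedGL h * g) =
      ((h : Matrix (Fin 2) (Fin 2) ℝ).det : ℝ) * topMinor a b g := by
  simp only [topMinor, entryGL, Units.val_mul, Matrix.mul_apply, Fin.sum_univ_three,
    Matrix.det_fin_two]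
  simp [embedGL, embedMatrix]
  ring

end minors

/-! ### The operators `𝓕₁`, `𝓕₂` between principal series of `GL(3, ℝ)`. -/

section source

/-- The shift of the sign parameter effected by `𝓕_j`. -/
def eHatSign (j : Fin 3) : Fin 3 → ZMod 2 := fun k => if k = j then 0 else 1

theorem inducingChar_shift (ξ : Fin 3 → ZMod 2) (lam : Fin 3 → ℂ) (j : Fin 3) (t : Fin 3 → ℝˣ) :
    inducingChar (ξ + eHatSign j) (lam - eHat j) (diagGL t) =
      inducingChar ξ lam (diagGL t) * ∏ k, if k = j then 1 else ((t k : ℝ) : ℂ) := by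
  rw [inducingChar, inducingChar, ← Finset.prod_mul_distrib]
  refine Finset.prod_congr rfl fun k _ => ?_
  by_cases hk : k = j
  · simp [eHatSign, eHat, hk]
  · simp only [Pi.add_apply, Pi.sub_apply, eHatSign, eHat, hk, if_false]
    rw [show -(lam k - 1) - rhoGL 3 k = (-lam k - rhoGL 3 k) + 1 by ring, signedPow_add_one]
    · simp [coe_diagGL]
    · simp [coe_diagGL]

variable {ξ : Fin 3 → ZMod 2} {lam : Fin 3 → ℂ} {f : GL (Fin 3) ℝ → ℂ}

/-- The simple root vectors suffice, because `E_{1,3} = [E_{1,2}, E_{2,3}]`. -/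
theorem mem_principalSeriesSubmodule_three (hs : SmoothGL f)
    (hw : HasWeight (fun t => inducingChar ξ lam (diagGL t)) f)
    (h01 : epsGL 0 1 f = 0) (h12 : epsGL 1 2 f = 0) : f ∈ principalSeriesSubmodule 3 ξ lam := by
  have h02 : epsGL 0 2 f = 0 := by
    funext g
    have := epsGL_comm hs 0 1 1 2 g
    rw [h01, h12, epsGL_zero, epsGL_zero] at this
    simpa using this.symm
  refine mem_principalSeriesSubmodule_iff.2 ⟨hs, hw, fun i j hij => ?_⟩
  fin_cases i <;> fin_cases j <;> first | exact h01 | exact h12 | exact h02 | simp at hij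

theorem sourceF₂_eq (lam : Fin 3 → ℂ) (f : GL (Fin 3) ℝ → ℂ) : sourceF₂ lam f = fun g =>
    topMinor 0 1 g * epsGL 2 1 f g + (-lamDiff lam 2 1) * (topMinor 0 2 g * f g) := by
  funext g; rw [sourceF₂, Psi₃_eq, Psi₂_eq]; ring

theorem sourceF₁_eq (lam : Fin 3 → ℂ) (f : GL (Fin 3) ℝ → ℂ) : sourceF₁ lam f = fun g =>
    (topMinor 0 1 g * (epsGL 2 1 (epsGL 1 0 f) g + lamDiff lam 1 0 * epsGL 2 0 f g) +
      (-lamDiff lam 2 0) * (topMinor 0 2 g * epsGL 1 0 f g)) +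
    (lamDiff lam 2 0 * lamDiff lam 1 0) * (topMinor 1 2 g * f g) := by
  funext g; rw [sourceF₁, Psi₃_eq, Psi₂_eq, Psi₁_eq]; ring

theorem isDiffOp_sourceF₂ (lam : Fin 3 → ℂ) : IsDiffOp (fun g => g) (sourceF₂ lam) := by
  have e : sourceF₂ lam = fun f g =>
    topMinor 0 1 g * epsGL 2 1 f g + (-lamDiff lam 2 1) * (topMinor 0 2 g * f g) :=
    funext (sourceF₂_eq lam)
  rw [e]
  exact ((IsDiffOp.mul (smoothGL_topMinor _ _)).comp (IsDiffOp.epsGL 2 1) continuous_id).add_op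
    ((IsDiffOp.const_mul _).comp (IsDiffOp.mul (smoothGL_topMinor _ _)) continuous_id)

theorem isDiffOp_sourceF₁ (lam : Fin 3 → ℂ) : IsDiffOp (fun g => g) (sourceF₁ lam) := by
  have e : sourceF₁ lam = fun f g => _ := funext (sourceF₁_eq lam)
  rw [e]
  refine IsDiffOp.add_op (IsDiffOp.add_op ?_ ?_) ?_
  · refine (IsDiffOp.mul (smoothGL_topMinor 0 1)).comp (A := fun f g =>
      epsGL 2 1 (epsGL 1 0 f) g + lamDiff lam 1 0 * epsGL 2 0 f g) ?_ continuous_id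
    exact ((IsDiffOp.epsGL 2 1).comp (IsDiffOp.epsGL 1 0) continuous_id).add_op
      ((IsDiffOp.const_mul _).comp (IsDiffOp.epsGL 2 0) continuous_id)
  · exact (IsDiffOp.const_mul _).comp ((IsDiffOp.mul (smoothGL_topMinor 0 2)).comp
      (IsDiffOp.epsGL 1 0) continuous_id) continuous_id
  · exact (IsDiffOp.const_mul _).comp (IsDiffOp.mul (smoothGL_topMinor 1 2)) continuous_id

/-- Under `ε^{2,3}` the commutator `E_{2,2} - E_{3,3}` gives `λ_{3,2} Ψ₃ f`, and since `ε^{2,3} Ψ₂ =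
Ψ₃` the second term cancels it. Under `ε^{1,2}` each piece vanishes separately. -/
theorem sourceF₂_mem (hf : f ∈ principalSeriesSubmodule 3 ξ lam) :
    sourceF₂ lam f ∈ principalSeriesSubmodule 3 (ξ + eHatSign 1) (lam - eHat 1) := by
  obtain ⟨hs, hw, h0⟩ := mem_principalSeriesSubmodule_iff.1 hf
  have h01 : epsGL 0 1 f = 0 := h0 0 1 (by decide)
  have h12 : epsGL 1 2 f = 0 := h0 1 2 (by decide)
  have h11 := epsGL_self_of_mem hf 1
  have h22 := epsGL_self_of_mem hf 2
  have s1 := (smoothGL_topMinor 0 1).mul (hs.eps 2 1)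
  have s2 := (smoothGL_topMinor 0 2).mul hs
  have key : ∀ i j g, epsGL i j (sourceF₂ lam f) g =
      (epsGL i j (topMinor 0 1) g * epsGL 2 1 f g +
        topMinor 0 1 g * epsGL i j (epsGL 2 1 f) g) + (-lamDiff lam 2 1) *
      (epsGL i j (topMinor 0 2) g * f g + topMinor 0 2 g * epsGL i j f g) := by
    intro i j g
    rw [sourceF₂_eq, epsGL_add s1 (s2.const_mul _), epsGL_const_mul s2,
      epsGL_mul (smoothGL_topMinor _ _) (hs.eps _ _), epsGL_mul (smoothGL_topMinor _ _) hs]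
  refine mem_principalSeriesSubmodule_three ((isDiffOp_sourceF₂ lam).smooth hs) ?_ ?_ ?_
  · intro g t
    have w1 := (hasWeight_topMinor 0 1).mul (hw.eps hs 2 1) g t
    have w2 := (hasWeight_topMinor 0 2).mul hw g t
    have ht : ((t 1 : ℝ) : ℂ) ≠ 0 := by exact_mod_cast (t 1).ne_zero
    simp only [sourceF₂_eq] at w1 w2 ⊢
    rw [w1, w2, inducingChar_shift, Fin.prod_univ_three]
    simp
    field_simp
  · funext g
    rw [key, epsGL_comm hs, epsGL_topMinor, epsGL_topMinor, h01, epsGL_zero]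
    simp [topMinor_self]
  · funext g
    rw [key, epsGL_comm hs, epsGL_topMinor, epsGL_topMinor, h12, epsGL_zero, h11, h22]
    simp [rhoGL, lamDiff]
    ring

/-- Under `ε^{1,2}`, the relation `ε^{1,2} ε^{2,1} f = λ_{2,1} f` makes the two `Ψ₃` terms cancel
each other, and the `Ψ₂` and `Ψ₁` terms cancel because `ε^{1,2} Ψ₁ = Ψ₂`. Under `ε^{2,3}` the `Ψ₃`
terms add up to `λ_{3,1} Ψ₃ ε^{2,1} f`, which `ε^{2,3} Ψ₂ = Ψ₃` cancels. -/
theorem sourceF₁_mem (hf : f ∈ principalSeriesSubmodule 3 ξ lam) :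
    sourceF₁ lam f ∈ principalSeriesSubmodule 3 (ξ + eHatSign 0) (lam - eHat 0) := by
  obtain ⟨hs, hw, h0⟩ := mem_principalSeriesSubmodule_iff.1 hf
  have h01 : epsGL 0 1 f = 0 := h0 0 1 (by decide)
  have h12 : epsGL 1 2 f = 0 := h0 1 2 (by decide)
  have h00 := epsGL_self_of_mem hf 0
  have h11 := epsGL_self_of_mem hf 1
  have h22 := epsGL_self_of_mem hf 2
  have s20 := (hs.eps 2 0).const_mul (lamDiff lam 1 0)
  have s0 : SmoothGL (fun g => epsGL 2 1 (epsGL 1 0 f) g + lamDiff lam 1 0 * epsGL 2 0 f g) :=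
    ((hs.eps 1 0).eps 2 1).add s20
  have s1 := (smoothGL_topMinor 0 1).mul s0
  have s2 := (smoothGL_topMinor 0 2).mul (hs.eps 1 0)
  have s3 := (smoothGL_topMinor 1 2).mul hs
  have s12 : SmoothGL (fun g =>
      topMinor 0 1 g * (epsGL 2 1 (epsGL 1 0 f) g + lamDiff lam 1 0 * epsGL 2 0 f g) +
        (-lamDiff lam 2 0) * (topMinor 0 2 g * epsGL 1 0 f g)) := s1.add (s2.const_mul _)
  have key : ∀ i j g, epsGL i j (sourceF₁ lam f) g =
      ((epsGL i j (topMinor 0 1) g *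
          (epsGL 2 1 (epsGL 1 0 f) g + lamDiff lam 1 0 * epsGL 2 0 f g) +
        topMinor 0 1 g * (epsGL i j (epsGL 2 1 (epsGL 1 0 f)) g +
          lamDiff lam 1 0 * epsGL i j (epsGL 2 0 f) g)) +
      (-lamDiff lam 2 0) * (epsGL i j (topMinor 0 2) g * epsGL 1 0 f g +
        topMinor 0 2 g * epsGL i j (epsGL 1 0 f) g)) +
      (lamDiff lam 2 0 * lamDiff lam 1 0) * (epsGL i j (topMinor 1 2) g * f g +
        topMinor 1 2 g * epsGL i j f g) := by
    intro i j g
    rw [sourceF₁_eq, epsGL_add s12 (s3.const_mul _),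
      epsGL_add s1 (s2.const_mul _), epsGL_const_mul s2, epsGL_const_mul s3,
      epsGL_mul (smoothGL_topMinor _ _) s0, epsGL_mul (smoothGL_topMinor _ _) (hs.eps _ _),
      epsGL_mul (smoothGL_topMinor _ _) hs, epsGL_add ((hs.eps 1 0).eps 2 1) s20,
      epsGL_const_mul (hs.eps 2 0)]
  have hc : ∀ i j p q, epsGL i j (epsGL p q f) = fun g => epsGL p q (epsGL i j f) g +
      ((if j = p then epsGL i q f g else 0) - (if q = i then epsGL p j f g else 0)) :=
    fun i j p q => funext (epsGL_comm hs i j p q)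
  refine mem_principalSeriesSubmodule_three ((isDiffOp_sourceF₁ lam).smooth hs) ?_ ?_ ?_
  · intro g t
    have wa := (hasWeight_topMinor 0 1).mul ((hw.eps hs 1 0).eps (hs.eps 1 0) 2 1) g t
    have wb := (hasWeight_topMinor 0 1).mul (hw.eps hs 2 0) g t
    have w2 := (hasWeight_topMinor 0 2).mul (hw.eps hs 1 0) g t
    have w3 := (hasWeight_topMinor 1 2).mul hw g t
    have ht1 : ((t 1 : ℝ) : ℂ) ≠ 0 := by exact_mod_cast (t 1).ne_zero
    have ht0 : ((t 0 : ℝ) : ℂ) ≠ 0 := by exact_mod_cast (t 0).ne_zero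
    simp only [sourceF₁_eq, mul_add] at wa wb w2 w3 ⊢
    rw [mul_left_comm _ (lamDiff lam 1 0), wa, wb, w2, w3, inducingChar_shift,
      Fin.prod_univ_three]
    simp
    field_simp
  · have h0110 : epsGL 0 1 (epsGL 1 0 f) = (lam 1 - lam 0 - 1) • f := by
      rw [hc, h01, epsGL_zero, h00, h11]
      funext g
      simp [rhoGL]
      ring
    have h21 : epsGL 2 1 (epsGL 0 1 (epsGL 1 0 f)) = (lam 1 - lam 0 - 1) • epsGL 2 1 f := by
      rw [h0110]; exact rightDeriv_smul hs _ _
    funext g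
    rw [key, epsGL_comm (hs.eps 1 0), h21, h0110, epsGL_comm hs 0 1 2 0]
    simp only [epsGL_topMinor, h01, epsGL_zero]
    simp [topMinor_self, lamDiff]
    ring
  · have h1210 : epsGL 1 2 (epsGL 1 0 f) = 0 := by
      rw [hc, h12, epsGL_zero]
      funext g
      simp
    have h1110 : epsGL 1 1 (epsGL 1 0 f) = (-lam 1 + 1) • epsGL 1 0 f := by
      rw [hc, h11]
      funext g
      have : epsGL 1 0 ((-lam 1 - rhoGL 3 1) • f) = (-lam 1 - rhoGL 3 1) • epsGL 1 0 f :=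
        rightDeriv_smul hs _ _
      rw [this]
      simp [rhoGL]
      ring
    have h2210 : epsGL 2 2 (epsGL 1 0 f) = (-lam 2 + 1) • epsGL 1 0 f := by
      rw [hc, h22]
      funext g
      have : epsGL 1 0 ((-lam 2 - rhoGL 3 2) • f) = (-lam 2 - rhoGL 3 2) • epsGL 1 0 f :=
        rightDeriv_smul hs _ _
      rw [this]
      simp [rhoGL]
      exact Or.inl (by ring)
    funext g
    rw [key, epsGL_comm (hs.eps 1 0), h1210, epsGL_zero, epsGL_comm hs 1 2 2 0, h1110, h2210]
    simp only [epsGL_topMinor, h12, epsGL_zero]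
    simp [topMinor_self, lamDiff]
    ring

theorem sourceF₂Pow_mem (b : ℕ) : ∀ {ξ : Fin 3 → ZMod 2} {lam : Fin 3 → ℂ}
    {f : GL (Fin 3) ℝ → ℂ}, f ∈ principalSeriesSubmodule 3 ξ lam → sourceF₂Pow b lam f ∈
      principalSeriesSubmodule 3 (ξ + (b : ZMod 2) • eHatSign 1) (lam - (b : ℂ) • eHat 1) := by
  induction b with
  | zero => intro ξ lam f hf; simpa [sourceF₂Pow] using hf
  | succ b ih =>
    intro ξ lam f hf
    have e1 : ξ + ((b + 1 : ℕ) : ZMod 2) • eHatSign 1 =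
        ξ + eHatSign 1 + (b : ZMod 2) • eHatSign 1 := by
      push_cast; rw [add_smul, one_smul]; abel
    have e2 : lam - ((b + 1 : ℕ) : ℂ) • eHat 1 = lam - eHat 1 - (b : ℂ) • eHat 1 := by
      push_cast; rw [add_smul, one_smul]; abel
    rw [e1, e2]
    exact ih (sourceF₂_mem hf)

theorem sourceF₁Pow_mem (b : ℕ) : ∀ {ξ : Fin 3 → ZMod 2} {lam : Fin 3 → ℂ}
    {f : GL (Fin 3) ℝ → ℂ}, f ∈ principalSeriesSubmodule 3 ξ lam → sourceF₁Pow b lam f ∈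
      principalSeriesSubmodule 3 (ξ + (b : ZMod 2) • eHatSign 0) (lam - (b : ℂ) • eHat 0) := by
  induction b with
  | zero => intro ξ lam f hf; simpa [sourceF₁Pow] using hf
  | succ b ih =>
    intro ξ lam f hf
    have e1 : ξ + ((b + 1 : ℕ) : ZMod 2) • eHatSign 0 =
        ξ + eHatSign 0 + (b : ZMod 2) • eHatSign 0 := by
      push_cast; rw [add_smul, one_smul]; abel
    have e2 : lam - ((b + 1 : ℕ) : ℂ) • eHat 0 = lam - eHat 0 - (b : ℂ) • eHat 0 := by
      push_cast; rw [add_smul, one_smul]; abel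
    rw [e1, e2]
    exact ih (sourceF₁_mem hf)

theorem sourceComp_mem (a b : ℕ) (hf : f ∈ principalSeriesSubmodule 3 ξ lam) :
    sourceComp a b lam f ∈ principalSeriesSubmodule 3
      (ξ + (b : ZMod 2) • eHatSign 1 + (a : ZMod 2) • eHatSign 0)
      (lam - (b : ℂ) • eHat 1 - (a : ℂ) • eHat 0) :=
  sourceF₁Pow_mem a (sourceF₂Pow_mem b hf)

theorem isDiffOp_sourceF₂Pow (b : ℕ) : ∀ lam, IsDiffOp (fun g => g) (sourceF₂Pow b lam) := by
  induction b with
  | zero => exact fun _ => IsDiffOp.id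
  | succ b ih => exact fun lam => (ih _).comp (isDiffOp_sourceF₂ lam) continuous_id

theorem isDiffOp_sourceF₁Pow (b : ℕ) : ∀ lam, IsDiffOp (fun g => g) (sourceF₁Pow b lam) := by
  induction b with
  | zero => exact fun _ => IsDiffOp.id
  | succ b ih => exact fun lam => (ih _).comp (isDiffOp_sourceF₁ lam) continuous_id

theorem isDiffOp_sourceComp (a b : ℕ) (lam : Fin 3 → ℂ) :
    IsDiffOp (fun g => g) (sourceComp a b lam) :=
  (isDiffOp_sourceF₁Pow a _).comp (isDiffOp_sourceF₂Pow b lam) continuous_id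

theorem epsGL_leftTranslate {n : ℕ} {f : GL (Fin n) ℝ → ℂ} (hf : SmoothGL f) (a : GL (Fin n) ℝ)
    (i j : Fin n) : epsGL i j (fun g => f (a * g)) = fun g => epsGL i j f (a * g) :=
  funext fun g => rightDeriv_leftTranslate hf a _ g

theorem sourceF₂_leftTranslate (hf : SmoothGL f) (h : GL (Fin 2) ℝ) :
    (fun g => sourceF₂ lam f (embedGL h * g)) =
      (((h : Matrix (Fin 2) (Fin 2) ℝ).det : ℝ) : ℂ) •
        sourceF₂ lam fun g => f (embedGL h * g) := by
  funext g
  simp only [sourceF₂_eq, epsGL_leftTranslate hf, topMinor_embed_mul, Pi.smul_apply, smul_eq_mul]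
  ring

theorem sourceF₁_leftTranslate (hf : SmoothGL f) (h : GL (Fin 2) ℝ) :
    (fun g => sourceF₁ lam f (embedGL h * g)) =
      (((h : Matrix (Fin 2) (Fin 2) ℝ).det : ℝ) : ℂ) •
        sourceF₁ lam fun g => f (embedGL h * g) := by
  funext g
  simp only [sourceF₁_eq, epsGL_leftTranslate hf, epsGL_leftTranslate (hf.eps _ _),
    topMinor_embed_mul, Pi.smul_apply, smul_eq_mul]
  ring

theorem sourceF₂Pow_leftTranslate (h : GL (Fin 2) ℝ) (b : ℕ) : ∀ {lam : Fin 3 → ℂ}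
    {f : GL (Fin 3) ℝ → ℂ}, SmoothGL f → (fun g => sourceF₂Pow b lam f (embedGL h * g)) =
      (((h : Matrix (Fin 2) (Fin 2) ℝ).det : ℝ) : ℂ) ^ b •
        sourceF₂Pow b lam fun g => f (embedGL h * g) := by
  induction b with
  | zero => intro lam f _; simp [sourceF₂Pow]
  | succ b ih =>
    intro lam f hf
    simp only [sourceF₂Pow]
    rw [ih ((isDiffOp_sourceF₂ lam).smooth hf), sourceF₂_leftTranslate hf,
      (isDiffOp_sourceF₂Pow b _).smul _ ((isDiffOp_sourceF₂ lam).smooth (hf.leftTranslate _)),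
      smul_smul, pow_succ]

theorem sourceF₁Pow_leftTranslate (h : GL (Fin 2) ℝ) (b : ℕ) : ∀ {lam : Fin 3 → ℂ}
    {f : GL (Fin 3) ℝ → ℂ}, SmoothGL f → (fun g => sourceF₁Pow b lam f (embedGL h * g)) =
      (((h : Matrix (Fin 2) (Fin 2) ℝ).det : ℝ) : ℂ) ^ b •
        sourceF₁Pow b lam fun g => f (embedGL h * g) := by
  induction b with
  | zero => intro lam f _; simp [sourceF₁Pow]
  | succ b ih =>
    intro lam f hf
    simp only [sourceF₁Pow]
    rw [ih ((isDiffOp_sourceF₁ lam).smooth hf), sourceF₁_leftTranslate hf,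
      (isDiffOp_sourceF₁Pow b _).smul _ ((isDiffOp_sourceF₁ lam).smooth (hf.leftTranslate _)),
      smul_smul, pow_succ]

theorem sourceComp_leftTranslate (h : GL (Fin 2) ℝ) (a b : ℕ) (hf : SmoothGL f) :
    (fun g => sourceComp a b lam f (embedGL h * g)) =
      (((h : Matrix (Fin 2) (Fin 2) ℝ).det : ℝ) : ℂ) ^ (b + a) •
        sourceComp a b lam fun g => f (embedGL h * g) := by
  simp only [sourceComp]
  rw [sourceF₁Pow_leftTranslate h a ((isDiffOp_sourceF₂Pow b _).smooth hf),
    sourceF₂Pow_leftTranslate h b hf, (isDiffOp_sourceF₁Pow a _).smul _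
      ((isDiffOp_sourceF₂Pow b _).smooth (hf.leftTranslate _)), smul_smul, pow_add, mul_comm]

end source

/-! ### Powers of the lowering operator on highest weight functions of `GL(2, ℝ)`. -/

section bol

variable {n : ℕ}

theorem SmoothGL.eps_iterate {f : GL (Fin n) ℝ → ℂ} (h : SmoothGL f) (i j : Fin n) (m : ℕ) :
    SmoothGL ((epsGL i j)^[m] f) := by
  induction m with
  | zero => exact h
  | succ m ih => rw [Function.iterate_succ_apply']; exact ih.eps i j

theorem IsDiffOp.epsGL_iterate (i j : Fin n) (m : ℕ) :
    IsDiffOp (fun g => g) ((_root_.epsGL i j)^[m]) := by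
  induction m with
  | zero => exact IsDiffOp.id
  | succ m ih =>
    rw [Function.iterate_succ']
    exact (IsDiffOp.epsGL i j).comp ih continuous_id

theorem HasWeight.eps_iterate {c : (Fin n → ℝˣ) → ℂ} {f : GL (Fin n) ℝ → ℂ}
    (h : HasWeight c f) (hf : SmoothGL f) (i j : Fin n) (m : ℕ) :
    HasWeight (fun t => c t * ((t i : ℝ) / (t j : ℝ) : ℝ) ^ m) ((epsGL i j)^[m] f) := by
  induction m with
  | zero => simpa using h
  | succ m ih =>
    rw [Function.iterate_succ_apply']
    intro g t
    rw [ih.eps (hf.eps_iterate i j m) i j g t]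
    simp only [pow_succ, mul_assoc]

theorem epsGL_iterate_leftTranslate {f : GL (Fin n) ℝ → ℂ} (hf : SmoothGL f)
    (a : GL (Fin n) ℝ) (i j : Fin n) (m : ℕ) :
    (epsGL i j)^[m] (fun g => f (a * g)) = fun g => (epsGL i j)^[m] f (a * g) := by
  induction m with
  | zero => rfl
  | succ m ih =>
    rw [Function.iterate_succ_apply', ih, epsGL_leftTranslate (hf.eps_iterate i j m),
      Function.iterate_succ_apply']

theorem epsGL_cartan_iterate {f : GL (Fin 2) ℝ → ℂ} (hf : SmoothGL f) {α β : ℂ}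
    (h0 : epsGL 0 0 f = α • f) (h1 : epsGL 1 1 f = β • f) (m : ℕ) :
    epsGL 0 0 ((epsGL 1 0)^[m] f) = (α - m) • (epsGL 1 0)^[m] f ∧
      epsGL 1 1 ((epsGL 1 0)^[m] f) = (β + m) • (epsGL 1 0)^[m] f := by
  induction m with
  | zero => simp [h0, h1]
  | succ m ih =>
    have hs := hf.eps_iterate 1 0 m
    simp only [Function.iterate_succ_apply']
    have e0 : epsGL 1 0 ((α - m) • (epsGL 1 0)^[m] f) = _ := rightDeriv_smul hs (α - m) _
    have e1 : epsGL 1 0 ((β + m) • (epsGL 1 0)^[m] f) = _ := rightDeriv_smul hs (β + m) _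
    constructor
    · funext g
      rw [epsGL_comm hs, ih.1, e0]
      simp [epsGL_eq_rightDeriv]; ring
    · funext g
      rw [epsGL_comm hs, ih.2, e1]
      simp [epsGL_eq_rightDeriv]; ring

/-- The usual `sl₂` sum: moving `ε^{1,2}` past each of the `m + 1` factors contributes `α - β - 2k`
for `k = 0, …, m`. -/
theorem epsGL_raise_iterate {f : GL (Fin 2) ℝ → ℂ} (hf : SmoothGL f) {α β : ℂ}
    (h0 : epsGL 0 0 f = α • f) (h1 : epsGL 1 1 f = β • f) (h01 : epsGL 0 1 f = 0) (m : ℕ) :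
    epsGL 0 1 ((epsGL 1 0)^[m + 1] f) =
      ((m + 1) * (α - β - m)) • (epsGL 1 0)^[m] f := by
  induction m with
  | zero =>
    funext g
    rw [zero_add, Function.iterate_one, Function.iterate_zero, id, epsGL_comm hf, h01,
      epsGL_zero, h0, h1]
    simp; ring
  | succ m ih =>
    have hs := hf.eps_iterate 1 0 (m + 1)
    obtain ⟨c0, c1⟩ := epsGL_cartan_iterate hf h0 h1 (m + 1)
    funext g
    rw [Function.iterate_succ_apply', epsGL_comm hs, ih]
    have e : epsGL 1 0 (((m + 1) * (α - β - m)) • (epsGL 1 0)^[m] f) = _ :=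
      rightDeriv_smul (hf.eps_iterate 1 0 m) _ _
    rw [e, ← epsGL_eq_rightDeriv, ← Function.iterate_succ_apply' (epsGL 1 0) m]
    simp only [c0, c1, Pi.smul_apply, smul_eq_mul, if_true]
    push_cast; ring

/-- For the exponent `m` the coefficient is `m (α - β - m + 1)`, so the two alternatives are its two
zeros. -/
theorem epsGL_raise_iterate_eq_zero {f : GL (Fin 2) ℝ → ℂ} (hf : SmoothGL f) {α β : ℂ}
    (h0 : epsGL 0 0 f = α • f) (h1 : epsGL 1 1 f = β • f) (h01 : epsGL 0 1 f = 0) (m : ℕ)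
    (hm : m = 0 ∨ α - β + 1 = m) : epsGL 0 1 ((epsGL 1 0)^[m] f) = 0 := by
  cases m with
  | zero => exact h01
  | succ m =>
    rw [epsGL_raise_iterate hf h0 h1 h01]
    have : α - β - m = 0 := by
      rcases hm with h | h
      · omega
      · push_cast at h; linear_combination h
    rw [this, mul_zero, zero_smul]

end bol

/-! ### The composed operator: target space and `H`-equivariance. -/

section operator

/-- The symmetry breaking operator `det_H^{-m'} ∘ (ε_H^{2,1})^m ∘ rest₂ ∘ 𝓕₁^a ∘ 𝓕₂^b`. -/
def breakingOp (m' m a b : ℕ) (lam : Fin 3 → ℂ) (f : GL (Fin 3) ℝ → ℂ) : GL (Fin 2) ℝ → ℂ :=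
  untwist m' ((epsGL 1 0)^[m] (rest₂ (sourceComp a b lam f)))

/-- The linear part of the affine map `embedMatrix`. -/
def embedLin : Matrix (Fin 2) (Fin 2) ℝ →ₗ[ℝ] Matrix (Fin 3) (Fin 3) ℝ where
  toFun h := !![h 0 0, h 0 1, 0; h 1 0, h 1 1, 0; 0, 0, 0]
  map_add' a b := by ext i j; fin_cases i <;> fin_cases j <;> simp
  map_smul' c a := by ext i j; fin_cases i <;> fin_cases j <;> simp

theorem contDiff_embedMatrix : ContDiff ℝ ∞ embedMatrix := by
  have h : ∀ M, embedMatrix M = embedLin.toContinuousLinearMap M + Matrix.single 2 2 1 := by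
    intro M
    ext i j
    fin_cases i <;> fin_cases j <;> simp [embedMatrix, embedLin]
  have h' : (embedMatrix : Matrix (Fin 2) (Fin 2) ℝ → Matrix (Fin 3) (Fin 3) ℝ) =
      fun M => embedLin.toContinuousLinearMap M + Matrix.single 2 2 1 := funext h
  rw [h']
  exact embedLin.toContinuousLinearMap.contDiff.add contDiff_const

theorem coe_embedGL (h : GL (Fin 2) ℝ) :
    (embedGL h : Matrix (Fin 3) (Fin 3) ℝ) = embedMatrix h := rfl

theorem continuous_embedGL : Continuous embedGL := by
  rw [isOpenEmbedding_val_GL.continuous_iff]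
  exact contDiff_embedMatrix.continuous.comp Units.continuous_val

theorem isDiffOp_rest₂ : IsDiffOp embedGL rest₂ := by
  have := IsDiffOp.mul_comp (IsDiffOp.smoothGL_const 1) contDiff_embedMatrix
    (φ := embedGL) fun g => (coe_embedGL g).symm
  simp only [one_mul] at this
  exact this

theorem smoothGL_det_inv {n : ℕ} : SmoothGL fun h : GL (Fin n) ℝ =>
    (((h : Matrix (Fin n) (Fin n) ℝ).det : ℝ) : ℂ)⁻¹ := by
  have hdet : ContDiff ℝ ∞ fun M : Matrix (Fin n) (Fin n) ℝ => M.det := by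
    simp only [Matrix.det_apply]
    refine ContDiff.sum fun σ _ => ContDiff.const_smul _ (contDiff_prod fun i _ => ?_)
    exact (LinearMap.toContinuousLinearMap (Matrix.entryLinearMap ℝ ℝ (σ i) i)).contDiff
  refine smoothGL_of_contDiffOn (F := fun M => ((M.det : ℝ) : ℂ)⁻¹) ?_ fun _ => rfl
  refine ContDiffOn.inv (Complex.ofRealCLM.contDiff.comp hdet).contDiffOn fun M hM => ?_
  exact Complex.ofReal_ne_zero.2 ((Matrix.isUnit_iff_isUnit_det _).1 hM).ne_zero

theorem isDiffOp_untwist (m : ℕ) : IsDiffOp (fun g => g) (untwist m) := by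
  refine IsDiffOp.mul (J := fun h : GL (Fin 2) ℝ =>
    (((h : Matrix (Fin 2) (Fin 2) ℝ).det : ℝ) : ℂ)⁻¹ ^ m) ?_
  induction m with
  | zero => simpa using IsDiffOp.smoothGL_const 1
  | succ m ih => simpa only [pow_succ] using ih.mul smoothGL_det_inv

theorem isDiffOp_breakingOp (m' m a b : ℕ) (lam : Fin 3 → ℂ) :
    IsDiffOp embedGL (breakingOp m' m a b lam) :=
  (isDiffOp_untwist m').comp ((IsDiffOp.epsGL_iterate 1 0 m).comp
    (isDiffOp_rest₂.comp (isDiffOp_sourceComp a b lam) continuous_embedGL) continuous_id)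
    continuous_id

/-- The shift by `1/2` is the difference of `ρ = (1, 0, -1)` and `ρ_H = (1/2, -1/2)` on the first
two coordinates. -/
theorem rest₂_mem {ξ : Fin 3 → ZMod 2} {lam : Fin 3 → ℂ} {f : GL (Fin 3) ℝ → ℂ}
    (hf : f ∈ principalSeriesSubmodule 3 ξ lam) : rest₂ f ∈ principalSeriesSubmodule 2
      ![ξ 0, ξ 1] ![lam 0 + 1 / 2, lam 1 + 1 / 2] := by
  refine ⟨isDiffOp_rest₂.smooth hf.1, fun g p hp => ?_⟩
  simp only [rest₂, map_mul]
  rw [hf.2 _ _ (embedGL_mem_borel hp)]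
  congr 1
  simp only [inducingChar, Fin.prod_univ_three, Fin.prod_univ_two, coe_embedGL, embedMatrix, rhoGL]
  simp [signedPow_one]
  ring_nf

theorem breakingOp_mem {ξ : Fin 3 → ZMod 2} {lam : Fin 3 → ℂ} {η : Fin 2 → ZMod 2}
    {nu : Fin 2 → ℂ} {m a b : ℕ}
    (hn₁ : nu 0 - lam 0 - 1 / 2 = (m + a : ℂ))
    (hn₂ : nu 0 + nu 1 - lam 0 - lam 1 - 1 = (b + a : ℂ))
    (hη₁ : η 0 = ξ 0 + (m + a : ZMod 2))
    (hη₂ : η 1 = ξ 1 + (m + a + (b + a) : ZMod 2))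
    (hm : m = 0 ∨ lam 0 - lam 1 + m - b + a = 0) {f : GL (Fin 3) ℝ → ℂ}
    (hf : f ∈ principalSeriesSubmodule 3 ξ lam) :
    breakingOp (b + a) m a b lam f ∈ principalSeriesSubmodule 2 η nu := by
  have hr := rest₂_mem (sourceComp_mem a b hf)
  set F := rest₂ (sourceComp a b lam f) with hF
  obtain ⟨hs, hw, h0⟩ := mem_principalSeriesSubmodule_iff.1 hr
  have h00 := epsGL_self_of_mem hr 0
  have h11 := epsGL_self_of_mem hr 1
  -- After `𝓕₁^a ∘ 𝓕₂^b` the first two parameters are `λ₁ - b` and `λ₂ - a`, so the `sl₂` condition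
  -- becomes `λ₁ - λ₂ + m - b + a = 0`.
  have hraise : epsGL 0 1 ((epsGL 1 0)^[m] F) = 0 := by
    refine epsGL_raise_iterate_eq_zero hs h00 h11 (h0 0 1 (by decide)) m (hm.imp_right fun h => ?_)
    simp [rhoGL, eHat]
    linear_combination -h
  refine ⟨(isDiffOp_breakingOp _ m a b lam).smooth hf.1, fun g p hp => ?_⟩
  have hp' : (p : Matrix (Fin 2) (Fin 2) ℝ).BlockTriangular id := hp
  have hdetp := Matrix.det_of_isUpperTriangular hp'
  rw [Fin.prod_univ_two] at hdetp
  have hne : (p : Matrix (Fin 2) (Fin 2) ℝ).det ≠ 0 :=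
    ((Matrix.isUnit_iff_isUnit_det _).1 p.isUnit).ne_zero
  rw [hdetp] at hne
  have hx := left_ne_zero_of_mul hne
  have hy := right_ne_zero_of_mul hne
  simp only [breakingOp, untwist, ← hF]
  rw [apply_mul_of_epsGL_eq_zero (hw.eps_iterate hs 1 0 m) (hs.eps_iterate 1 0 m)
    (by
      intro i j hij
      fin_cases i <;> fin_cases j <;> first | exact hraise | simp at hij) g hp
    (t := ![Units.mk0 _ hx, Units.mk0 _ hy]) (by intro i; fin_cases i <;> rfl)]
  rw [Units.val_mul, Matrix.det_mul, hdetp]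
  simp only [inducingChar, Fin.prod_univ_two, coe_diagGL, rhoGL]
  generalize (p : Matrix (Fin 2) (Fin 2) ℝ) 0 0 = x at *
  generalize (p : Matrix (Fin 2) (Fin 2) ℝ) 1 1 = y at *
  have hx' : (x : ℂ) ≠ 0 := by exact_mod_cast hx
  have hy' : (y : ℂ) ≠ 0 := by exact_mod_cast hy
  have e2 : (2 : ZMod 2) = 0 := rfl
  -- The lowering power contributes `(y/x)^m` and the determinant `(xy)^{-(a+b)}`. The sign
  -- parameters agree because doubled terms vanish in `ZMod 2`.
  have k0 : signedPow (η 0) (-nu 0 - 1 / 2) x * (x : ℂ) ^ (m + (b + a)) =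
      signedPow (ξ 0 + b) (-(lam 0 - b + 1 / 2) - 1 / 2) x := by
    rw [← signedPow_add_natCast _ _ hx]
    congr 1
    · rw [hη₁]; push_cast
      linear_combination ((m : ZMod 2) + a) * e2
    · push_cast
      linear_combination -hn₁
  have k1 : signedPow (η 1) (-nu 1 + 1 / 2) y * (y : ℂ) ^ (b + a) =
      signedPow (ξ 1 + a) (-(lam 1 - a + 1 / 2) + 1 / 2) y * (y : ℂ) ^ m := by
    rw [← signedPow_add_natCast _ _ hy, ← signedPow_add_natCast _ _ hy]
    congr 1
    · rw [hη₂]; push_cast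
      linear_combination ((b : ZMod 2) + a) * e2
    · push_cast
      linear_combination hn₁ - hn₂
  simp [eHatSign, eHat]
  have r0 : -2⁻¹ + ((b : ℂ) - lam 0) - (2 - 1) / 2 = -(lam 0 - b + 1 / 2) - 1 / 2 := by ring
  have r1 : -2⁻¹ + ((a : ℂ) - lam 1) - -1 / 2 = -(lam 1 - a + 1 / 2) + 1 / 2 := by ring
  have r2 : -nu 0 - (2 - 1) / 2 = -nu 0 - 1 / 2 := by ring
  have r3 : -nu 1 - -1 / 2 = -nu 1 + 1 / 2 := by ring
  rw [r0, r1, r2, r3, ← k0]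
  have : signedPow (η 1) (-nu 1 + 1 / 2) y =
      signedPow (ξ 1 + a) (-(lam 1 - a + 1 / 2) + 1 / 2) y * (y : ℂ) ^ m / (y : ℂ) ^ (b + a) := by
    rw [← k1]; field_simp
  rw [this]
  simp only [div_pow, mul_pow, inv_pow]
  field_simp
  ring

/-- The `a + b` operators `𝓕_j` produce `det(h)^(a+b)`, which the determinant twist removes; right
derivatives commute with left translation. -/
theorem breakingOp_leftTranslate (m a b : ℕ) (lam : Fin 3 → ℂ) {f : GL (Fin 3) ℝ → ℂ}
    (hf : SmoothGL f) (h g : GL (Fin 2) ℝ) :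
    breakingOp (b + a) m a b lam (fun g => f (embedGL h * g)) g =
      breakingOp (b + a) m a b lam f (h * g) := by
  have hd : ((h : Matrix (Fin 2) (Fin 2) ℝ).det : ℂ) ≠ 0 :=
    Complex.ofReal_ne_zero.2 ((Matrix.isUnit_iff_isUnit_det _).1 h.isUnit).ne_zero
  have hsm := (isDiffOp_sourceComp a b lam).smooth hf
  have hsm' := (isDiffOp_sourceComp a b lam).smooth (hf.leftTranslate (embedGL h))
  have h1 := congrArg rest₂ (sourceComp_leftTranslate (lam := lam) h a b hf)
  have h2 : rest₂ (fun g => sourceComp a b lam f (embedGL h * g)) =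
      fun g => rest₂ (sourceComp a b lam f) (h * g) := by
    funext g; simp only [rest₂, map_mul]
  rw [h2, isDiffOp_rest₂.smul _ hsm'] at h1
  have h3 := congrArg ((epsGL 1 0)^[m]) h1
  rw [epsGL_iterate_leftTranslate (isDiffOp_rest₂.smooth hsm),
    (IsDiffOp.epsGL_iterate 1 0 m).smul _ (isDiffOp_rest₂.smooth hsm')] at h3
  have h4 := congrFun h3 g
  simp only [Pi.smul_apply, smul_eq_mul] at h4
  simp only [breakingOp, untwist]
  rw [h4, Units.val_mul, Matrix.det_mul]
  push_cast
  simp only [mul_inv, mul_pow, inv_pow]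
  field_simp

end operator

/-! ### Differential operators are continuous for the `C^∞` topology. -/

section continuity

variable {n k : ℕ} {ξ : Fin n → ZMod 2} {lam : Fin n → ℂ} {η : Fin k → ZMod 2} {nu : Fin k → ℂ}

theorem norm_iteratedFDeriv_le_smoothSeminorm (m : ℕ) (K : TopologicalSpace.Compacts (GL (Fin n) ℝ))
    (f : PrincipalSeries n ξ lam) {g : GL (Fin n) ℝ} (hg : g ∈ K) :
    ‖iteratedFDeriv ℝ m (extendGL f.toFun) (g : Matrix (Fin n) (Fin n) ℝ)‖ ≤
      smoothSeminorm n ξ lam (m, K) f :=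
  le_ciSup (PrincipalSeries.bddAbove m K f) (⟨g, hg⟩ : K)

theorem smoothSeminorm_le {m : ℕ} {K : TopologicalSpace.Compacts (GL (Fin n) ℝ)}
    {f : PrincipalSeries n ξ lam} {B : ℝ} (hB : 0 ≤ B) (h : ∀ g ∈ K,
      ‖iteratedFDeriv ℝ m (extendGL f.toFun) (g : Matrix (Fin n) (Fin n) ℝ)‖ ≤ B) :
    smoothSeminorm n ξ lam (m, K) f ≤ B :=
  Real.iSup_le (fun g : K => h g.1 g.2) hB

/-- The linear map between principal series given by a differential operator. -/
def IsDiffOp.toLinearMap {φ : GL (Fin k) ℝ → GL (Fin n) ℝ}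
    {A : (GL (Fin n) ℝ → ℂ) → GL (Fin k) ℝ → ℂ} (hA : IsDiffOp φ A)
    (hmem : ∀ f ∈ principalSeriesSubmodule n ξ lam, A f ∈ principalSeriesSubmodule k η nu) :
    PrincipalSeries n ξ lam →ₗ[ℂ] PrincipalSeries k η nu where
  toFun f := ⟨A f.toFun, hmem _ f.2⟩
  map_add' f₁ f₂ := PrincipalSeries.ext fun g => congrFun (hA.add f₁.smooth f₂.smooth) g
  map_smul' c f := PrincipalSeries.ext fun g => congrFun (hA.smul c f.smooth) g

theorem IsDiffOp.continuous_toLinearMap {φ : GL (Fin k) ℝ → GL (Fin n) ℝ} (hφ : Continuous φ)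
    {A : (GL (Fin n) ℝ → ℂ) → GL (Fin k) ℝ → ℂ} (hA : IsDiffOp φ A)
    (hmem : ∀ f ∈ principalSeriesSubmodule n ξ lam, A f ∈ principalSeriesSubmodule k η nu) :
    Continuous (hA.toLinearMap hmem) := by
  classical
  refine WithSeminorms.continuous_of_isBounded PrincipalSeries.withSeminorms
    PrincipalSeries.withSeminorms _ fun mK => ?_
  obtain ⟨m, K⟩ := mK
  obtain ⟨N, C, hC, h⟩ := hA.bound m
  -- Seminorms of `A f` over `K` are controlled by finitely many seminorms of `f` over the image
  -- `φ(K)`.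
  let K' : TopologicalSpace.Compacts (GL (Fin n) ℝ) := K.map φ hφ
  obtain ⟨D, hD⟩ := K.isCompact.bddAbove_image hC.continuousOn
  refine ⟨(Finset.range (N + 1)).image fun j => (j, K'), ⟨max D 0, le_max_right _ _⟩, ?_⟩
  intro f
  change _ ≤ max D 0 * (((Finset.range (N + 1)).image fun j => (j, K')).sup
    (smoothSeminorm n ξ lam)) f
  have hnn := apply_nonneg ((((Finset.range (N + 1)).image fun j => (j, K'))).sup
    (smoothSeminorm n ξ lam)) f
  refine smoothSeminorm_le (mul_nonneg (le_max_right _ _) hnn) fun g hg => ?_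
  refine (h f.toFun f.smooth g _ fun j hj => ?_).trans (mul_le_mul_of_nonneg_right
    ((hD ⟨g, hg, rfl⟩).trans (le_max_left _ _)) hnn)
  refine (norm_iteratedFDeriv_le_smoothSeminorm j K' f ⟨g, hg, rfl⟩).trans ?_
  refine Seminorm.le_finset_sup_apply (p := smoothSeminorm n ξ lam) ?_
  exact Finset.mem_image.2 ⟨j, Finset.mem_range.2 (by omega), rfl⟩

end continuity

/-! ### The operator lies in `DSBO₂`. -/

section mem

variable {ξ : Fin 3 → ZMod 2} {lam : Fin 3 → ℂ} {η : Fin 2 → ZMod 2} {nu : Fin 2 → ℂ}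

theorem exists_breakingOp_mem_DSBO {m a b : ℕ}
    (hn₁ : nu 0 - lam 0 - 1 / 2 = (m + a : ℂ))
    (hn₂ : nu 0 + nu 1 - lam 0 - lam 1 - 1 = (b + a : ℂ))
    (hη₁ : η 0 = ξ 0 + (m + a : ZMod 2))
    (hη₂ : η 1 = ξ 1 + (m + a + (b + a) : ZMod 2))
    (hm : m = 0 ∨ lam 0 - lam 1 + m - b + a = 0) :
    ∃ T ∈ DSBO₂ ξ lam η nu, ∀ f : PrincipalSeries 3 ξ lam,
      (T f).toFun = breakingOp (b + a) m a b lam f.toFun := by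
  have hD := isDiffOp_breakingOp (b + a) m a b lam
  let T : PrincipalSeries 3 ξ lam →L[ℂ] PrincipalSeries 2 η nu :=
    ⟨hD.toLinearMap fun f hf => breakingOp_mem hn₁ hn₂ hη₁ hη₂ hm hf,
      hD.continuous_toLinearMap continuous_embedGL _⟩
  refine ⟨T, ⟨fun h f => PrincipalSeries.ext fun g => ?_, fun f => ?_⟩, fun f => rfl⟩
  · change breakingOp (b + a) m a b lam (fun g => f.toFun ((embedGL h)⁻¹ * g)) g =
      breakingOp (b + a) m a b lam f.toFun (h⁻¹ * g)
    rw [← map_inv]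
    exact breakingOp_leftTranslate m a b lam f.smooth _ _
  · have hcont : Continuous flagMap :=
      Continuous.quotient_map' continuous_embedGL _
    refine (image_closure_subset_closure_image hcont).trans ?_
    refine closure_minimal ?_ isClosed_closure
    rintro _ ⟨_, ⟨g, hg, rfl⟩, rfl⟩
    by_contra hn
    -- Off the closed support `f` vanishes on a whole neighbourhood, so locality of the operator
    -- applies.
    refine hg (hD.apply_eq_zero f.smooth ?_)
    have ho : IsOpen ((fun g : GL (Fin 3) ℝ => (g : GL (Fin 3) ℝ ⧸ borelGL 3)) ⁻¹'
        (sectionSupport f)ᶜ) := isClosed_closure.isOpen_compl.preimage continuous_quotient_mk'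
    filter_upwards [ho.mem_nhds hn] with g' hg'
    by_contra h0
    exact hg' (subset_closure ⟨g', h0, rfl⟩)

end mem

/-! ### Multiplicativity and smoothness of signed powers. -/

section signedPow

theorem signedPow_mul (ξ : ZMod 2) (s : ℂ) {x y : ℝ} :
    signedPow ξ s (x * y) = signedPow ξ s x * signedPow ξ s y := by
  rw [signedPow, signedPow, signedPow, sign_mul, abs_mul]
  push_cast
  rw [Complex.mul_cpow_ofReal_nonneg (abs_nonneg x) (abs_nonneg y), mul_pow]
  ring

theorem signedPow_eq_exp (ξ : ZMod 2) (s : ℂ) {x : ℝ} (hx : x ≠ 0) :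
    signedPow ξ s x = ((SignType.sign x : ℝ) : ℂ) ^ ξ.val * Complex.exp (Real.log x * s) := by
  rw [signedPow, Complex.cpow_def_of_ne_zero (by exact_mod_cast (abs_pos.2 hx).ne'),
    ← Complex.ofReal_log (abs_nonneg x), Real.log_abs]

theorem signedPow_of_pos (ξ : ZMod 2) (s : ℂ) {x : ℝ} (hx : 0 < x) :
    signedPow ξ s x = Complex.exp (Real.log x * s) := by
  rw [signedPow_eq_exp _ _ hx.ne', sign_pos hx]; simp

theorem contDiffAt_signedPow (ξ : ZMod 2) (s : ℂ) {x : ℝ} (hx : x ≠ 0) :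
    ContDiffAt ℝ ∞ (signedPow ξ s) x := by
  have h1 : ContDiffAt ℝ ∞ (fun y : ℝ => ((SignType.sign x : ℝ) : ℂ) ^ ξ.val *
      Complex.exp ((Real.log y : ℂ) * s)) x := by
    refine contDiffAt_const.mul (ContDiffAt.cexp (ContDiffAt.mul ?_ contDiffAt_const))
    exact Complex.ofRealCLM.contDiff.contDiffAt.comp x (Real.contDiffAt_log.2 hx)
  refine h1.congr_of_eventuallyEq ?_
  have h2 : ∀ᶠ y in nhds x, SignType.sign y = SignType.sign x := by
    rcases lt_or_gt_of_ne hx with h | h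
    · filter_upwards [eventually_lt_nhds h] with y hy
      rw [sign_neg hy, sign_neg h]
    · filter_upwards [eventually_gt_nhds h] with y hy
      rw [sign_pos hy, sign_pos h]
  filter_upwards [h2, eventually_ne_nhds hx] with y hy hy0
  rw [signedPow_eq_exp _ _ hy0, hy]

end signedPow

/-! ### The open cell `N⁻ P` and its coordinates. -/

section chart

/-- The lower triangular unipotent matrix with entries `x, y, z` in the places
`(2,1), (3,2), (3,1)`. -/
def nbarMat (p : Fin 3 → ℝ) : Matrix (Fin 3) (Fin 3) ℝ := !![1, 0, 0; p 0, 1, 0; p 2, p 1, 1]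

theorem det_nbarMat (p : Fin 3 → ℝ) : (nbarMat p).det = 1 := by
  simp [nbarMat, Matrix.det_fin_three]

/-- The chart `N⁻ → G / P` at the base point. -/
def nbar (p : Fin 3 → ℝ) : GL (Fin 3) ℝ :=
  Matrix.GeneralLinearGroup.mkOfDetNeZero (nbarMat p) (by rw [det_nbarMat]; exact one_ne_zero)

theorem coe_nbar (p : Fin 3 → ℝ) : (nbar p : Matrix (Fin 3) (Fin 3) ℝ) = nbarMat p := rfl

theorem nbar_zero : nbar 0 = 1 := by
  ext i j
  rw [coe_nbar]
  fin_cases i <;> fin_cases j <;> simp [nbarMat]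

theorem contDiff_nbarMat : ContDiff ℝ ∞ nbarMat := by
  have h : nbarMat = fun p => 1 + p 0 • Matrix.single 1 0 (1 : ℝ) +
      p 1 • Matrix.single 2 1 (1 : ℝ) + p 2 • Matrix.single 2 0 (1 : ℝ) := by
    funext p
    ext i j
    fin_cases i <;> fin_cases j <;> simp [nbarMat]
  rw [h]
  exact ((contDiff_const.add ((contDiff_apply ℝ ℝ 0).smul contDiff_const)).add
    ((contDiff_apply ℝ ℝ 1).smul contDiff_const)).add
    ((contDiff_apply ℝ ℝ 2).smul contDiff_const)

theorem SmoothGL.comp_nbar {f : GL (Fin 3) ℝ → ℂ} (hf : SmoothGL f) :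
    ContDiff ℝ ∞ fun p => f (nbar p) := by
  have h : (fun p => f (nbar p)) = fun p => extendGL f (nbarMat p) := by
    funext p; rw [← coe_nbar, extendGL_coe]
  rw [h, contDiff_iff_contDiffAt]
  exact fun p => ContDiffAt.comp p (hf.contDiffAt (nbar p)) contDiff_nbarMat.contDiffAt

/-- The leading principal minor of size two. -/
def minorTwo (M : Matrix (Fin 3) (Fin 3) ℝ) : ℝ := M 0 0 * M 1 1 - M 0 1 * M 1 0

/-- The minor with rows `1, 3` and columns `1, 2`. -/
def minorSide (M : Matrix (Fin 3) (Fin 3) ℝ) : ℝ := M 0 0 * M 2 1 - M 0 1 * M 2 0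

/-- The coordinates on the open cell `N⁻ P`. -/
def cellCoord (M : Matrix (Fin 3) (Fin 3) ℝ) : Fin 3 → ℝ :=
  ![M 1 0 / M 0 0, minorSide M / minorTwo M, M 2 0 / M 0 0]

/-- The open cell `N⁻ P`, as a set of invertible matrices. -/
def cell : Set (Matrix (Fin 3) (Fin 3) ℝ) := {M | IsUnit M ∧ M 0 0 ≠ 0 ∧ minorTwo M ≠ 0}

/-- The value of `inducingChar` on the component of `M` in `P`. -/
def cellChar (ξ : Fin 3 → ZMod 2) (lam : Fin 3 → ℂ) (M : Matrix (Fin 3) (Fin 3) ℝ) : ℂ :=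
  signedPow (ξ 0) (-lam 0 - 1) (M 0 0) * signedPow (ξ 1) (-lam 1) (minorTwo M / M 0 0) *
    signedPow (ξ 2) (-lam 2 + 1) (M.det / minorTwo M)

theorem inducingChar_three (ξ : Fin 3 → ZMod 2) (lam : Fin 3 → ℂ) (p : GL (Fin 3) ℝ) :
    inducingChar ξ lam p =
      signedPow (ξ 0) (-lam 0 - 1) ((p : Matrix (Fin 3) (Fin 3) ℝ) 0 0) *
      signedPow (ξ 1) (-lam 1) ((p : Matrix (Fin 3) (Fin 3) ℝ) 1 1) *
      signedPow (ξ 2) (-lam 2 + 1) ((p : Matrix (Fin 3) (Fin 3) ℝ) 2 2) := by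
  rw [inducingChar, Fin.prod_univ_three]
  have e0 : -lam 0 - rhoGL 3 0 = -lam 0 - 1 := by simp [rhoGL]; ring
  have e1 : -lam 1 - rhoGL 3 1 = -lam 1 := by simp [rhoGL]; ring
  have e2 : -lam 2 - rhoGL 3 2 = -lam 2 + 1 := by simp [rhoGL]; ring
  rw [e0, e1, e2]

theorem contDiff_entry (i j : Fin 3) :
    ContDiff ℝ ∞ fun M : Matrix (Fin 3) (Fin 3) ℝ => M i j :=
  (LinearMap.toContinuousLinearMap (Matrix.entryLinearMap ℝ ℝ i j)).contDiff

theorem contDiff_minorTwo : ContDiff ℝ ∞ minorTwo :=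
  ((contDiff_entry 0 0).mul (contDiff_entry 1 1)).sub ((contDiff_entry 0 1).mul (contDiff_entry 1 0))

theorem contDiff_minorSide : ContDiff ℝ ∞ minorSide :=
  ((contDiff_entry 0 0).mul (contDiff_entry 2 1)).sub ((contDiff_entry 0 1).mul (contDiff_entry 2 0))

theorem contDiff_det_three : ContDiff ℝ ∞ fun M : Matrix (Fin 3) (Fin 3) ℝ => M.det := by
  simp only [Matrix.det_apply]
  refine ContDiff.sum fun σ _ => ContDiff.const_smul _ (contDiff_prod fun i _ => ?_)
  exact contDiff_entry (σ i) i

theorem isOpen_cell : IsOpen cell :=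
  isOpen_units_matrix.inter ((isOpen_ne_fun (contDiff_entry 0 0).continuous continuous_const).inter
    (isOpen_ne_fun contDiff_minorTwo.continuous continuous_const))

theorem contDiffOn_cellCoord : ContDiffOn ℝ ∞ cellCoord cell := by
  rw [contDiffOn_pi]
  intro i
  fin_cases i
  · exact ContDiffOn.div (contDiff_entry 1 0).contDiffOn (contDiff_entry 0 0).contDiffOn
      fun M hM => hM.2.1
  · exact ContDiffOn.div contDiff_minorSide.contDiffOn contDiff_minorTwo.contDiffOn
      fun M hM => hM.2.2
  · exact ContDiffOn.div (contDiff_entry 2 0).contDiffOn (contDiff_entry 0 0).contDiffOn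
      fun M hM => hM.2.1

theorem det_ne_zero_of_mem_cell {M : Matrix (Fin 3) (Fin 3) ℝ} (hM : M ∈ cell) : M.det ≠ 0 :=
  ((Matrix.isUnit_iff_isUnit_det _).1 hM.1).ne_zero

theorem contDiffOn_cellChar (ξ : Fin 3 → ZMod 2) (lam : Fin 3 → ℂ) :
    ContDiffOn ℝ ∞ (cellChar ξ lam) cell := by
  intro M hM
  have h0 := (contDiff_entry 0 0).contDiffAt (x := M)
  have h1 := contDiff_minorTwo.contDiffAt (x := M)
  have h2 := contDiff_det_three.contDiffAt (x := M)
  refine ContDiffAt.contDiffWithinAt (ContDiffAt.mul (ContDiffAt.mul ?_ ?_) ?_)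
  · exact (contDiffAt_signedPow _ _ hM.2.1).comp M h0
  · exact (contDiffAt_signedPow _ _ (div_ne_zero hM.2.2 hM.2.1)).comp M (h1.div h0 hM.2.1)
  · exact (contDiffAt_signedPow _ _ (div_ne_zero (det_ne_zero_of_mem_cell hM) hM.2.2)).comp M
      (h2.div h1 hM.2.2)

/-- The cell decomposition `g = n⁻ p`. -/
theorem eq_nbar_mul {g : GL (Fin 3) ℝ} (hg : (g : Matrix (Fin 3) (Fin 3) ℝ) ∈ cell)
    (ξ : Fin 3 → ZMod 2) (lam : Fin 3 → ℂ) :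
    ∃ p ∈ borelGL 3, g = nbar (cellCoord g) * p ∧ inducingChar ξ lam p = cellChar ξ lam g := by
  let M : Matrix (Fin 3) (Fin 3) ℝ := g
  have hM : M = (g : Matrix (Fin 3) (Fin 3) ℝ) := rfl
  have h0 : M 0 0 ≠ 0 := hg.2.1
  have h1 : M 0 0 * M 1 1 - M 0 1 * M 1 0 ≠ 0 := hg.2.2
  -- The upper factor from Gaussian elimination; its diagonal consists of ratios of successive
  -- leading minors, as in `cellChar`.
  let X : Matrix (Fin 3) (Fin 3) ℝ := !![M 0 0, M 0 1, M 0 2;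
    0, minorTwo M / M 0 0, M 1 2 - M 1 0 / M 0 0 * M 0 2;
    0, 0, M.det / minorTwo M]
  have hX : nbarMat (cellCoord M) * X = M := by
    ext i j
    fin_cases i <;> fin_cases j <;>
      simp [nbarMat, cellCoord, X, Matrix.mul_apply, Fin.sum_univ_three, minorTwo, minorSide,
        Matrix.det_fin_three] <;> field_simp <;> ring
  have hdet : X.det ≠ 0 := by
    have := congrArg Matrix.det hX
    rw [Matrix.det_mul, det_nbarMat, one_mul] at this
    rw [this]; exact det_ne_zero_of_mem_cell hg
  refine ⟨Matrix.GeneralLinearGroup.mkOfDetNeZero X hdet, ?_, ?_, ?_⟩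
  · change X.BlockTriangular id
    intro i j hij
    fin_cases i <;> fin_cases j <;> simp [X] at hij ⊢
  · exact Units.ext hX.symm
  · rw [inducingChar_three]
    rfl

theorem nbar_mem_cell (p : Fin 3 → ℝ) : nbarMat p ∈ cell :=
  ⟨(nbar p).isUnit, by simp [nbarMat], by simp [nbarMat, minorTwo]⟩

theorem cellCoord_nbar (p : Fin 3 → ℝ) : cellCoord (nbarMat p) = p := by
  ext i
  fin_cases i <;> simp [cellCoord, nbarMat, minorSide, minorTwo]

theorem cellChar_nbar (ξ : Fin 3 → ZMod 2) (lam : Fin 3 → ℂ) (p : Fin 3 → ℝ) :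
    cellChar ξ lam (nbarMat p) = 1 := by
  rw [cellChar, det_nbarMat]
  simp [minorTwo, nbarMat, signedPow_one]

section borel

variable {g p : GL (Fin 3) ℝ}

theorem entry_mul_borel (hp : p ∈ borelGL 3) (i : Fin 3) :
    ((g * p : GL (Fin 3) ℝ) : Matrix (Fin 3) (Fin 3) ℝ) i 0 =
      (g : Matrix (Fin 3) (Fin 3) ℝ) i 0 * (p : Matrix (Fin 3) (Fin 3) ℝ) 0 0 ∧
    ((g * p : GL (Fin 3) ℝ) : Matrix (Fin 3) (Fin 3) ℝ) i 1 =
      (g : Matrix (Fin 3) (Fin 3) ℝ) i 0 * (p : Matrix (Fin 3) (Fin 3) ℝ) 0 1 +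
      (g : Matrix (Fin 3) (Fin 3) ℝ) i 1 * (p : Matrix (Fin 3) (Fin 3) ℝ) 1 1 := by
  have hp' : (p : Matrix (Fin 3) (Fin 3) ℝ).BlockTriangular id := hp
  have h10 : (p : Matrix (Fin 3) (Fin 3) ℝ) 1 0 = 0 := hp' (by decide)
  have h20 : (p : Matrix (Fin 3) (Fin 3) ℝ) 2 0 = 0 := hp' (by decide)
  have h21 : (p : Matrix (Fin 3) (Fin 3) ℝ) 2 1 = 0 := hp' (by decide)
  simp [Matrix.mul_apply, Fin.sum_univ_three, h10, h20, h21]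

theorem diag_ne_zero_of_mem_borel (hp : p ∈ borelGL 3) (i : Fin 3) :
    (p : Matrix (Fin 3) (Fin 3) ℝ) i i ≠ 0 := by
  have : (p : Matrix (Fin 3) (Fin 3) ℝ).det ≠ 0 :=
    ((Matrix.isUnit_iff_isUnit_det _).1 p.isUnit).ne_zero
  rw [Matrix.det_of_isUpperTriangular hp] at this
  exact Finset.prod_ne_zero_iff.1 this i (Finset.mem_univ i)

theorem minorTwo_mul_borel (hp : p ∈ borelGL 3) :
    minorTwo ((g * p : GL (Fin 3) ℝ) : Matrix (Fin 3) (Fin 3) ℝ) = minorTwo g *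
      ((p : Matrix (Fin 3) (Fin 3) ℝ) 0 0 * (p : Matrix (Fin 3) (Fin 3) ℝ) 1 1) := by
  simp only [minorTwo, (entry_mul_borel hp _).1, (entry_mul_borel hp _).2]; ring

theorem minorSide_mul_borel (hp : p ∈ borelGL 3) :
    minorSide ((g * p : GL (Fin 3) ℝ) : Matrix (Fin 3) (Fin 3) ℝ) = minorSide g *
      ((p : Matrix (Fin 3) (Fin 3) ℝ) 0 0 * (p : Matrix (Fin 3) (Fin 3) ℝ) 1 1) := by
  simp only [minorSide, (entry_mul_borel hp _).1, (entry_mul_borel hp _).2]; ring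

theorem mul_borel_mem_cell_iff (hp : p ∈ borelGL 3) :
    ((g * p : GL (Fin 3) ℝ) : Matrix (Fin 3) (Fin 3) ℝ) ∈ cell ↔
      (g : Matrix (Fin 3) (Fin 3) ℝ) ∈ cell := by
  have h := diag_ne_zero_of_mem_borel hp
  simp only [cell, Set.mem_ofPred_eq, minorTwo_mul_borel hp, (entry_mul_borel hp 0).1,
    Units.isUnit, true_and]
  simp [h 0, h 1]

/-- Each coordinate is a quotient of two minors on the same initial columns, which `p` multiplies by
the same factor. -/
theorem cellCoord_mul_borel (hp : p ∈ borelGL 3) :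
    cellCoord ((g * p : GL (Fin 3) ℝ) : Matrix (Fin 3) (Fin 3) ℝ) = cellCoord g := by
  have h := diag_ne_zero_of_mem_borel hp
  simp only [cellCoord, minorTwo_mul_borel hp, minorSide_mul_borel hp, (entry_mul_borel hp _).1]
  rw [mul_div_mul_right _ _ (h 0), mul_div_mul_right _ _ (h 0),
    mul_div_mul_right _ _ (mul_ne_zero (h 0) (h 1))]

theorem cellChar_mul_borel (ξ : Fin 3 → ZMod 2) (lam : Fin 3 → ℂ) (hp : p ∈ borelGL 3) :
    cellChar ξ lam ((g * p : GL (Fin 3) ℝ) : Matrix (Fin 3) (Fin 3) ℝ) =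
      inducingChar ξ lam p * cellChar ξ lam g := by
  have h := diag_ne_zero_of_mem_borel hp
  have hdet : (p : Matrix (Fin 3) (Fin 3) ℝ).det = _ := Matrix.det_of_isUpperTriangular hp
  rw [Fin.prod_univ_three] at hdet
  have e₁ : ∀ m c a b : ℝ, a ≠ 0 → m * (a * b) / (c * a) = m / c * b := fun m c a b ha => by
    rw [mul_comm a b, ← mul_assoc, mul_div_mul_right _ _ ha, mul_div_right_comm]
  simp only [cellChar, inducingChar_three, minorTwo_mul_borel hp, (entry_mul_borel hp 0).1]
  rw [Units.val_mul, Matrix.det_mul, hdet, e₁ _ _ _ _ (h 0),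
    e₁ _ _ _ _ (mul_ne_zero (h 0) (h 1))]
  simp only [signedPow_mul]
  ring

end borel

end chart

/-! ### Global sections from functions on the chart, with seminorm bounds. -/

section lift

/-- A smooth cutoff function around the origin. -/
def cutoff : ContDiffBump (0 : Fin 3 → ℝ) where
  rIn := 1 / 2
  rOut := 1
  rIn_pos := by norm_num
  rIn_lt_rOut := by norm_num

theorem cutoff_eq_one {p : Fin 3 → ℝ} (hp : ‖p‖ < 1 / 2) : cutoff p = 1 :=
  cutoff.one_of_mem_closedBall (by simpa [cutoff] using hp.le)

theorem cutoff_eq_zero {p : Fin 3 → ℝ} (hp : 1 ≤ ‖p‖) : cutoff p = 0 :=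
  cutoff.zero_of_le_dist (by simpa [cutoff] using hp)

theorem contDiff_cutoff : ContDiff ℝ ∞ fun p => ((cutoff p : ℝ) : ℂ) :=
  Complex.ofRealCLM.contDiff.comp cutoff.contDiff

open Classical in
/-- The extension by zero of the section `cutoff * Φ` over the open cell. -/
def liftFun (ξ : Fin 3 → ZMod 2) (lam : Fin 3 → ℂ) (Φ : (Fin 3 → ℝ) → ℂ)
    (M : Matrix (Fin 3) (Fin 3) ℝ) : ℂ :=
  if M ∈ cell then cellChar ξ lam M * (cutoff (cellCoord M) : ℝ) * Φ (cellCoord M) else 0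

/-- The closed set of matrices whose coordinates in the open cell are bounded by one. -/
def cellBox : Set (Matrix (Fin 3) (Fin 3) ℝ) :=
  {M | |M 1 0| ≤ |M 0 0| ∧ |M 2 0| ≤ |M 0 0| ∧ |minorSide M| ≤ |minorTwo M|}

theorem isClosed_cellBox : IsClosed cellBox := by
  have h0 := (contDiff_entry 0 0).continuous.abs
  refine (isClosed_le (contDiff_entry 1 0).continuous.abs h0).inter
    ((isClosed_le (contDiff_entry 2 0).continuous.abs h0).inter
    (isClosed_le contDiff_minorSide.continuous.abs contDiff_minorTwo.continuous.abs))

/-- On the box a vanishing `M 0 0` kills the whole first column, and a vanishing `minorTwo` makes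
the second column proportional to the first. Hence the box is closed and its invertible elements
avoid the boundary of the cell, so extension by zero is smooth. -/
theorem mem_cell_of_mem_cellBox {M : Matrix (Fin 3) (Fin 3) ℝ} (hu : IsUnit M)
    (hM : M ∈ cellBox) : M ∈ cell := by
  have hdet : M.det ≠ 0 := ((Matrix.isUnit_iff_isUnit_det _).1 hu).ne_zero
  obtain ⟨h1, h2, h3⟩ := hM
  have h00 : M 0 0 ≠ 0 := by
    intro h
    rw [h, abs_zero, abs_nonpos_iff] at h1 h2
    exact hdet (by rw [Matrix.det_fin_three, h, h1, h2]; ring)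
  refine ⟨hu, h00, fun h => ?_⟩
  rw [h, abs_zero, abs_nonpos_iff] at h3
  apply hdet
  have e1 : M 1 1 = M 0 1 * M 1 0 / M 0 0 := by
    rw [minorTwo] at h; field_simp; linear_combination h
  have e2 : M 2 1 = M 0 1 * M 2 0 / M 0 0 := by
    rw [minorSide] at h3; field_simp; linear_combination h3
  rw [Matrix.det_fin_three, e1, e2]
  field_simp
  ring

theorem norm_cellCoord_le {M : Matrix (Fin 3) (Fin 3) ℝ} (hM : M ∈ cellBox) :
    ‖cellCoord M‖ ≤ 1 := by
  obtain ⟨h1, h2, h3⟩ := hM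
  rw [pi_norm_le_iff_of_nonneg zero_le_one]
  intro i
  fin_cases i <;> simp only [cellCoord, Real.norm_eq_abs] <;> simp [abs_div] <;>
    refine div_le_one_of_le₀ ?_ (abs_nonneg _) <;> assumption

theorem liftFun_eq_zero (ξ : Fin 3 → ZMod 2) (lam : Fin 3 → ℂ) (Φ : (Fin 3 → ℝ) → ℂ)
    {M : Matrix (Fin 3) (Fin 3) ℝ} (hM : M ∉ cellBox) : liftFun ξ lam Φ M = 0 := by
  rw [liftFun]
  split_ifs with hc
  · rw [cutoff_eq_zero, Complex.ofReal_zero, mul_zero, zero_mul]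
    by_contra hlt
    have hlt := (pi_norm_lt_iff zero_lt_one).1 (not_le.1 hlt)
    have g0 := (hlt 0).le
    have g1 := (hlt 1).le
    have g2 := (hlt 2).le
    simp only [cellCoord, Real.norm_eq_abs] at g0 g1 g2
    simp [abs_div] at g0 g1 g2
    rw [div_le_one (abs_pos.2 hc.2.1)] at g0 g2
    rw [div_le_one (abs_pos.2 hc.2.2)] at g1
    exact hM ⟨g0, g2, g1⟩
  · rfl

theorem liftFun_eventuallyEq_cell (ξ : Fin 3 → ZMod 2) (lam : Fin 3 → ℂ) (Φ : (Fin 3 → ℝ) → ℂ)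
    {M : Matrix (Fin 3) (Fin 3) ℝ} (hM : M ∈ cell) : liftFun ξ lam Φ =ᶠ[nhds M] fun M =>
      cellChar ξ lam M * (cutoff (cellCoord M) : ℝ) * Φ (cellCoord M) := by
  filter_upwards [isOpen_cell.mem_nhds hM] with M' hM'
  rw [liftFun, if_pos hM']

theorem liftFun_eventuallyEq_zero (ξ : Fin 3 → ZMod 2) (lam : Fin 3 → ℂ) (Φ : (Fin 3 → ℝ) → ℂ)
    {M : Matrix (Fin 3) (Fin 3) ℝ} (hM : M ∉ cellBox) :
    liftFun ξ lam Φ =ᶠ[nhds M] fun _ => 0 := by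
  filter_upwards [isClosed_cellBox.isOpen_compl.mem_nhds hM] with M' hM'
  exact liftFun_eq_zero ξ lam Φ hM'

theorem contDiffOn_cellChar_mul_cutoff (ξ : Fin 3 → ZMod 2) (lam : Fin 3 → ℂ) :
    ContDiffOn ℝ ∞ (fun M => cellChar ξ lam M * ((cutoff (cellCoord M) : ℝ) : ℂ)) cell :=
  (contDiffOn_cellChar ξ lam).mul (contDiff_cutoff.comp_contDiffOn contDiffOn_cellCoord)

variable (ξ : Fin 3 → ZMod 2) (lam : Fin 3 → ℂ)

theorem liftFun_mem {Φ : (Fin 3 → ℝ) → ℂ} (hΦ : ContDiff ℝ ∞ Φ) :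
    (fun g : GL (Fin 3) ℝ => liftFun ξ lam Φ g) ∈ principalSeriesSubmodule 3 ξ lam := by
  refine ⟨smoothGL_of_contDiffOn (F := liftFun ξ lam Φ) ?_ fun _ => rfl, fun g p hp => ?_⟩
  · intro M hM
    refine ContDiffAt.contDiffWithinAt ?_
    by_cases hb : M ∈ cellBox
    · have hc := mem_cell_of_mem_cellBox hM hb
      refine ContDiffAt.congr_of_eventuallyEq ?_ (liftFun_eventuallyEq_cell ξ lam Φ hc)
      exact (((contDiffOn_cellChar_mul_cutoff ξ lam).mul
        (hΦ.comp_contDiffOn contDiffOn_cellCoord)).contDiffAt (isOpen_cell.mem_nhds hc))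
    · exact contDiffAt_const.congr_of_eventuallyEq (liftFun_eventuallyEq_zero ξ lam Φ hb)
  · simp only [liftFun, mul_borel_mem_cell_iff hp, cellCoord_mul_borel hp,
      cellChar_mul_borel ξ lam hp]
    by_cases hc : (g : Matrix (Fin 3) (Fin 3) ℝ) ∈ cell
    · rw [if_pos hc, if_pos ((mul_borel_mem_cell_iff hp).2 hc)]
      ring
    · rw [if_neg hc, if_neg fun h => hc ((mul_borel_mem_cell_iff hp).1 h), mul_zero]

/-- The element of the principal series with `Φ` as its restriction to `N⁻` near the origin. -/
def liftPS {Φ : (Fin 3 → ℝ) → ℂ} (hΦ : ContDiff ℝ ∞ Φ) : PrincipalSeries 3 ξ lam :=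
  ⟨_, liftFun_mem ξ lam hΦ⟩

theorem liftPS_apply {Φ : (Fin 3 → ℝ) → ℂ} (hΦ : ContDiff ℝ ∞ Φ) (g : GL (Fin 3) ℝ) :
    liftPS ξ lam hΦ g = liftFun ξ lam Φ g := rfl

theorem liftPS_nbar {Φ : (Fin 3 → ℝ) → ℂ} (hΦ : ContDiff ℝ ∞ Φ) {p : Fin 3 → ℝ}
    (hp : ‖p‖ < 1 / 2) : liftPS ξ lam hΦ (nbar p) = Φ p := by
  rw [liftPS_apply, liftFun, coe_nbar, if_pos (nbar_mem_cell p), cellCoord_nbar, cellChar_nbar,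
    cutoff_eq_one hp]
  simp

/-- `K` meets the box in a compact subset of the cell, where the constants from
`exists_bound_mul_comp` are bounded; elsewhere the lift vanishes locally. The constant `D` must not
depend on `Φ`, since `Φ` is rescaled later. -/
theorem exists_smoothSeminorm_liftPS_le (m : ℕ) (K : TopologicalSpace.Compacts (GL (Fin 3) ℝ)) :
    ∃ D : ℝ, 0 ≤ D ∧ ∀ (Φ : (Fin 3 → ℝ) → ℂ) (hΦ : ContDiff ℝ ∞ Φ) (B : ℝ),
      (∀ j ≤ m, ∀ p : Fin 3 → ℝ, ‖p‖ ≤ 1 → ‖iteratedFDeriv ℝ j Φ p‖ ≤ B) →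
        smoothSeminorm 3 ξ lam (m, K) (liftPS ξ lam hΦ) ≤ D * B := by
  obtain ⟨C, hC, hbd⟩ := exists_bound_mul_comp isOpen_cell
    (contDiffOn_cellChar_mul_cutoff ξ lam) contDiffOn_cellCoord m
  let S : Set (Matrix (Fin 3) (Fin 3) ℝ) := (Units.val '' (K : Set (GL (Fin 3) ℝ))) ∩ cellBox
  have hS : IsCompact S := (K.isCompact.image Units.continuous_val).inter_right isClosed_cellBox
  have hSc : S ⊆ cell := by
    rintro _ ⟨⟨g, _, rfl⟩, hb⟩
    exact mem_cell_of_mem_cellBox g.isUnit hb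
  obtain ⟨D, hD⟩ := hS.bddAbove_image (hC.mono hSc)
  refine ⟨max D 0, le_max_right _ _, fun Φ hΦ B hB => ?_⟩
  have hB0 : 0 ≤ B := (norm_nonneg _).trans (hB 0 (Nat.zero_le _) 0 (by simp))
  refine smoothSeminorm_le (mul_nonneg (le_max_right _ _) hB0) fun g hg => ?_
  have he : extendGL (liftPS ξ lam hΦ).toFun =ᶠ[nhds (g : Matrix (Fin 3) (Fin 3) ℝ)]
      liftFun ξ lam Φ :=
    extendGL_eventuallyEq (Filter.Eventually.of_forall fun _ => rfl)
  by_cases hb : (g : Matrix (Fin 3) (Fin 3) ℝ) ∈ cellBox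
  · have hc := mem_cell_of_mem_cellBox g.isUnit hb
    rw [((he.trans (liftFun_eventuallyEq_cell ξ lam Φ hc)).iteratedFDeriv ℝ m).eq_of_nhds]
    refine (hbd _ hc Φ hΦ.contDiffAt B fun j hj => hB j hj _ (norm_cellCoord_le hb)).trans ?_
    exact mul_le_mul_of_nonneg_right ((hD ⟨_, ⟨⟨g, hg, rfl⟩, hb⟩, rfl⟩).trans (le_max_left _ _)) hB0
  · rw [((he.trans (liftFun_eventuallyEq_zero ξ lam Φ hb)).iteratedFDeriv ℝ m).eq_of_nhds]
    have h0 : (fun _ : Matrix (Fin 3) (Fin 3) ℝ => (0 : ℂ)) = 0 := rfl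
    rw [h0, iteratedFDeriv_zero, Pi.zero_apply, norm_zero]
    exact mul_nonneg (le_max_right _ _) hB0

theorem exists_norm_apply_liftPS_le (u : PrincipalSeries 3 ξ lam →ₗ[ℂ] ℂ) (hu : Continuous u) :
    ∃ (m : ℕ) (D : ℝ), 0 ≤ D ∧ ∀ (Φ : (Fin 3 → ℝ) → ℂ) (hΦ : ContDiff ℝ ∞ Φ) (B : ℝ),
      (∀ j ≤ m, ∀ p : Fin 3 → ℝ, ‖p‖ ≤ 1 → ‖iteratedFDeriv ℝ j Φ p‖ ≤ B) →
        ‖u (liftPS ξ lam hΦ)‖ ≤ D * B := by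
  let q : Seminorm ℂ (PrincipalSeries 3 ξ lam) := (normSeminorm ℂ ℂ).comp u
  have hq : Continuous q := continuous_norm.comp hu
  obtain ⟨s, C, -, hC⟩ := Seminorm.bound_of_continuous PrincipalSeries.withSeminorms q hq
  choose D hD0 hD using exists_smoothSeminorm_liftPS_le ξ lam
  have hsum : 0 ≤ ∑ i ∈ s, D i.1 i.2 := Finset.sum_nonneg fun i _ => hD0 _ _
  refine ⟨s.sup Prod.fst, C * ∑ i ∈ s, D i.1 i.2, mul_nonneg C.2 hsum, ?_⟩
  intro Φ hΦ B hB
  have hB0 : 0 ≤ B := (norm_nonneg _).trans (hB 0 (Nat.zero_le _) 0 (by simp))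
  have h1 : ‖u (liftPS ξ lam hΦ)‖ ≤ C * s.sup (smoothSeminorm 3 ξ lam) (liftPS ξ lam hΦ) :=
    hC (liftPS ξ lam hΦ)
  refine h1.trans ?_
  rw [mul_assoc]
  refine mul_le_mul_of_nonneg_left ?_ C.2
  refine Seminorm.finset_sup_apply_le (mul_nonneg hsum hB0) fun i hi => ?_
  refine (hD i.1 i.2 Φ hΦ B fun j hj => hB j (hj.trans (Finset.le_sup (f := Prod.fst) hi))).trans ?_
  exact mul_le_mul_of_nonneg_right
    (Finset.single_le_sum (f := fun i => D i.1 i.2) (fun i _ => hD0 _ _) hi) hB0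

end lift

/-- The properties of the functional on germs of smooth functions on `N⁻` that a
`p₂`-differential symmetry breaking operator defines by evaluation at the identity. -/
structure IsJetFunctional (n₁ n₂ : ℕ) (μ : ℂ) (v : ((Fin 3 → ℝ) → ℂ) → ℂ) : Prop where
  add : ∀ {Φ Ψ : (Fin 3 → ℝ) → ℂ}, ContDiff ℝ ∞ Φ → ContDiff ℝ ∞ Ψ → v (Φ + Ψ) = v Φ + v Ψ
  smul : ∀ (c : ℂ) {Φ : (Fin 3 → ℝ) → ℂ}, ContDiff ℝ ∞ Φ → v (c • Φ) = c * v Φ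
  congr : ∀ {Φ Ψ : (Fin 3 → ℝ) → ℂ}, ContDiff ℝ ∞ Φ → ContDiff ℝ ∞ Ψ → Φ =ᶠ[nhds 0] Ψ → v Φ = v Ψ
  bound : ∃ (m : ℕ) (D : ℝ), 0 ≤ D ∧ ∀ Φ : (Fin 3 → ℝ) → ℂ, ContDiff ℝ ∞ Φ → ∀ B : ℝ,
    (∀ j ≤ m, ∀ p : Fin 3 → ℝ, ‖p‖ ≤ 1 → ‖iteratedFDeriv ℝ j Φ p‖ ≤ B) → ‖v Φ‖ ≤ D * B
  dilation : ∀ {Φ : (Fin 3 → ℝ) → ℂ}, ContDiff ℝ ∞ Φ → ∀ {a d : ℝ}, 0 < a → 0 < d →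
    (d : ℂ) ^ n₁ * v (fun p => Φ ![a / d * p 0, d * p 1, a * p 2]) =
      (a : ℂ) ^ n₁ * (d : ℂ) ^ n₂ * v Φ
  unipotent : ∀ {Φ Ψ : (Fin 3 → ℝ) → ℂ}, ContDiff ℝ ∞ Φ → ContDiff ℝ ∞ Ψ →
    (Ψ =ᶠ[nhds 0] fun p => Complex.exp (-μ * Real.log (1 - p 0)) *
      Φ ![p 0 / (1 - p 0), (1 - p 0) * p 1 + p 2, p 2 / (1 - p 0)]) → v Ψ = v Φ

/-! ### From a symmetry breaking operator to its functional at the identity. -/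

section breaking

variable {ξ : Fin 3 → ZMod 2} {lam : Fin 3 → ℂ} {η : Fin 2 → ZMod 2} {nu : Fin 2 → ℂ}
  {T : PrincipalSeries 3 ξ lam →L[ℂ] PrincipalSeries 2 η nu}

theorem PrincipalSeries.one_notMem_sectionSupport {n : ℕ} {ξ : Fin n → ZMod 2} {lam : Fin n → ℂ}
    {f : PrincipalSeries n ξ lam} (hf : ∀ᶠ g in nhds (1 : GL (Fin n) ℝ), f g = 0) :
    ((1 : GL (Fin n) ℝ) : GL (Fin n) ℝ ⧸ borelGL n) ∉ sectionSupport f := by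
  intro h
  rw [sectionSupport, mem_closure_iff_nhds] at h
  obtain ⟨_, ⟨g, hg, rfl⟩, g', hg', he⟩ := h _ (QuotientGroup.isOpenMap_coe.image_mem_nhds hf)
  refine hg' ?_
  have hp : g⁻¹ * g' ∈ borelGL n := QuotientGroup.eq.1 he.symm
  have := f.equivariant g hp
  rw [mul_inv_cancel_left] at this
  rw [this, show f g = 0 from hg, mul_zero]

theorem DSBO₂.apply_one_eq_zero (hT : T ∈ DSBO₂ ξ lam η nu) {f : PrincipalSeries 3 ξ lam}
    (hf : ∀ᶠ g in nhds (1 : GL (Fin 3) ℝ), f g = 0) : T f 1 = 0 := by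
  by_contra h
  refine PrincipalSeries.one_notMem_sectionSupport hf (hT.2 f ?_)
  refine ⟨((1 : GL (Fin 2) ℝ) : GL (Fin 2) ℝ ⧸ borelGL 2), subset_closure ⟨1, h, rfl⟩, ?_⟩
  change ((embedGL 1 : GL (Fin 3) ℝ) : GL (Fin 3) ℝ ⧸ borelGL 3) = _
  rw [map_one]

theorem cellCoord_one : cellCoord (1 : Matrix (Fin 3) (Fin 3) ℝ) = 0 := by
  rw [← Units.val_one, ← nbar_zero, coe_nbar, cellCoord_nbar]

theorem one_mem_cell : (1 : Matrix (Fin 3) (Fin 3) ℝ) ∈ cell := by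
  rw [← Units.val_one, ← nbar_zero, coe_nbar]
  exact nbar_mem_cell 0

theorem tendsto_cellCoord_one :
    Filter.Tendsto (fun g : GL (Fin 3) ℝ => cellCoord g) (nhds 1) (nhds 0) := by
  have h : ContinuousAt cellCoord ((1 : GL (Fin 3) ℝ) : Matrix (Fin 3) (Fin 3) ℝ) :=
    contDiffOn_cellCoord.continuousOn.continuousAt (isOpen_cell.mem_nhds one_mem_cell)
  have h2 := (h.comp (f := (Units.val : GL (Fin 3) ℝ → Matrix (Fin 3) (Fin 3) ℝ))
    Units.continuous_val.continuousAt).tendsto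
  rwa [Function.comp_apply, Units.val_one, cellCoord_one] at h2

/-- Near `1` every `g` factors as `n⁻ p`, and equivariance under `p` carries equality from the chart
to the group. -/
theorem PrincipalSeries.eventuallyEq_of_nbar {f₁ f₂ : PrincipalSeries 3 ξ lam}
    (h : ∀ᶠ p in nhds (0 : Fin 3 → ℝ), f₁ (nbar p) = f₂ (nbar p)) :
    ∀ᶠ g in nhds (1 : GL (Fin 3) ℝ), f₁ g = f₂ g := by
  have hc : ∀ᶠ g : GL (Fin 3) ℝ in nhds 1, (g : Matrix (Fin 3) (Fin 3) ℝ) ∈ cell :=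
    Units.continuous_val.continuousAt.eventually_mem (isOpen_cell.mem_nhds one_mem_cell)
  filter_upwards [tendsto_cellCoord_one.eventually h, hc] with g hg hgc
  obtain ⟨p, hp, hgp, -⟩ := eq_nbar_mul hgc ξ lam
  rw [hgp, f₁.equivariant _ hp, f₂.equivariant _ hp, hg]

theorem DSBO₂.apply_one_congr (hT : T ∈ DSBO₂ ξ lam η nu) {f₁ f₂ : PrincipalSeries 3 ξ lam}
    (h : ∀ᶠ p in nhds (0 : Fin 3 → ℝ), f₁ (nbar p) = f₂ (nbar p)) : T f₁ 1 = T f₂ 1 := by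
  have h0 : T (f₁ - f₂) 1 = 0 := by
    refine DSBO₂.apply_one_eq_zero hT ?_
    filter_upwards [PrincipalSeries.eventuallyEq_of_nbar h] with g hg
    exact sub_eq_zero.2 hg
  rw [map_sub] at h0
  exact sub_eq_zero.1 h0

theorem liftPS_nbar_eventually (ξ : Fin 3 → ZMod 2) (lam : Fin 3 → ℂ) {Φ : (Fin 3 → ℝ) → ℂ}
    (hΦ : ContDiff ℝ ∞ Φ) : ∀ᶠ p in nhds (0 : Fin 3 → ℝ), liftPS ξ lam hΦ (nbar p) = Φ p := by
  filter_upwards [Metric.ball_mem_nhds (0 : Fin 3 → ℝ) (show (0 : ℝ) < 1 / 2 by norm_num)] with p hp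
  exact liftPS_nbar ξ lam hΦ (by simpa using hp)

theorem DSBO₂.apply_leftTranslate (hT : T ∈ DSBO₂ ξ lam η nu) (h : GL (Fin 2) ℝ)
    (f : PrincipalSeries 3 ξ lam) : T (leftRegular 3 ξ lam (embedGL h⁻¹) f) 1 = T f h := by
  rw [hT.1]
  change T f (h⁻¹⁻¹ * 1) = T f h
  rw [inv_inv, mul_one]

open Classical in
/-- The functional `Φ ↦ (T f)(1)`, for `f` a section with restriction `Φ` to `N⁻` near the
origin. -/
def jetFunctional (T : PrincipalSeries 3 ξ lam →L[ℂ] PrincipalSeries 2 η nu)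
    (Φ : (Fin 3 → ℝ) → ℂ) : ℂ :=
  if hΦ : ContDiff ℝ ∞ Φ then T (liftPS ξ lam hΦ) 1 else 0

theorem jetFunctional_apply {Φ : (Fin 3 → ℝ) → ℂ} (hΦ : ContDiff ℝ ∞ Φ) :
    jetFunctional T Φ = T (liftPS ξ lam hΦ) 1 := dif_pos hΦ

/-- By the support condition any section with the right germ computes the functional, so the cutoff
and the choice of lift play no role. -/
theorem jetFunctional_eq (hT : T ∈ DSBO₂ ξ lam η nu) {Φ : (Fin 3 → ℝ) → ℂ} (hΦ : ContDiff ℝ ∞ Φ)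
    {f : PrincipalSeries 3 ξ lam} (hf : ∀ᶠ p in nhds (0 : Fin 3 → ℝ), f (nbar p) = Φ p) :
    jetFunctional T Φ = T f 1 := by
  rw [jetFunctional_apply hΦ]
  refine DSBO₂.apply_one_congr hT ?_
  filter_upwards [hf, liftPS_nbar_eventually ξ lam hΦ] with p h₁ h₂
  rw [h₁, h₂]

theorem jetFunctional_smul (hT : T ∈ DSBO₂ ξ lam η nu) (c : ℂ) {Φ : (Fin 3 → ℝ) → ℂ}
    (hΦ : ContDiff ℝ ∞ Φ) : jetFunctional T (c • Φ) = c * jetFunctional T Φ := by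
  rw [jetFunctional_apply hΦ]
  refine (jetFunctional_eq (f := c • liftPS ξ lam hΦ) hT (hΦ.const_smul c) ?_).trans ?_
  · filter_upwards [liftPS_nbar_eventually ξ lam hΦ] with p h₁
    exact congrArg (c * ·) h₁
  · rw [map_smul]; rfl

/-- An operator is determined by its functional. -/
theorem DSBO₂.eq_zero_of_jetFunctional (hT : T ∈ DSBO₂ ξ lam η nu)
    (h : ∀ Φ : (Fin 3 → ℝ) → ℂ, ContDiff ℝ ∞ Φ → jetFunctional T Φ = 0) : T = 0 := by
  refine ContinuousLinearMap.ext fun f => PrincipalSeries.ext fun g => ?_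
  rw [← DSBO₂.apply_leftTranslate hT g f]
  rw [← jetFunctional_eq hT (PrincipalSeries.smooth _).comp_nbar
    (Filter.Eventually.of_forall fun _ => rfl), h _ (PrincipalSeries.smooth _).comp_nbar]
  rfl

/-- The action of upper triangular matrices on the functional. -/
theorem jetFunctional_borel (hT : T ∈ DSBO₂ ξ lam η nu) {Φ Ψ : (Fin 3 → ℝ) → ℂ}
    (hΦ : ContDiff ℝ ∞ Φ) (hΨ : ContDiff ℝ ∞ Ψ) {q : GL (Fin 2) ℝ} (hq : q ∈ borelGL 2)
    (h : Ψ =ᶠ[nhds 0] fun p => cellChar ξ lam (embedMatrix q * nbarMat p) *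
      Φ (cellCoord (embedMatrix q * nbarMat p))) :
    jetFunctional T Ψ = inducingChar η nu q * jetFunctional T Φ := by
  have hq3 := embedGL_mem_borel hq
  have hmem : (embedMatrix q : Matrix (Fin 3) (Fin 3) ℝ) ∈ cell := by
    have := (mul_borel_mem_cell_iff (g := 1) hq3).2 one_mem_cell
    rwa [one_mul] at this
  have hc0 : cellCoord (embedMatrix q) = 0 := by
    have := cellCoord_mul_borel (g := 1) hq3
    rw [one_mul] at this
    exact this.trans cellCoord_one
  have hn0 : nbarMat 0 = 1 := by rw [← coe_nbar, nbar_zero, Units.val_one]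
  have hcont : Filter.Tendsto (fun p : Fin 3 → ℝ => (embedMatrix q : Matrix (Fin 3) (Fin 3) ℝ) *
      nbarMat p) (nhds 0) (nhds (embedMatrix q)) := by
    have : Continuous fun p : Fin 3 → ℝ => (embedMatrix q : Matrix (Fin 3) (Fin 3) ℝ) * nbarMat p :=
      continuous_const.matrix_mul contDiff_nbarMat.continuous
    have h2 := this.tendsto 0
    rwa [hn0, mul_one] at h2
  have hcoord : Filter.Tendsto cellCoord (nhds (embedMatrix q)) (nhds 0) := by
    have := contDiffOn_cellCoord.continuousOn.continuousAt (isOpen_cell.mem_nhds hmem)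
    rw [ContinuousAt, hc0] at this
    exact this
  -- `T f` at `q` is computed in two ways: by intertwining, as the value at `1` for a translated
  -- section, and by right equivariance, as a character times the value at `1`.
  have key : T (leftRegular 3 ξ lam (embedGL q⁻¹) (liftPS ξ lam hΦ)) 1 =
      inducingChar η nu q * jetFunctional T Φ := by
    rw [DSBO₂.apply_leftTranslate hT, jetFunctional_apply hΦ]
    have := (T (liftPS ξ lam hΦ)).equivariant 1 hq
    rwa [one_mul] at this
  rw [← key]
  refine jetFunctional_eq hT hΨ ?_
  have hball : ∀ᶠ p in nhds (0 : Fin 3 → ℝ), ‖p‖ < 1 / 2 := by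
    filter_upwards [Metric.ball_mem_nhds (0 : Fin 3 → ℝ) (show (0 : ℝ) < 1 / 2 by norm_num)]
      with p hp
    simpa using hp
  filter_upwards [h, (hcoord.comp hcont).eventually hball,
    hcont.eventually (isOpen_cell.mem_nhds hmem)] with p h₁ h₂ h₃
  rw [h₁]
  change liftFun ξ lam Φ (((embedGL q⁻¹)⁻¹ * nbar p : GL (Fin 3) ℝ) : Matrix (Fin 3) (Fin 3) ℝ) = _
  have he : (((embedGL q⁻¹)⁻¹ * nbar p : GL (Fin 3) ℝ) : Matrix (Fin 3) (Fin 3) ℝ) =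
      embedMatrix q * nbarMat p := by
    rw [map_inv, inv_inv]; rfl
  rw [he, liftFun, if_pos (show _ ∈ cell from h₃), cutoff_eq_one (show ‖cellCoord _‖ < 1 / 2 from h₂), Complex.ofReal_one, mul_one]

theorem continuous_apply_one : Continuous fun f : PrincipalSeries 2 η nu => f 1 := by
  let K : TopologicalSpace.Compacts (GL (Fin 2) ℝ) := ⟨{1}, isCompact_singleton⟩
  let l : PrincipalSeries 2 η nu →ₗ[ℂ] ℂ :=
    { toFun := fun f => f 1, map_add' := fun _ _ => rfl, map_smul' := fun _ _ => rfl }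
  have := WithSeminorms.continuous_normedSpace_rng ℂ (PrincipalSeries.withSeminorms (n := 2)) l
    ⟨{(0, K)}, 1, fun f => ?_⟩
  · exact this
  · have h := norm_iteratedFDeriv_le_smoothSeminorm (m := 0) (K := K) f (g := 1) rfl
    rw [norm_iteratedFDeriv_zero, extendGL_coe] at h
    rw [Finset.sup_singleton, one_smul]
    exact h

theorem inducingChar_two (η : Fin 2 → ZMod 2) (nu : Fin 2 → ℂ) (q : GL (Fin 2) ℝ) :
    inducingChar η nu q =
      signedPow (η 0) (-nu 0 - 1 / 2) ((q : Matrix (Fin 2) (Fin 2) ℝ) 0 0) *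
      signedPow (η 1) (-nu 1 + 1 / 2) ((q : Matrix (Fin 2) (Fin 2) ℝ) 1 1) := by
  rw [inducingChar, Fin.prod_univ_two]
  have e0 : -nu 0 - rhoGL 2 0 = -nu 0 - 1 / 2 := by simp [rhoGL]; ring
  have e1 : -nu 1 - rhoGL 2 1 = -nu 1 + 1 / 2 := by simp [rhoGL]; ring
  rw [e0, e1]

theorem exp_log_mul_natCast {a : ℝ} (ha : 0 < a) (n : ℕ) :
    Complex.exp (Real.log a * n) = (a : ℂ) ^ n := by
  rw [mul_comm, Complex.exp_nat_mul, ← Complex.ofReal_exp, Real.exp_log ha]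

theorem isJetFunctional_jetFunctional (hT : T ∈ DSBO₂ ξ lam η nu) {n₁ n₂ : ℕ}
    (hn₁ : nu 0 - lam 0 - 1 / 2 = (n₁ : ℂ))
    (hn₂ : nu 0 + nu 1 - lam 0 - lam 1 - 1 = (n₂ : ℂ)) :
    IsJetFunctional n₁ n₂ (lam 0 - lam 1 + 1) (jetFunctional T) where
  add {Φ Ψ} hΦ hΨ := by
    rw [jetFunctional_apply hΦ, jetFunctional_apply hΨ]
    refine (jetFunctional_eq (f := liftPS ξ lam hΦ + liftPS ξ lam hΨ) hT (hΦ.add hΨ) ?_).trans ?_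
    · filter_upwards [liftPS_nbar_eventually ξ lam hΦ, liftPS_nbar_eventually ξ lam hΨ]
        with p h₁ h₂
      exact congrArg₂ (· + ·) h₁ h₂
    · rw [map_add]; rfl
  smul c Φ hΦ := jetFunctional_smul hT c hΦ
  congr {Φ Ψ} hΦ hΨ h := by
    rw [jetFunctional_apply hΨ]
    refine jetFunctional_eq hT hΦ ?_
    filter_upwards [h, liftPS_nbar_eventually ξ lam hΨ] with p h₁ h₂
    rw [h₁, h₂]
  bound := by
    let u : PrincipalSeries 3 ξ lam →ₗ[ℂ] ℂ :=
      { toFun := fun f => T f 1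
        map_add' := fun f₁ f₂ => by rw [map_add]; rfl
        map_smul' := fun c f => by rw [map_smul]; rfl }
    obtain ⟨m, D, hD, h⟩ := exists_norm_apply_liftPS_le ξ lam u
      (continuous_apply_one.comp T.continuous)
    refine ⟨m, D, hD, fun Φ hΦ B hB => ?_⟩
    rw [jetFunctional_apply hΦ]
    exact h Φ hΦ B hB
  dilation {Φ} hΦ a d ha hd := by
    -- Inverses are taken so that the chart coordinates are multiplied by `a/d`, `d`, `a`.
    let q : GL (Fin 2) ℝ := Matrix.GeneralLinearGroup.mkOfDetNeZero !![a⁻¹, 0; 0, d⁻¹]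
      (by simp [Matrix.det_fin_two, ha.ne', hd.ne'])
    have hq : q ∈ borelGL 2 := by
      change (!![a⁻¹, 0; 0, d⁻¹] : Matrix (Fin 2) (Fin 2) ℝ).BlockTriangular id
      intro i j hij
      fin_cases i <;> fin_cases j <;> simp at hij ⊢
    have hM : ∀ p, embedMatrix q * nbarMat p = !![a⁻¹, 0, 0; d⁻¹ * p 0, d⁻¹, 0; p 2, p 1, 1] := by
      intro p
      change embedMatrix !![a⁻¹, 0; 0, d⁻¹] * nbarMat p = _
      ext i j
      fin_cases i <;> fin_cases j <;>
        simp [embedMatrix, nbarMat, Matrix.mul_apply, Fin.sum_univ_three]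
    have hcoord : ∀ p, cellCoord (embedMatrix q * nbarMat p) =
        ![a / d * p 0, d * p 1, a * p 2] := by
      intro p
      rw [hM]
      ext i
      fin_cases i <;> simp [cellCoord, minorSide, minorTwo] <;> field_simp
    have hai := inv_pos.2 ha
    have hdi := inv_pos.2 hd
    have hchar : ∀ p, cellChar ξ lam (embedMatrix q * nbarMat p) =
        Complex.exp (Real.log a⁻¹ * (-lam 0 - 1)) * Complex.exp (Real.log d⁻¹ * (-lam 1)) := by
      intro p
      rw [hM, cellChar]
      have e1 : minorTwo !![a⁻¹, 0, 0; d⁻¹ * p 0, d⁻¹, 0; p 2, p 1, 1] = a⁻¹ * d⁻¹ := by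
        simp [minorTwo]
      have e2 : (!![a⁻¹, 0, 0; d⁻¹ * p 0, d⁻¹, 0; p 2, p 1, 1] : Matrix _ _ ℝ).det =
          a⁻¹ * d⁻¹ := by
        simp [Matrix.det_fin_three]
      rw [e1, e2, div_self (mul_pos hai hdi).ne', signedPow_one, mul_one]
      change signedPow _ _ a⁻¹ * signedPow _ _ (a⁻¹ * d⁻¹ / a⁻¹) = _
      rw [mul_div_cancel_left₀ _ hai.ne', signedPow_of_pos _ _ hai, signedPow_of_pos _ _ hdi]
    have hlin : ContDiff ℝ ∞ fun p : Fin 3 → ℝ => ![a / d * p 0, d * p 1, a * p 2] := by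
      rw [contDiff_pi]
      intro i
      fin_cases i <;> exact contDiff_const.mul (contDiff_apply ℝ ℝ _)
    have hΨ : ContDiff ℝ ∞ fun p : Fin 3 → ℝ => Φ ![a / d * p 0, d * p 1, a * p 2] :=
      hΦ.comp hlin
    have key := jetFunctional_borel hT hΦ (hΨ.const_smul
      (Complex.exp (Real.log a⁻¹ * (-lam 0 - 1)) * Complex.exp (Real.log d⁻¹ * (-lam 1)))) hq
      (Filter.Eventually.of_forall fun p => by beta_reduce; rw [hcoord, hchar]; rfl)
    replace key := (jetFunctional_smul hT _ hΨ).symm.trans key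
    rw [inducingChar_two] at key
    change _ = signedPow _ _ a⁻¹ * signedPow _ _ d⁻¹ * _ at key
    rw [signedPow_of_pos _ _ hai, signedPow_of_pos _ _ hdi] at key
    -- The quotient of the two characters is `a^n₁ d^(n₂ - n₁)`; the factor `d^n₁` on the left
    -- avoids a possibly negative exponent.
    have hexp : (d : ℂ) ^ n₁ * (Complex.exp (Real.log a⁻¹ * (-nu 0 - 1 / 2)) *
        Complex.exp (Real.log d⁻¹ * (-nu 1 + 1 / 2))) = (a : ℂ) ^ n₁ * (d : ℂ) ^ n₂ *
        (Complex.exp (Real.log a⁻¹ * (-lam 0 - 1)) * Complex.exp (Real.log d⁻¹ * (-lam 1))) := by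
      simp only [← exp_log_mul_natCast ha, ← exp_log_mul_natCast hd, ← Complex.exp_add, Real.log_inv]
      congr 1
      push_cast
      linear_combination (Real.log a : ℂ) * hn₁ + (Real.log d : ℂ) * (hn₂ - hn₁)
    refine mul_left_cancel₀ (mul_ne_zero (Complex.exp_ne_zero (Real.log a⁻¹ * (-lam 0 - 1)))
      (Complex.exp_ne_zero (Real.log d⁻¹ * (-lam 1)))) ?_
    linear_combination (d : ℂ) ^ n₁ * key + jetFunctional T Φ * hexp
  unipotent {Φ Ψ} hΦ hΨ h := by
    -- A single unipotent element is enough: the dilations will separate the orders of its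
    -- expansion.
    let q : GL (Fin 2) ℝ := Matrix.GeneralLinearGroup.mkOfDetNeZero !![1, -1; 0, 1]
      (by simp [Matrix.det_fin_two])
    have hq : q ∈ borelGL 2 := by
      change (!![1, -1; 0, 1] : Matrix (Fin 2) (Fin 2) ℝ).BlockTriangular id
      intro i j hij
      fin_cases i <;> fin_cases j <;> simp at hij ⊢
    have hM : ∀ p, embedMatrix q * nbarMat p = !![1 - p 0, -1, 0; p 0, 1, 0; p 2, p 1, 1] := by
      intro p
      change embedMatrix !![1, -1; 0, 1] * nbarMat p = _
      ext i j
      fin_cases i <;> fin_cases j <;>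
        simp [embedMatrix, nbarMat, Matrix.mul_apply, Fin.sum_univ_three, sub_eq_add_neg]
    have hchi : inducingChar η nu q = 1 := by
      rw [inducingChar_two]
      change signedPow _ _ 1 * signedPow _ _ 1 = 1
      rw [signedPow_one, signedPow_one, one_mul]
    rw [← one_mul (jetFunctional T Φ), ← hchi]
    refine jetFunctional_borel hT hΦ hΨ hq (h.trans ?_)
    have hlt : ∀ᶠ p in nhds (0 : Fin 3 → ℝ), p 0 < 1 :=
      (continuous_apply 0).continuousAt.eventually_lt_const one_pos
    filter_upwards [hlt] with p hp
    have hp' : 0 < 1 - p 0 := sub_pos.2 hp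
    have e1 : minorTwo !![1 - p 0, -1, 0; p 0, 1, 0; p 2, p 1, 1] = 1 := by
      simp [minorTwo]
    have e2 : (!![1 - p 0, -1, 0; p 0, 1, 0; p 2, p 1, 1] : Matrix _ _ ℝ).det = 1 := by
      simp [Matrix.det_fin_three]
    have hcoord : cellCoord (embedMatrix q * nbarMat p) =
        ![p 0 / (1 - p 0), (1 - p 0) * p 1 + p 2, p 2 / (1 - p 0)] := by
      rw [hM, cellCoord, e1, div_one]
      simp [minorSide]
    rw [hcoord, hM, cellChar, e1, e2, div_one, signedPow_one, mul_one]
    change _ = signedPow _ _ (1 - p 0) * signedPow _ _ (1 / (1 - p 0)) * _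
    rw [signedPow_of_pos _ _ hp', signedPow_of_pos _ _ (one_div_pos.2 hp'), ← Complex.exp_add,
      one_div, Real.log_inv]
    congr 2
    push_cast
    ring

end breaking

/-! ### Expansion of `(1 - x)^{-c}` with globally smooth remainders. -/

section analytic

/-- The functional is controlled only on globally smooth functions, whereas `(1 - x)^{-c}` may be
singular at `x = 1`; a bump function keeps the germ at `0`. -/
theorem AnalyticAt.exists_contDiff_eventuallyEq {f : ℝ → ℂ} (hf : AnalyticAt ℝ f 0) :
    ∃ r : ℝ → ℂ, ContDiff ℝ ∞ r ∧ r =ᶠ[nhds 0] f := by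
  obtain ⟨ε, hε, h⟩ := Metric.eventually_nhds_iff_ball.1 hf.eventually_analyticAt
  let χ : ContDiffBump (0 : ℝ) := ⟨ε / 4, ε / 2, by positivity, by linarith⟩
  refine ⟨fun x => ((χ x : ℝ) : ℂ) * f x, ?_, ?_⟩
  · rw [contDiff_iff_contDiffAt]
    intro x
    by_cases hx : x ∈ Metric.ball (0 : ℝ) ε
    · exact ContDiffAt.mul (Complex.ofRealCLM.contDiff.comp χ.contDiff).contDiffAt (h x hx).contDiffAt
    · have hx' : x ∈ (Metric.closedBall (0 : ℝ) (ε / 2))ᶜ := by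
        simp only [Metric.mem_ball, not_lt, Set.mem_compl_iff, Metric.mem_closedBall, not_le]
          at hx ⊢
        linarith
      refine (contDiffAt_const (c := (0 : ℂ))).congr_of_eventuallyEq ?_
      filter_upwards [Metric.isClosed_closedBall.isOpen_compl.mem_nhds hx'] with y hy
      rw [χ.zero_of_le_dist, Complex.ofReal_zero, zero_mul]
      simpa using (not_le.1 fun hle => hy (Metric.mem_closedBall.2 hle)).le
  · filter_upwards [χ.eventuallyEq_one] with x hx
    rw [hx]; simp

theorem AnalyticAt.exists_smooth_remainder {f : ℝ → ℂ} (hf : AnalyticAt ℝ f 0) :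
    ∃ r : ℝ → ℂ, ContDiff ℝ ∞ r ∧ AnalyticAt ℝ r 0 ∧ r 0 = deriv f 0 ∧
      ∀ᶠ x in nhds (0 : ℝ), f x = f 0 + x * r x := by
  obtain ⟨p, hp⟩ := hf
  have hd : AnalyticAt ℝ (dslope f 0) 0 := ⟨_, hp.has_fpower_series_dslope_fslope⟩
  obtain ⟨r, hr, he⟩ := hd.exists_contDiff_eventuallyEq
  refine ⟨r, hr, hd.congr he.symm, by rw [he.eq_of_nhds, dslope_same], ?_⟩
  filter_upwards [he] with x hx
  have := sub_smul_dslope f 0 x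
  rw [sub_zero, Complex.real_smul] at this
  rw [hx, this]
  ring

theorem analyticAt_one_sub_power (c : ℂ) :
    AnalyticAt ℝ (fun x : ℝ => Complex.exp (-c * Real.log (1 - x))) 0 := by
  have h1 : AnalyticAt ℝ (fun x : ℝ => Real.log (1 - x)) 0 := by
    refine AnalyticAt.log (analyticAt_const.sub analyticAt_id) ?_
    simp
  have h2 : AnalyticAt ℝ (fun x : ℝ => ((Real.log (1 - x) : ℝ) : ℂ)) 0 :=
    (Complex.ofRealCLM.analyticAt _).comp h1
  exact (analyticAt_cexp.restrictScalars (𝕜 := ℝ)).comp (analyticAt_const.mul h2)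

theorem deriv_one_sub_power (c : ℂ) :
    deriv (fun x : ℝ => Complex.exp (-c * Real.log (1 - x))) 0 = c := by
  have h1 : HasDerivAt (fun x : ℝ => Real.log (1 - x)) (-1) 0 := by
    have h := ((hasDerivAt_id (0 : ℝ)).const_sub 1).log (by simp)
    simpa using h
  have h := ((h1.ofReal_comp).const_mul (-c)).cexp
  have h' := h.deriv
  simpa using h'

/-- The second order expansion of `(1 - x)^{-c}`, with a smooth remainder. -/
theorem exists_one_sub_power_expansion (c : ℂ) :
    ∃ r s : ℝ → ℂ, ContDiff ℝ ∞ r ∧ ContDiff ℝ ∞ s ∧ ∀ᶠ x in nhds (0 : ℝ),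
      Complex.exp (-c * Real.log (1 - x)) = 1 + x * s x ∧
      Complex.exp (-c * Real.log (1 - x)) = 1 + x * c + x ^ 2 * r x := by
  obtain ⟨s, hs, has, hs0, hse⟩ := (analyticAt_one_sub_power c).exists_smooth_remainder
  obtain ⟨r, hr, -, -, hre⟩ := has.exists_smooth_remainder
  refine ⟨r, s, hr, hs, ?_⟩
  filter_upwards [hse, hre] with x h₁ h₂
  rw [deriv_one_sub_power] at hs0
  have h0 : Complex.exp (-c * Real.log (1 - 0)) = 1 := by simp
  rw [h0] at h₁
  refine ⟨h₁, ?_⟩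
  rw [h₁, h₂, hs0]
  ring

end analytic

/-! ### The functional on monomials: finite order, weights and the recursion. -/

section weights

/-- The monomial `x^i y^j z^k`, with values in `ℂ`. -/
def monomialFun (i j k : ℕ) (p : Fin 3 → ℝ) : ℂ := (p 0 : ℂ) ^ i * (p 1 : ℂ) ^ j * (p 2 : ℂ) ^ k

theorem contDiff_coord (i : Fin 3) : ContDiff ℝ ∞ fun p : Fin 3 → ℝ => (p i : ℂ) :=
  Complex.ofRealCLM.contDiff.comp (contDiff_apply ℝ ℝ i)

theorem contDiff_monomialFun (i j k : ℕ) : ContDiff ℝ ∞ (monomialFun i j k) :=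
  (((contDiff_coord 0).pow i).mul ((contDiff_coord 1).pow j)).mul ((contDiff_coord 2).pow k)

/-- The linear map that multiplies the coordinates by `a`, `b`, `c`. -/
def diagScale (a b c : ℝ) : (Fin 3 → ℝ) →L[ℝ] (Fin 3 → ℝ) :=
  ContinuousLinearMap.pi fun i => (![a, b, c] i) • ContinuousLinearMap.proj i

theorem diagScale_apply (a b c : ℝ) (p : Fin 3 → ℝ) :
    diagScale a b c p = ![a * p 0, b * p 1, c * p 2] := by
  ext i
  fin_cases i <;> simp [diagScale]

theorem norm_diagScale_apply_le {a b c r : ℝ} (ha : |a| ≤ r) (hb : |b| ≤ r) (hc : |c| ≤ r)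
    (p : Fin 3 → ℝ) : ‖diagScale a b c p‖ ≤ r * ‖p‖ := by
  have hr : 0 ≤ r := (abs_nonneg a).trans ha
  rw [pi_norm_le_iff_of_nonneg (mul_nonneg hr (norm_nonneg p)), diagScale_apply]
  intro i
  fin_cases i
  · exact (norm_mul_le a _).trans (mul_le_mul ha (norm_le_pi_norm p 0) (norm_nonneg _) hr)
  · exact (norm_mul_le b _).trans (mul_le_mul hb (norm_le_pi_norm p 1) (norm_nonneg _) hr)
  · exact (norm_mul_le c _).trans (mul_le_mul hc (norm_le_pi_norm p 2) (norm_nonneg _) hr)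

theorem norm_diagScale_le {a b c r : ℝ} (ha : |a| ≤ r) (hb : |b| ≤ r) (hc : |c| ≤ r) :
    ‖diagScale a b c‖ ≤ r :=
  ContinuousLinearMap.opNorm_le_bound _ ((abs_nonneg a).trans ha)
    (norm_diagScale_apply_le ha hb hc)

theorem eq_zero_of_norm_mul_le {w : ℂ} {C : ℝ} (h : ∀ s : ℝ, 0 < s → s ≤ 1 → ‖w‖ ≤ C * s) :
    w = 0 := by
  have hC : 0 ≤ C := by simpa using (norm_nonneg w).trans (h 1 one_pos le_rfl)
  by_contra hw
  have hw := norm_pos_iff.2 hw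
  -- For this `s` one has `C * s < ‖w‖`, which contradicts the assumed bound.
  have hs : 0 < ‖w‖ / (‖w‖ + C + C) := by positivity
  have hs1 : ‖w‖ / (‖w‖ + C + C) ≤ 1 := by
    rw [div_le_one (by positivity)]; linarith
  have := h _ hs hs1
  rw [← mul_div_assoc, le_div_iff₀ (by positivity)] at this
  nlinarith [mul_nonneg hC hw.le, mul_pos hw hw]

namespace IsJetFunctional

variable {n₁ n₂ : ℕ} {μ : ℂ} {v : ((Fin 3 → ℝ) → ℂ) → ℂ}

theorem zero (hv : IsJetFunctional n₁ n₂ μ v) : v 0 = 0 := by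
  have h := hv.smul 0 (Φ := 0) contDiff_const
  rwa [zero_smul, zero_mul] at h

theorem sum (hv : IsJetFunctional n₁ n₂ μ v) {α : Type*} (s : Finset α)
    {Φ : α → (Fin 3 → ℝ) → ℂ} (hΦ : ∀ a, ContDiff ℝ ∞ (Φ a)) :
    v (∑ a ∈ s, Φ a) = ∑ a ∈ s, v (Φ a) := by
  classical
  induction s using Finset.induction_on with
  | empty => simpa using hv.zero
  | insert a s ha ih =>
    rw [Finset.sum_insert ha, Finset.sum_insert ha, hv.add (hΦ a), ih]
    have : (∑ a ∈ s, Φ a) = fun p => ∑ a ∈ s, Φ a p := by ext p; simp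
    rw [this]
    exact ContDiff.sum fun i _ => hΦ i

theorem dilation_diagScale (hv : IsJetFunctional n₁ n₂ μ v) {Φ : (Fin 3 → ℝ) → ℂ} (hΦ : ContDiff ℝ ∞ Φ)
    {a d : ℝ} (ha : 0 < a) (hd : 0 < d) :
    (d : ℂ) ^ n₁ * v (fun p => Φ (diagScale (a / d) d a p)) =
      (a : ℂ) ^ n₁ * (d : ℂ) ^ n₂ * v Φ := by
  simp only [diagScale_apply]
  exact hv.dilation hΦ ha hd

/-- The functional has finite order. -/
theorem exists_order (hv : IsJetFunctional n₁ n₂ μ v) :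
    ∃ N : ℕ, ∀ Φ : (Fin 3 → ℝ) → ℂ, ContDiff ℝ ∞ Φ →
      (∀ m ≤ N, iteratedFDeriv ℝ m Φ 0 = 0) → v Φ = 0 := by
  obtain ⟨m, D, hD, hb⟩ := hv.bound
  -- For `a = s²`, `d = s` the chart scales by `(s, s, s²)` and `v` by `s^(n₁ + n₂)`. Vanishing to
  -- this order makes the `C^m` size of the rescaled `Φ` at most a constant times `s^(m + n₁ + n₂ +
  -- 1)`, which leaves `‖v Φ‖ = O(s)`. Homogeneity thus replaces the structure theorem for
  -- distributions supported at a point.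
  refine ⟨m + n₁ + n₂, fun Φ hΦ h0 => ?_⟩
  obtain ⟨C, hC⟩ := exists_bound_of_iteratedFDeriv_eq_zero hΦ h0
  have hC0 : 0 ≤ C := by
    have := hC 0 (Nat.zero_le _) (fun _ => 1) (by simp [pi_norm_const])
    simpa [pi_norm_const] using (norm_nonneg _).trans this
  refine eq_zero_of_norm_mul_le (C := D * C) fun s hs hs1 => ?_
  have hdil := hv.dilation_diagScale hΦ (mul_pos hs hs) hs
  rw [mul_div_cancel_right₀ _ hs.ne'] at hdil
  have hss : s * s ≤ s := mul_le_of_le_one_left hs.le hs1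
  have hn : ‖diagScale s s (s * s)‖ ≤ s :=
    norm_diagScale_le (abs_of_pos hs).le (abs_of_pos hs).le
      (by rw [abs_of_pos (mul_pos hs hs)]; exact hss)
  have hest : ‖v fun p => Φ (diagScale s s (s * s) p)‖ ≤ D * (C * s ^ (m + n₁ + n₂ + 1)) := by
    refine hb _ (hΦ.comp (diagScale s s (s * s)).contDiff) _ fun j hj p hp => ?_
    have hnp : ‖diagScale s s (s * s) p‖ ≤ s := by
      refine ((diagScale s s (s * s)).le_opNorm p).trans ?_
      exact (mul_le_mul hn hp (norm_nonneg _) hs.le).trans (mul_one s).le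
    refine (norm_iteratedFDeriv_comp_clm_le hΦ _ j p).trans ?_
    calc _ ≤ (C * s ^ (m + n₁ + n₂ + 1 - j)) * s ^ j := by
          refine mul_le_mul ((hC j (by omega) _ (hnp.trans hs1)).trans ?_)
            (pow_le_pow_left₀ (norm_nonneg _) hn j) (by positivity) (by positivity)
          exact mul_le_mul_of_nonneg_left (pow_le_pow_left₀ (norm_nonneg _) hnp _) hC0
      _ = C * s ^ (m + n₁ + n₂ + 1) := by
          rw [mul_assoc, ← pow_add]; congr 2; omega
  have hsc : (s : ℂ) ≠ 0 := by exact_mod_cast hs.ne'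
  have heq : (v fun p => Φ (diagScale s s (s * s) p)) = (s : ℂ) ^ (n₁ + n₂) * v Φ := by
    refine mul_left_cancel₀ (pow_ne_zero n₁ hsc) ?_
    rw [hdil]; push_cast; ring
  rw [heq, norm_mul, norm_pow, Complex.norm_real, Real.norm_of_nonneg hs.le] at hest
  refine le_of_mul_le_mul_left (a := s ^ (n₁ + n₂)) ?_ (by positivity)
  refine hest.trans ?_
  have : s ^ (m + n₁ + n₂ + 1) ≤ s ^ (n₁ + n₂ + 1) :=
    pow_le_pow_of_le_one hs.le hs1 (by omega)
  calc D * (C * s ^ (m + n₁ + n₂ + 1)) ≤ D * (C * s ^ (n₁ + n₂ + 1)) := by gcongr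
    _ = s ^ (n₁ + n₂) * (D * C * s) := by ring

theorem monomialFun_scale (i j k : ℕ) (a b c : ℝ) (p : Fin 3 → ℝ) :
    monomialFun i j k (diagScale a b c p) =
      (a : ℂ) ^ i * (b : ℂ) ^ j * (c : ℂ) ^ k * monomialFun i j k p := by
  rw [diagScale_apply]
  simp [monomialFun]
  ring

theorem eq_of_two_pow_mul {m n : ℕ} {w : ℂ} (h : (2 : ℂ) ^ m * w = 2 ^ n * w) (hw : w ≠ 0) :
    m = n := by
  have h2 := mul_right_cancel₀ hw h
  have h3 : (2 : ℕ) ^ m = 2 ^ n := by exact_mod_cast h2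
  exact Nat.pow_right_injective le_rfl h3

/-- The weights of the monomials on which the functional does not vanish. -/
theorem weight_eq (hv : IsJetFunctional n₁ n₂ μ v) {i j k : ℕ} (h : v (monomialFun i j k) ≠ 0) :
    i + k = n₁ ∧ n₁ + j = n₂ + i := by
  have hs : ∀ c : ℂ, v (fun p => c * monomialFun i j k p) = c * v (monomialFun i j k) :=
    fun c => hv.smul c (contDiff_monomialFun i j k)
  -- The dilations `(a, d) = (2, 1)` and `(1, 2)` suffice, since powers of two determine their
  -- exponents.
  have h1 := hv.dilation_diagScale (contDiff_monomialFun i j k) two_pos one_pos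
  have h2 := hv.dilation_diagScale (contDiff_monomialFun i j k) one_pos two_pos
  simp only [monomialFun_scale, hs] at h1 h2
  constructor
  · refine eq_of_two_pow_mul (w := v (monomialFun i j k)) ?_ h
    push_cast at h1
    simp only [one_pow, one_mul, mul_one, div_one] at h1
    rw [← h1]; ring
  · refine eq_of_two_pow_mul (w := v (monomialFun i j k)) ?_ h
    push_cast at h2
    simp only [one_pow, one_mul, mul_one, div_pow] at h2
    field_simp at h2
    rw [pow_add, pow_add]
    linear_combination v (monomialFun i j k) * h2

/-- The dilation `a = s`, `d = 1` contracts `x` and `z` and fixes `y`. It gives `v` of the product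
as `s^(i+k-n₁)` times a quantity bounded for `0 < s ≤ 1`; let `s → 0`. Smooth remainders are
discarded in this way without expanding them further. -/
theorem eq_zero_of_weight_lt (hv : IsJetFunctional n₁ n₂ μ v) {i j k : ℕ} (hik : n₁ < i + k)
    {G : (Fin 3 → ℝ) → ℂ} (hG : ContDiff ℝ ∞ G) : v (fun p => monomialFun i j k p * G p) = 0 := by
  obtain ⟨m, D, hD, hb⟩ := hv.bound
  choose C hC hCb using fun l : ℕ => exists_bound_mul_comp isOpen_univ
    (contDiff_monomialFun i j k).contDiffOn (contDiff_id (E := Fin 3 → ℝ)).contDiffOn l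
  have hK : IsCompact (Metric.closedBall (0 : Fin 3 → ℝ) 1) := isCompact_closedBall _ _
  choose C' hC' using fun l : ℕ => hK.bddAbove_image ((hC l).mono (Set.subset_univ _))
  have hcG : ∀ l : ℕ, Continuous fun x => ‖iteratedFDeriv ℝ l G x‖ := fun l =>
    (hG.continuous_iteratedFDeriv (m := l) (by exact_mod_cast le_top)).norm
  choose M hM using fun l : ℕ => hK.bddAbove_image (hcG l).continuousOn
  let M' : ℝ := ∑ l ∈ Finset.range (m + 1), |M l|
  let C'' : ℝ := ∑ l ∈ Finset.range (m + 1), |C' l|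
  have hM0 : 0 ≤ M' := Finset.sum_nonneg fun _ _ => abs_nonneg _
  have hle : ∀ (f : ℕ → ℝ) (l : ℕ), l ≤ m → f l ≤ ∑ l ∈ Finset.range (m + 1), |f l| :=
    fun f l hl => (le_abs_self _).trans (Finset.single_le_sum (f := fun l => |f l|)
      (fun _ _ => abs_nonneg _) (Finset.mem_range.2 (by omega)))
  refine eq_zero_of_norm_mul_le (C := D * (C'' * M')) fun s hs hs1 => ?_
  have hΦ : ContDiff ℝ ∞ fun p => monomialFun i j k p * G p := (contDiff_monomialFun i j k).mul hG
  have hGs : ContDiff ℝ ∞ fun p => G (diagScale s 1 s p) := hG.comp (diagScale s 1 s).contDiff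
  have hdil := hv.dilation_diagScale hΦ hs one_pos
  simp only [monomialFun_scale, div_one, Complex.ofReal_one, one_pow, one_mul, mul_one] at hdil
  have hfun : (fun p => (s : ℂ) ^ i * (s : ℂ) ^ k * monomialFun i j k p * G (diagScale s 1 s p)) =
      ((s : ℂ) ^ i * (s : ℂ) ^ k) • fun p => monomialFun i j k p * G (diagScale s 1 s p) := by
    ext p; simp only [Pi.smul_apply, smul_eq_mul]; ring
  rw [hfun, hv.smul _ ((contDiff_monomialFun i j k).mul hGs)] at hdil
  have hn : ‖diagScale s 1 s‖ ≤ 1 := norm_diagScale_le (by rwa [abs_of_pos hs])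
    (by simp) (by rwa [abs_of_pos hs])
  have hest : ‖v fun p => monomialFun i j k p * G (diagScale s 1 s p)‖ ≤ D * (C'' * M') := by
    refine hb _ ((contDiff_monomialFun i j k).mul hGs) _ fun l hl p hp => ?_
    have hp' : p ∈ Metric.closedBall (0 : Fin 3 → ℝ) 1 := by simpa using hp
    refine (hCb l p (Set.mem_univ _) _ hGs.contDiffAt M' fun l' hl' => ?_).trans ?_
    · refine (norm_iteratedFDeriv_comp_clm_le hG _ l' p).trans ?_
      have hnp : ‖diagScale s 1 s p‖ ≤ 1 :=
        ((diagScale s 1 s).le_of_opNorm_le hn p).trans (by simpa using hp)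
      calc _ ≤ M' * 1 := mul_le_mul
            ((hM l' ⟨_, by simpa using hnp, rfl⟩).trans (hle M l' (hl'.trans hl)))
            (pow_le_one₀ (norm_nonneg _) hn) (by positivity) hM0
        _ = M' := mul_one _
    · exact mul_le_mul_of_nonneg_right ((hC' l ⟨p, hp', rfl⟩).trans (hle C' l hl)) hM0
  have hsc : (s : ℂ) ≠ 0 := by exact_mod_cast hs.ne'
  obtain ⟨e, he⟩ := Nat.exists_eq_add_of_lt hik
  have heq : v (fun p => monomialFun i j k p * G p) =
      (s : ℂ) ^ (e + 1) * v fun p => monomialFun i j k p * G (diagScale s 1 s p) := by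
    refine mul_left_cancel₀ (pow_ne_zero n₁ hsc) ?_
    rw [← hdil, ← pow_add, he]; ring
  rw [heq, norm_mul, norm_pow, Complex.norm_real, Real.norm_of_nonneg hs.le, mul_comm]
  refine mul_le_mul hest ?_ (by positivity) ((norm_nonneg _).trans hest)
  exact (pow_le_pow_of_le_one hs.le hs1 (Nat.le_add_left 1 e)).trans (pow_one s).le

theorem exists_add_pow_expansion (j : ℕ) :
    ∃ Q : (Fin 3 → ℝ) → ℂ, ContDiff ℝ ∞ Q ∧ ∀ p : Fin 3 → ℝ,
      ((1 - (p 0 : ℂ)) * p 1 + p 2) ^ (j + 1) = ((1 - (p 0 : ℂ)) * p 1) ^ (j + 1) +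
        (j + 1) * ((1 - (p 0 : ℂ)) * p 1) ^ j * p 2 + (p 2 : ℂ) ^ 2 * Q p := by
  have hw : ContDiff ℝ ∞ fun p : Fin 3 → ℝ => (1 - (p 0 : ℂ)) * p 1 :=
    (contDiff_const.sub (contDiff_coord 0)).mul (contDiff_coord 1)
  induction j with
  | zero => exact ⟨0, contDiff_const, fun p => by simp⟩
  | succ j ih =>
    obtain ⟨Q, hQ, h⟩ := ih
    refine ⟨fun p => (j + 1) * ((1 - (p 0 : ℂ)) * p 1) ^ j +
      ((1 - (p 0 : ℂ)) * p 1 + p 2) * Q p, ?_, fun p => ?_⟩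
    · exact (contDiff_const.mul (hw.pow j)).add ((hw.add (contDiff_coord 2)).mul hQ)
    · rw [pow_succ, h p]
      push_cast
      ring

/-- Apply unipotent invariance to `x^i y^(j+1) z^k`, of degree `n₁ - 1` in `(x, z)`. The transform
starts with the monomial itself, which cancels; its part of degree `n₁` is the asserted combination,
and all higher degrees are killed by `eq_zero_of_weight_lt`. -/
theorem recursion (hv : IsJetFunctional n₁ n₂ μ v) {i j k : ℕ} (hi : i + 1 + k = n₁) :
    (μ + i + k - (j + 1)) * v (monomialFun (i + 1) (j + 1) k) +
      (j + 1) * v (monomialFun i j (k + 1)) = 0 := by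
  obtain ⟨Q, hQ, hQe⟩ := exists_add_pow_expansion j
  -- The three exponents belong to the terms of `((1 - x) y + z)^(j+1)` of degree `0`, `1` and at
  -- least `2` in `z`, which carry `(1 - x)^(j+1)`, `(1 - x)^j` and no such factor.
  obtain ⟨r₀, s₀, hr₀, hs₀, h₀⟩ := exists_one_sub_power_expansion (μ + i + k - (j + 1))
  obtain ⟨r₁, s₁, hr₁, hs₁, h₁⟩ := exists_one_sub_power_expansion (μ + i + k - j)
  obtain ⟨r₂, s₂, hr₂, hs₂, h₂⟩ := exists_one_sub_power_expansion (μ + i + k)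
  have hx : ∀ {r : ℝ → ℂ}, ContDiff ℝ ∞ r → ContDiff ℝ ∞ fun p : Fin 3 → ℝ => r (p 0) :=
    fun hr => hr.comp (contDiff_apply ℝ ℝ 0)
  set A := monomialFun i (j + 1) k with hA
  set B := (μ + i + k - (j + 1)) • monomialFun (i + 1) (j + 1) k with hB
  set C := ((j : ℂ) + 1) • monomialFun i j (k + 1) with hC
  -- Each remainder is a monomial of degree `n₁ + 1` in `(x, z)` times a smooth function.
  let R₀ : (Fin 3 → ℝ) → ℂ := fun p => monomialFun (i + 2) (j + 1) k p * r₀ (p 0)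
  let R₁ : (Fin 3 → ℝ) → ℂ := fun p => monomialFun (i + 1) j (k + 1) p * ((j + 1) * s₁ (p 0))
  let R₂ : (Fin 3 → ℝ) → ℂ := fun p => monomialFun i 0 (k + 2) p * ((1 + p 0 * s₂ (p 0)) * Q p)
  have cA : ContDiff ℝ ∞ A := contDiff_monomialFun _ _ _
  have cB : ContDiff ℝ ∞ B := (contDiff_monomialFun _ _ _).const_smul (μ + i + k - (j + 1))
  have cC : ContDiff ℝ ∞ C := (contDiff_monomialFun _ _ _).const_smul ((j : ℂ) + 1)
  have g₁ : ContDiff ℝ ∞ fun p : Fin 3 → ℝ => ((j : ℂ) + 1) * s₁ (p 0) :=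
    contDiff_const.mul (hx hs₁)
  have g₂ : ContDiff ℝ ∞ fun p : Fin 3 → ℝ => (1 + p 0 * s₂ (p 0)) * Q p :=
    (contDiff_const.add ((contDiff_coord 0).mul (hx hs₂))).mul hQ
  have c₀ : ContDiff ℝ ∞ R₀ := (contDiff_monomialFun _ _ _).mul (hx hr₀)
  have c₁ : ContDiff ℝ ∞ R₁ := (contDiff_monomialFun _ _ _).mul g₁
  have c₂ : ContDiff ℝ ∞ R₂ := (contDiff_monomialFun _ _ _).mul g₂
  have d₀ : ContDiff ℝ ∞ (R₁ + R₂) := c₁.add c₂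
  have d₁ : ContDiff ℝ ∞ (R₀ + (R₁ + R₂)) := c₀.add d₀
  have d₂ : ContDiff ℝ ∞ (C + (R₀ + (R₁ + R₂))) := cC.add d₁
  have d₃ : ContDiff ℝ ∞ (B + (C + (R₀ + (R₁ + R₂)))) := cB.add d₂
  have key : v (A + (B + (C + (R₀ + (R₁ + R₂))))) = v A := by
    refine hv.unipotent cA (cA.add d₃) ?_
    have hlt : ∀ᶠ x in nhds (0 : ℝ), x < 1 := eventually_lt_nhds one_pos
    have ht : Filter.Tendsto (fun p : Fin 3 → ℝ => p 0) (nhds 0) (nhds 0) :=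
      (continuous_apply 0).tendsto _
    filter_upwards [ht.eventually h₀, ht.eventually h₁, ht.eventually h₂, ht.eventually hlt]
      with p ⟨_, e₀⟩ ⟨e₁, _⟩ ⟨e₂, _⟩ hp
    have hp' : 0 < 1 - p 0 := sub_pos.2 hp
    set w : ℂ := 1 - (p 0 : ℂ) with hw
    have hw0 : w ≠ 0 := by rw [hw]; exact_mod_cast hp'.ne'
    have hpow : ∀ l : ℕ, Complex.exp (Real.log (1 - p 0) * l) = w ^ l := fun l => by
      rw [exp_log_mul_natCast hp', hw]; push_cast; rfl
    have f₂ : Complex.exp (-μ * Real.log (1 - p 0)) = (1 + p 0 * s₂ (p 0)) * w ^ i * w ^ k := by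
      rw [← e₂, ← hpow, ← hpow, ← Complex.exp_add, ← Complex.exp_add]
      congr 1; ring
    have f₁ : (1 + p 0 * s₂ (p 0)) * w ^ j = 1 + p 0 * s₁ (p 0) := by
      rw [← e₂, ← e₁, ← hpow, ← Complex.exp_add]
      congr 1; ring
    have f₀ : (1 + p 0 * s₂ (p 0)) * w ^ (j + 1) =
        1 + p 0 * (μ + i + k - (j + 1)) + (p 0 : ℂ) ^ 2 * r₀ (p 0) := by
      rw [← e₂, ← e₀, ← hpow, ← Complex.exp_add]
      congr 1; push_cast; ring
    have hmon : A ![p 0 / (1 - p 0), (1 - p 0) * p 1 + p 2, p 2 / (1 - p 0)] =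
        ((p 0 : ℂ) / w) ^ i * (w * p 1 + p 2) ^ (j + 1) * (p 2 / w) ^ k := by
      simp [hA, monomialFun, hw]
    rw [hmon, f₂, hQe p]
    have hi' : w ^ i * ((p 0 : ℂ) / w) ^ i = (p 0 : ℂ) ^ i := by
      rw [← mul_pow, mul_div_cancel₀ _ hw0]
    have hk' : w ^ k * ((p 2 : ℂ) / w) ^ k = (p 2 : ℂ) ^ k := by
      rw [← mul_pow, mul_div_cancel₀ _ hw0]
    simp only [Pi.add_apply, Pi.smul_apply, smul_eq_mul, hA, hB, hC, R₀, R₁, R₂, monomialFun]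
    rw [← hw, mul_pow, mul_pow]
    generalize ((p 0 : ℂ) / w) ^ i = X at hi' ⊢
    generalize ((p 2 : ℂ) / w) ^ k = Z at hk' ⊢
    set S : ℂ := 1 + p 0 * s₂ (p 0) with hS
    set Y : ℂ := w ^ (j + 1) * (p 1 : ℂ) ^ (j + 1) +
      (j + 1) * (w ^ j * (p 1 : ℂ) ^ j) * p 2 + (p 2 : ℂ) ^ 2 * Q p with hY
    linear_combination -(S * w ^ k * Z * Y) * hi' - S * (p 0 : ℂ) ^ i * Y * hk' -
      (p 0 : ℂ) ^ i * (p 2 : ℂ) ^ k * (p 1 : ℂ) ^ (j + 1) * f₀ -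
      (j + 1) * (p 0 : ℂ) ^ i * (p 2 : ℂ) ^ (k + 1) * (p 1 : ℂ) ^ j * f₁ -
      S * (p 0 : ℂ) ^ i * (p 2 : ℂ) ^ k * hY
  have z₀ : v R₀ = 0 := hv.eq_zero_of_weight_lt (by omega) (hx hr₀)
  have z₁ : v R₁ = 0 := hv.eq_zero_of_weight_lt (by omega) g₁
  have z₂ : v R₂ = 0 := hv.eq_zero_of_weight_lt (by omega) g₂
  rw [hv.add cA d₃, hv.add cB d₂, hv.add cC d₁, hv.add c₀ d₀, hv.add c₁ c₂, z₀, z₁, z₂, hB, hC,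
    hv.smul _ (contDiff_monomialFun _ _ _), hv.smul _ (contDiff_monomialFun _ _ _)] at key
  linear_combination key

/-- The monomials of admissible weight form a chain indexed by `k`, starting at `x^n₁ y^n₂`. The
recursion climbs it whatever `μ` is, since it divides only by `j + 1`. -/
theorem monomialFun_eq_zero (hv : IsJetFunctional n₁ n₂ μ v) (h0 : v (monomialFun n₁ n₂ 0) = 0)
    (i j k : ℕ) : v (monomialFun i j k) = 0 := by
  have key : ∀ k i j : ℕ, i + k = n₁ → j + k = n₂ → v (monomialFun i j k) = 0 := by
    intro k
    induction k with
    | zero => rintro i j rfl rfl; exact h0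
    | succ k ih =>
      intro i j hi hj
      have h := hv.recursion (i := i) (j := j) (k := k) (by omega)
      rw [ih (i + 1) (j + 1) (by omega) (by omega), mul_zero, zero_add] at h
      exact (mul_eq_zero.1 h).resolve_left (by exact_mod_cast Nat.succ_ne_zero j)
  by_contra h
  obtain ⟨h₁, h₂⟩ := hv.weight_eq h
  exact h (key k i j h₁ (by omega))

theorem prod_coord_eq {m : ℕ} (r : Fin m → Fin 3) :
    ∃ i j k, (fun p : Fin 3 → ℝ => ∏ l, ((p (r l) : ℝ) : ℂ)) = monomialFun i j k := by
  refine ⟨Fintype.card {l // r l = 0}, Fintype.card {l // r l = 1}, Fintype.card {l // r l = 2},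
    funext fun p => ?_⟩
  rw [← Fintype.prod_fiberwise' r fun b => ((p b : ℝ) : ℂ), Fin.prod_univ_three]
  simp only [Finset.prod_const, Finset.card_univ]
  rfl

/-- Split `Φ` into a Taylor polynomial, killed monomial by monomial, and a remainder flat enough to
be killed by finite order. -/
theorem eq_zero (hv : IsJetFunctional n₁ n₂ μ v) (h0 : v (monomialFun n₁ n₂ 0) = 0)
    {Φ : (Fin 3 → ℝ) → ℂ} (hΦ : ContDiff ℝ ∞ Φ) : v Φ = 0 := by
  obtain ⟨N, hN⟩ := hv.exists_order
  obtain ⟨c, hc⟩ := exists_taylor_polynomial hΦ N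
  have hmon : ∀ {m : ℕ} (r : Fin m → Fin 3),
      ContDiff ℝ ∞ (fun p : Fin 3 → ℝ => ∏ l, ((p (r l) : ℝ) : ℂ)) := fun r => by
    obtain ⟨i, j, k, h⟩ := prod_coord_eq r
    rw [h]; exact contDiff_monomialFun i j k
  set P : (Fin 3 → ℝ) → ℂ := fun p => ∑ j, ∑ r, c j r * ∏ i, ((p (r i) : ℝ) : ℂ) with hP
  have hP' : P = ∑ j, ∑ r, c j r • fun p : Fin 3 → ℝ => ∏ i, ((p (r i) : ℝ) : ℂ) := by
    ext p; simp [hP]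
  have hPc : ContDiff ℝ ∞ P :=
    ContDiff.sum fun j _ => ContDiff.sum fun r _ => contDiff_const.mul (hmon r)
  have hvP : v P = 0 := by
    rw [hP', hv.sum]
    · refine Finset.sum_eq_zero fun j _ => ?_
      refine (hv.sum Finset.univ (Φ := fun r : Fin j → Fin 3 => c j r • fun p : Fin 3 → ℝ =>
        ∏ i, ((p (r i) : ℝ) : ℂ)) fun r => (hmon r).const_smul (c j r)).trans ?_
      refine Finset.sum_eq_zero fun r _ => ?_
      rw [hv.smul _ (hmon r)]
      obtain ⟨i, j', k, h⟩ := prod_coord_eq r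
      rw [h, hv.monomialFun_eq_zero h0, mul_zero]
    · intro j
      have : (∑ r, c j r • fun p : Fin 3 → ℝ => ∏ i, ((p (r i) : ℝ) : ℂ)) =
          fun p => ∑ r, c j r * ∏ i, ((p (r i) : ℝ) : ℂ) := by ext p; simp
      rw [this]
      exact ContDiff.sum fun r _ => contDiff_const.mul (hmon r)
  have h := hv.add (hΦ.sub hPc) hPc
  have e : (fun x => Φ x - P x) + P = Φ := by ext p; simp
  rw [e, hvP, add_zero] at h
  rw [h]
  exact hN _ (hΦ.sub hPc) hc

end IsJetFunctional

end weights

/-! ### The operator does not vanish on the monomial `x^n₁ y^n₂`. -/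

section nonvanishing

variable {f : GL (Fin 3) ℝ → ℂ}

/-- The chart is affine and `nbar p * X` is tangent to it, so the right derivative is the
directional derivative of the germ along `w p`. -/
theorem rightDeriv_nbar (hf : SmoothGL f) {F : (Fin 3 → ℝ) → ℂ}
    (h : (fun p => f (nbar p)) =ᶠ[nhds 0] F) {X : Matrix (Fin 3) (Fin 3) ℝ}
    {w : (Fin 3 → ℝ) → Fin 3 → ℝ}
    (hw : ∀ (p : Fin 3 → ℝ) (s : ℝ), nbarMat (p + s • w p) = nbarMat p + s • (nbarMat p * X))
    {F' : (Fin 3 → ℝ) → ℂ} (hF : ∀ p, HasDerivAt (fun s : ℝ => F (p + s • w p)) (F' p) 0) :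
    (fun p => rightDeriv X f (nbar p)) =ᶠ[nhds 0] F' := by
  filter_upwards [h.eventually_nhds] with p hp
  have h0 : p + (0 : ℝ) • w p = p := by rw [zero_smul, add_zero]
  have hcurve : HasDerivAt (fun s : ℝ => (nbar (p + s • w p) : Matrix (Fin 3) (Fin 3) ℝ))
      ((nbar (p + (0 : ℝ) • w p) : Matrix (Fin 3) (Fin 3) ℝ) * X) 0 := by
    simp only [coe_nbar, h0, hw]
    have := ((hasDerivAt_id (0 : ℝ)).smul_const (nbarMat p * X)).const_add (nbarMat p)
    rwa [one_smul] at this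
  have h1 := hasDerivAt_comp_curve hf hcurve
  rw [h0] at h1
  refine h1.unique ((hF p).congr_of_eventuallyEq ?_)
  have hc : Filter.Tendsto (fun s : ℝ => p + s • w p) (nhds 0) (nhds p) := by
    have : Continuous fun s : ℝ => p + s • w p := by fun_prop
    simpa [h0] using this.tendsto 0
  exact hc.eventually hp

theorem hasDerivAt_coord_pow (x t : ℝ) (n : ℕ) :
    HasDerivAt (fun s : ℝ => ((x + s * t : ℝ) : ℂ) ^ n) (n * (x : ℂ) ^ (n - 1) * t) 0 := by
  have h1 : HasDerivAt (fun s : ℝ => x + s * t) t 0 := by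
    simpa using ((hasDerivAt_id (0 : ℝ)).mul_const t).const_add x
  simpa using h1.ofReal_comp.fun_pow n

variable {C : ℂ} {i j : ℕ}

theorem epsGL_one_zero_nbar (hf : SmoothGL f)
    (h : (fun p => f (nbar p)) =ᶠ[nhds 0] fun p => C * monomialFun i j 0 p) :
    (fun p => epsGL 1 0 f (nbar p)) =ᶠ[nhds 0] fun p => C * i * monomialFun (i - 1) j 0 p := by
  -- In the chart `ε^{2,1} = ∂_x + y ∂_z`, and the function does not involve `z`.
  refine rightDeriv_nbar hf h (w := fun p => ![1, 0, p 1]) (fun p s => ?_) fun p => ?_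
  · ext k l
    rw [Matrix.add_apply, Matrix.smul_apply, Matrix.mul_apply, Fin.sum_univ_three]
    fin_cases k <;> fin_cases l <;> simp [nbarMat]
  · have := ((hasDerivAt_coord_pow (p 0) 1 i).mul_const ((p 1 : ℂ) ^ j)).const_mul C
    convert! this using 1
    · ext s; simp [monomialFun]
    · simp [monomialFun]; ring

theorem epsGL_two_one_nbar (hf : SmoothGL f)
    (h : (fun p => f (nbar p)) =ᶠ[nhds 0] fun p => C * monomialFun i j 0 p) :
    (fun p => epsGL 2 1 f (nbar p)) =ᶠ[nhds 0] fun p => C * j * monomialFun i (j - 1) 0 p := by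
  refine rightDeriv_nbar hf h (w := fun _ => ![0, 1, 0]) (fun p s => ?_) fun p => ?_
  · ext k l
    rw [Matrix.add_apply, Matrix.smul_apply, Matrix.mul_apply, Fin.sum_univ_three]
    fin_cases k <;> fin_cases l <;> simp [nbarMat]
  · have := ((hasDerivAt_coord_pow (p 1) 1 j).const_mul ((p 0 : ℂ) ^ i)).const_mul C
    convert! this using 1
    · ext s; simp [monomialFun]
    · simp [monomialFun]; ring

theorem epsGL_two_zero_nbar (hf : SmoothGL f)
    (h : (fun p => f (nbar p)) =ᶠ[nhds 0] fun p => C * monomialFun i j 0 p) :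
    (fun p => epsGL 2 0 f (nbar p)) =ᶠ[nhds 0] fun _ => 0 := by
  refine rightDeriv_nbar hf h (w := fun _ => ![0, 0, 1]) (fun p s => ?_) fun p => ?_
  · ext k l
    rw [Matrix.add_apply, Matrix.smul_apply, Matrix.mul_apply, Fin.sum_univ_three]
    fin_cases k <;> fin_cases l <;> simp [nbarMat]
  · convert! hasDerivAt_const (0 : ℝ) (C * monomialFun i j 0 p) using 1
    ext s; simp [monomialFun]

theorem Psi₃_nbar (p : Fin 3 → ℝ) : Psi₃ (nbar p) = 1 := by
  rw [Psi₃, coe_nbar, Matrix.det_fin_two]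
  simp [nbarMat]

theorem Psi₂_nbar (p : Fin 3 → ℝ) : Psi₂ (nbar p) = 0 := by
  rw [Psi₂, coe_nbar, Matrix.det_fin_two]
  simp [nbarMat]

theorem Psi₁_nbar (p : Fin 3 → ℝ) : Psi₁ (nbar p) = 0 := by
  rw [Psi₁, coe_nbar, Matrix.det_fin_two]
  simp [nbarMat]

theorem sourceF₂_nbar (lam : Fin 3 → ℂ) (hf : SmoothGL f)
    (h : (fun p => f (nbar p)) =ᶠ[nhds 0] fun p => C * monomialFun i j 0 p) :
    (fun p => sourceF₂ lam f (nbar p)) =ᶠ[nhds 0] fun p => C * j * monomialFun i (j - 1) 0 p := by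
  filter_upwards [epsGL_two_one_nbar hf h] with p hp
  rw [sourceF₂, Psi₃_nbar, Psi₂_nbar, hp]
  ring

/-- On `N⁻` one has `Ψ₃ = 1` and `Ψ₂ = Ψ₁ = 0`, and `ε^{3,1} = ∂_z` kills functions of `x, y`. What
remains is `∂_y ∂_x`, independent of `λ`. -/
theorem sourceF₁_nbar (lam : Fin 3 → ℂ) (hf : SmoothGL f)
    (h : (fun p => f (nbar p)) =ᶠ[nhds 0] fun p => C * monomialFun i j 0 p) :
    (fun p => sourceF₁ lam f (nbar p)) =ᶠ[nhds 0]
      fun p => C * i * j * monomialFun (i - 1) (j - 1) 0 p := by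
  filter_upwards [epsGL_two_one_nbar (hf.eps 1 0) (epsGL_one_zero_nbar hf h),
    epsGL_two_zero_nbar hf h] with p h₁ h₂
  rw [sourceF₁, Psi₃_nbar, Psi₂_nbar, Psi₁_nbar, h₁, h₂]
  ring

theorem exists_sourceF₂Pow_nbar (b : ℕ) : ∀ {lam : Fin 3 → ℂ} {f : GL (Fin 3) ℝ → ℂ} {C : ℂ},
    SmoothGL f → C ≠ 0 →
    ((fun p => f (nbar p)) =ᶠ[nhds 0] fun p => C * monomialFun i (j + b) 0 p) →
    ∃ C' : ℂ, C' ≠ 0 ∧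
      (fun p => sourceF₂Pow b lam f (nbar p)) =ᶠ[nhds 0] fun p => C' * monomialFun i j 0 p := by
  induction b with
  | zero => exact fun _ hC h => ⟨_, hC, h⟩
  | succ b ih =>
    intro lam f C hf hC h
    have h' := sourceF₂_nbar lam hf h
    refine ih ((isDiffOp_sourceF₂ lam).smooth hf) ?_ h'
    exact mul_ne_zero hC (Nat.cast_ne_zero.2 (by omega))

theorem exists_sourceF₁Pow_nbar (a : ℕ) : ∀ {lam : Fin 3 → ℂ} {f : GL (Fin 3) ℝ → ℂ} {C : ℂ},
    SmoothGL f → C ≠ 0 →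
    ((fun p => f (nbar p)) =ᶠ[nhds 0] fun p => C * monomialFun (i + a) (j + a) 0 p) →
    ∃ C' : ℂ, C' ≠ 0 ∧
      (fun p => sourceF₁Pow a lam f (nbar p)) =ᶠ[nhds 0] fun p => C' * monomialFun i j 0 p := by
  induction a with
  | zero => exact fun _ hC h => ⟨_, hC, h⟩
  | succ a ih =>
    intro lam f C hf hC h
    have h' := sourceF₁_nbar lam hf h
    refine ih ((isDiffOp_sourceF₁ lam).smooth hf) ?_ h'
    exact mul_ne_zero (mul_ne_zero hC (Nat.cast_ne_zero.2 (by omega)))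
      (Nat.cast_ne_zero.2 (by omega))

/-- The lower triangular unipotent matrix of size two. -/
def nbarTwo (x : ℝ) : GL (Fin 2) ℝ :=
  Matrix.GeneralLinearGroup.mkOfDetNeZero !![1, 0; x, 1] (by simp [Matrix.det_fin_two])

theorem coe_nbarTwo (x : ℝ) : (nbarTwo x : Matrix (Fin 2) (Fin 2) ℝ) = !![1, 0; x, 1] := rfl

theorem embedGL_nbarTwo (x : ℝ) : embedGL (nbarTwo x) = nbar ![x, 0, 0] := by
  ext k l
  rw [coe_embedGL, coe_nbar, coe_nbarTwo]
  fin_cases k <;> fin_cases l <;> simp [embedMatrix, nbarMat]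

theorem nbarTwo_zero : nbarTwo 0 = 1 := by
  ext k l
  rw [coe_nbarTwo]
  fin_cases k <;> fin_cases l <;> simp

theorem epsGL_one_zero_nbarTwo {f : GL (Fin 2) ℝ → ℂ} (hf : SmoothGL f)
    (h : (fun x => f (nbarTwo x)) =ᶠ[nhds 0] fun x : ℝ => C * (x : ℂ) ^ i) :
    (fun x => epsGL 1 0 f (nbarTwo x)) =ᶠ[nhds 0] fun x : ℝ => C * i * (x : ℂ) ^ (i - 1) := by
  filter_upwards [h.eventually_nhds] with x hx
  have hcurve : HasDerivAt (fun s : ℝ => (nbarTwo s : Matrix (Fin 2) (Fin 2) ℝ))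
      ((nbarTwo x : Matrix (Fin 2) (Fin 2) ℝ) * Matrix.single 1 0 (1 : ℝ)) x := by
    have hM : ∀ s : ℝ, (nbarTwo s : Matrix (Fin 2) (Fin 2) ℝ) =
        1 + s • ((nbarTwo x : Matrix (Fin 2) (Fin 2) ℝ) * Matrix.single 1 0 (1 : ℝ)) := by
      intro s
      ext k l
      rw [coe_nbarTwo, coe_nbarTwo, Matrix.add_apply, Matrix.smul_apply, Matrix.mul_apply,
        Fin.sum_univ_two]
      fin_cases k <;> fin_cases l <;> simp
    rw [funext hM]
    have := ((hasDerivAt_id x).smul_const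
      ((nbarTwo x : Matrix (Fin 2) (Fin 2) ℝ) * Matrix.single 1 0 (1 : ℝ))).const_add 1
    rwa [one_smul] at this
  have h1 := hasDerivAt_comp_curve hf hcurve
  have h2 : HasDerivAt (fun s : ℝ => C * (s : ℂ) ^ i) (C * i * (x : ℂ) ^ (i - 1)) x := by
    have := ((hasDerivAt_id x).ofReal_comp.pow i).const_mul C
    simpa [mul_assoc] using this
  exact h1.unique (h2.congr_of_eventuallyEq hx)

theorem epsGL_iterate_nbarTwo_ne_zero (m : ℕ) : ∀ {f : GL (Fin 2) ℝ → ℂ} {C : ℂ}, SmoothGL f →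
    C ≠ 0 → ((fun x => f (nbarTwo x)) =ᶠ[nhds 0] fun x : ℝ => C * (x : ℂ) ^ m) →
    (epsGL 1 0)^[m] f 1 ≠ 0 := by
  induction m with
  | zero =>
    intro f C _ hC h
    have := h.eq_of_nhds
    simp only [nbarTwo_zero, pow_zero, mul_one] at this
    simpa [this] using hC
  | succ m ih =>
    intro f C hf hC h
    rw [Function.iterate_succ_apply]
    exact ih (hf.eps 1 0) (mul_ne_zero hC (Nat.cast_ne_zero.2 m.succ_ne_zero))
      (epsGL_one_zero_nbarTwo hf h)

/-- The operators differentiate `b + a` times in `y` and `a + m` times in `x`, exactly exhausting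
the monomial; every factor that appears is a positive exponent. -/
theorem breakingOp_one_ne_zero (m' m a b : ℕ) (lam : Fin 3 → ℂ) (hf : SmoothGL f)
    (h : (fun p => f (nbar p)) =ᶠ[nhds 0] monomialFun (m + a) (b + a) 0) :
    breakingOp m' m a b lam f 1 ≠ 0 := by
  have h0 : (fun p => f (nbar p)) =ᶠ[nhds 0] fun p => 1 * monomialFun (m + a) (a + b) 0 p := by
    simpa only [one_mul, add_comm a b] using h
  obtain ⟨C, hC, h₁⟩ := exists_sourceF₂Pow_nbar (lam := lam) b hf one_ne_zero h0
  have hs := (isDiffOp_sourceF₂Pow b lam).smooth hf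
  have h₁' : (fun p => sourceF₂Pow b lam f (nbar p)) =ᶠ[nhds 0]
      fun p => C * monomialFun (m + a) (0 + a) 0 p := by simpa only [zero_add] using h₁
  obtain ⟨C', hC', h₂⟩ := exists_sourceF₁Pow_nbar (lam := lam - (b : ℂ) • eHat 1) a hs hC h₁'
  have hsm : SmoothGL (rest₂ (sourceComp a b lam f)) :=
    isDiffOp_rest₂.smooth ((isDiffOp_sourceComp a b lam).smooth hf)
  have h₃ : (fun x => rest₂ (sourceComp a b lam f) (nbarTwo x)) =ᶠ[nhds 0]
      fun x : ℝ => C' * (x : ℂ) ^ m := by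
    have ht : Filter.Tendsto (fun x : ℝ => (![x, 0, 0] : Fin 3 → ℝ)) (nhds 0) (nhds 0) := by
      have hc : Continuous fun x : ℝ => (![x, 0, 0] : Fin 3 → ℝ) := by
        refine continuous_pi fun k => ?_
        fin_cases k
        · exact continuous_id
        · exact continuous_const
        · exact continuous_const
      have h0 : (![0, 0, 0] : Fin 3 → ℝ) = 0 := by
        ext k; fin_cases k <;> rfl
      have := hc.tendsto 0
      rwa [h0] at this
    filter_upwards [ht.eventually h₂] with x hx
    rw [rest₂, embedGL_nbarTwo]
    refine hx.trans ?_
    simp [monomialFun]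
  have := epsGL_iterate_nbarTwo_ne_zero m hsm hC' h₃
  simpa [breakingOp, untwist] using this

end nonvanishing

/-! ### One-dimensionality and the main theorem. -/

section uniqueness

variable {ξ : Fin 3 → ZMod 2} {lam : Fin 3 → ℂ} {η : Fin 2 → ZMod 2} {nu : Fin 2 → ℂ}

/-- With `L` the lift of `x^n₁ y^n₂`, the linear form `T ↦ (T L)(1)` is injective on `DSBO₂` and
nonzero on the constructed operator. -/
theorem exists_basis_breakingOp {m a b : ℕ}
    (hn₁ : nu 0 - lam 0 - 1 / 2 = (m + a : ℂ))
    (hn₂ : nu 0 + nu 1 - lam 0 - lam 1 - 1 = (b + a : ℂ))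
    (hη₁ : η 0 = ξ 0 + (m + a : ZMod 2))
    (hη₂ : η 1 = ξ 1 + (m + a + (b + a) : ZMod 2))
    (hm : m = 0 ∨ lam 0 - lam 1 + m - b + a = 0) :
    ∃ B : Module.Basis (Fin 1) ℂ (DSBO₂ ξ lam η nu), ∀ f : PrincipalSeries 3 ξ lam,
      ((B 0).1 f).toFun = breakingOp (b + a) m a b lam f.toFun := by
  obtain ⟨T₀, hT₀, hT₀f⟩ := exists_breakingOp_mem_DSBO hn₁ hn₂ hη₁ hη₂ hm
  let L : PrincipalSeries 3 ξ lam := liftPS ξ lam (contDiff_monomialFun (m + a) (b + a) 0)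
  have hL : T₀ L 1 ≠ 0 := by
    rw [hT₀f]
    exact breakingOp_one_ne_zero _ _ _ _ _ L.smooth
      (liftPS_nbar_eventually ξ lam (contDiff_monomialFun _ _ _))
  have huniq : ∀ T ∈ DSBO₂ ξ lam η nu, T L 1 = 0 → T = 0 := fun T hT h0 => by
    have hv := isJetFunctional_jetFunctional hT (n₁ := m + a) (n₂ := b + a)
      (by rw [hn₁]; push_cast; rfl) (by rw [hn₂]; push_cast; rfl)
    refine DSBO₂.eq_zero_of_jetFunctional hT fun Φ hΦ => hv.eq_zero ?_ hΦ
    rw [jetFunctional_apply (contDiff_monomialFun _ _ _)]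
    exact h0
  let e : Fin 1 → DSBO₂ ξ lam η nu := fun _ => ⟨T₀, hT₀⟩
  have hli : LinearIndependent ℂ e := by
    refine linearIndependent_unique_iff.2 fun h => hL ?_
    have : T₀ = 0 := congrArg Subtype.val h
    rw [this]
    rfl
  have hspan : ⊤ ≤ Submodule.span ℂ (Set.range e) := by
    rintro ⟨T, hT⟩ -
    have hz : T - (T L 1 / T₀ L 1) • T₀ = 0 := by
      refine huniq _ (Submodule.sub_mem _ hT (Submodule.smul_mem _ _ hT₀)) ?_
      change T L 1 - T L 1 / T₀ L 1 * T₀ L 1 = 0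
      rw [div_mul_cancel₀ _ hL, sub_self]
    have he : (⟨T, hT⟩ : DSBO₂ ξ lam η nu) = (T L 1 / T₀ L 1) • e 0 :=
      Subtype.ext (sub_eq_zero.1 hz)
    rw [he]
    exact Submodule.smul_mem _ _ (Submodule.subset_span ⟨0, rfl⟩)
  refine ⟨Module.Basis.mk hli hspan, fun f => ?_⟩
  rw [Module.Basis.mk_apply]
  exact hT₀f f

end uniqueness

end

theorem proposition5p6
    (ξ : Fin 3 → ZMod 2) (lam : Fin 3 → ℂ) (η : Fin 2 → ZMod 2) (nu : Fin 2 → ℂ)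
    (n₁ n₂ : ℕ)
    (hn₁ : nu 0 - lam 0 - 1 / 2 = (n₁ : ℂ))
    (hn₂ : nu 0 + nu 1 - lam 0 - lam 1 - 1 = (n₂ : ℂ))
    (hη₁ : η 0 = ξ 0 + (n₁ : ZMod 2))
    (hη₂ : η 1 = ξ 1 + ((n₁ + n₂ : ℕ) : ZMod 2)) :
    (n₁ ≤ n₂ →
      ∃ b : Module.Basis (Fin 1) ℂ (DSBO₂ ξ lam η nu),
        ∀ (f : PrincipalSeries 3 ξ lam) (h : GL (Fin 2) ℝ),
          (b 0).1 f h = untwist n₂ (rest₂ (sourceComp n₁ (n₂ - n₁) lam f)) h) ∧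
    (n₂ < n₁ → ∀ k₀ : ℕ, k₀ ≤ n₂ →
      lam 0 - lam 1 + (n₁ : ℂ) - (n₂ : ℂ) + (k₀ : ℂ) = 0 →
      ∃ b : Module.Basis (Fin 1) ℂ (DSBO₂ ξ lam η nu),
        ∀ (f : PrincipalSeries 3 ξ lam) (h : GL (Fin 2) ℝ),
          (b 0).1 f h =
            untwist n₂
              ((epsGL 1 0)^[n₁ - k₀] (rest₂ (sourceComp k₀ (n₂ - k₀) lam f))) h) := by
  -- Both cases are instances of one family: `a = n₁`, `m = 0` in the first and `a = k₀` in the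
  -- second.
  have key : ∀ {m a b : ℕ}, m + a = n₁ → b + a = n₂ →
      (m = 0 ∨ lam 0 - lam 1 + m - b + a = 0) →
      ∃ B : Module.Basis (Fin 1) ℂ (DSBO₂ ξ lam η nu), ∀ f : PrincipalSeries 3 ξ lam,
        ((B 0).1 f).toFun = breakingOp n₂ m a b lam f.toFun := by
    rintro m a b rfl rfl hm
    push_cast at hn₁ hn₂ hη₁ hη₂
    exact exists_basis_breakingOp hn₁ hn₂ hη₁ hη₂ hm
  refine ⟨fun hle => ?_, fun hlt k₀ hk hlam => ?_⟩
  · obtain ⟨B, hB⟩ := key (m := 0) (zero_add n₁) (Nat.sub_add_cancel hle) (Or.inl rfl)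
    exact ⟨B, fun f h => congrFun (hB f) h⟩
  · obtain ⟨B, hB⟩ := key (m := n₁ - k₀) (Nat.sub_add_cancel (hk.trans hlt.le))
      (Nat.sub_add_cancel hk) (Or.inr (by
        push_cast [Nat.cast_sub hk, Nat.cast_sub (hk.trans hlt.le)]
        linear_combination hlam))
    exact ⟨B, fun f h => congrFun (hB f) h⟩
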